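/- Let $p$ be an odd prime, $k$ an algebraic closure of $\mathbb F_p$, and let $(V,\langle\,,\rangle)$ be a symplectic vector space of dimension $2m$ over $\mathbb F_p$, with a basis $e_1,\dots,e_{2m}$ such that $\langle e_a,e_{2m+1-b}\rangle=\pm\delta_{ab}$. Let $\Phi$ be the Frobenius of $V_k=V\otimes k$. Let $s_j$ ($1\le j\le m-1$) be the permutation of the basis exchanging $e_j$ and $e_{j+1}$, and $e_{2m+1-j}$ and $e_{2m-j}$, and let $s_m$ exchange $e_m$ and $e_{m+1}$; these are the simple reflections of the Weyl group of $G=\mathrm{Sp}(V_k)$. For $0\le i\le m$ put $w_i=s_{m+1-i}\cdots s_m$, and let $P_i\subset G$ be the standard parabolic subgroup attached to $\{s_1,\dots,s_{m-1-i}\}$ (with $P_m=P_{m-1}=B$ the Borel subgroup), so that $G/P_i$ is the variety over $k$ of totally isotropic flags $F_{m-i}\subset F_{m-i+1}\subset\dots\subset F_m$ in $V_k$ with $\dim F_d=d$. Two such flags $F,F'$ have relative position $w$ if $(F,F')$ lies in the $G$-orbit of $(wF^{\rm std},F^{\rm std})$, where $F^{\rm std}_d=\langle e_1,\dots,e_d\rangle$,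 and the generalized Deligne–Lusztig variety $X_{P_i}(w)\subset G/P_i$ consists of the flags $F$ in relative position $w$ to $\Phi(F)$. Put $S_i=X_{P_i}(w_i)$; for $i=m$ this is the Deligne–Lusztig variety $X_B(s_1\cdots s_m)$ of the standard Coxeter element. Let $S_V\subset G/P_0$ be the variety of Lagrangian subspaces $U\subset V_k$ with $\dim(U\cap\Phi(U))\ge m-1$. All of these are varieties over $k$, described by their $k$-points. Then, for every $0\le i\le m$: (a) $S_i$ has pure dimension $i$, i.e. each of its irreducible components has dimension $i$. (b) The irreducible components of $S_i$ are indexed by the totally isotropic subspaces $W$ of $V$ (over $\mathbb F_p$) of dimension $m-i$: the map $W\mapsto X_W=\{F\in S_i\mid F_{m-i}=W\otimes k\}$ is a bijection from the set of these $W$ onto the set of irreducible components of $S_i$. (c) Let $W$ be such a subspace; then $W^\perp/W$ with the induced form is a symplectic space of dimension $2i$. The component $X_W$ is isomorphic to the Deligne–Lusztig variety of $\mathrm{Sp}(W^\perp/W)$ for its standard Coxeter element $s'_1\cdots s'_i$ (with respect to any basis of $W^\perp/W$ of the above kind). The map $F\mapsto F_m$ sends $S_i$ into $S_V$, and the closure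 in $S_V$ of the image of $X_W$ is isomorphic to $S_{W^\perp/W}$, the variety defined in the same way as $S_V$ for the symplectic space $W^\perp/W$. -/

import Mathlib

open scoped TensorProduct

noncomputable section

namespace DLSymplectic

/-! ### Zariski topology and polynomial functions on a finite-dimensional vector space -/

section Affine

variable (k : Type*) [Field k] (M : Type*) [AddCommGroup M] [Module k M]

/-- The algebra of polynomial functions `M → k`: it is generated by the linear functionals. -/
def polyFun : Subalgebra k (M → k) :=
  Algebra.adjoin k (Set.range fun f : Module.Dual k M => (f : M → k))

/-- The Zariski topology on `M`, generated by the basic open sets `{x | f x ≠ 0}`. -/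
@[reducible]
def zariskiTopology : TopologicalSpace M :=
  TopologicalSpace.generateFrom {U | ∃ f ∈ polyFun k M, U = {x | f x ≠ 0}}

end Affine

/-! ### Varieties of isotropic flags -/

section Flags

variable {k : Type*} [Field k] {E : Type*} [AddCommGroup E] [Module k E]

/-- Totally isotropic flags `F_{m-i} ⊆ F_{m-i+1} ⊆ ⋯ ⊆ F_m` with `dim F_d = d`; here
`space j = F_{m-i+j}`. When `E` is a symplectic space of dimension `2m`, these are the points of
`G/P_i`, where `G = Sp(E)` and `P_i` is the standard parabolic subgroup attached to the set
`{1, …, m-1-i}` of simple reflections. For `i = 0` they are the Lagrangian subspaces (`G/P`, with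
`P` the Siegel parabolic), for `i = m` the complete isotropic flags (`G/B`). -/
@[ext]
structure IsotropicFlag (β : LinearMap.BilinForm k E) (m : ℕ) (i : Fin (m + 1)) where
  space : Fin (i.val + 1) → Submodule k E
  mono : Monotone space
  finrank_space : ∀ j, Module.finrank k (space j) = m - i.val + j.val
  isotropic : ∀ j, ∀ x ∈ space j, ∀ y ∈ space j, β x y = 0

/-- Bases of `m`-dimensional totally isotropic subspaces. They form a locally closed subset of the
vector space `E^m`. -/
structure IsotropicFrame (β : LinearMap.BilinForm k E) (m : ℕ) where
  vec : Fin m → E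
  linearIndependent : LinearIndependent k vec
  isotropic : ∀ a b, β (vec a) (vec b) = 0

/-- The flag of a frame `v_1, …, v_m`: its member of dimension `d` is spanned by
`v_1, …, v_d`. -/
def IsotropicFrame.flag {β : LinearMap.BilinForm k E} {m : ℕ} (v : IsotropicFrame β m)
    (i : Fin (m + 1)) : IsotropicFlag β m i where
  space j := Submodule.span k (v.vec '' {a | a.val < m - i.val + j.val})
  mono := by
    intro j j' h
    refine Submodule.span_mono (Set.image_mono ?_)
    intro a ha
    have h' : j.val ≤ j'.val := h
    simp only [Set.mem_ofPred_eq] at ha ⊢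
    omega
  finrank_space := by
    intro j
    have hi := i.isLt
    have hj := j.isLt
    have h1 : LinearIndependent k
        (fun a : {a : Fin m | a.val < m - i.val + j.val} => v.vec a) :=
      v.linearIndependent.comp _ Subtype.val_injective
    have h2 := finrank_span_eq_card h1
    have h3 : Set.range (fun a : {a : Fin m | a.val < m - i.val + j.val} => v.vec a)
        = v.vec '' {a | a.val < m - i.val + j.val} := by
      rw [Set.image_eq_range]
    rw [h3] at h2
    rw [h2]
    have h4 : m - i.val + j.val ≤ m := by omega
    rw [← Nat.card_eq_fintype_card]
    change Nat.card {a : Fin m // a.val < m - i.val + j.val} = _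
    rw [Nat.card_eq_fintype_card, Fintype.card_subtype]
    exact (Fin.card_filter_val_lt ..).trans (min_eq_right h4)
  isotropic := by
    intro j x hx y hy
    have key : ∀ a, β (v.vec a) y = 0 := by
      intro a
      induction hy using Submodule.span_induction with
      | mem y hy => obtain ⟨b, -, rfl⟩ := hy; exact v.isotropic a b
      | zero => simp
      | add y z _ _ h1 h2 => simp [h1, h2]
      | smul c y _ h => simp [h]
    induction hx using Submodule.span_induction with
    | mem x hx => obtain ⟨a, -, rfl⟩ := hx; exact key a
    | zero => simp
    | add x z _ _ h1 h2 => simp [h1, h2]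
    | smul c x _ h => simp [h]

variable (β : LinearMap.BilinForm k E) (m : ℕ)

/-- The subspace topology of the Zariski topology of `E^m`. -/
instance : TopologicalSpace (IsotropicFrame β m) :=
  (zariskiTopology k (Fin m → E)).induced IsotropicFrame.vec

/-- The Zariski topology of the flag variety, as the quotient of the variety of frames (a Zariski
locally trivial torsor over the flag variety under a parabolic subgroup of `GL_m`). -/
instance (i : Fin (m + 1)) : TopologicalSpace (IsotropicFlag β m i) :=
  TopologicalSpace.coinduced (fun v : IsotropicFrame β m => v.flag i) inferInstance

variable {β m}

/-- Regular functions on an open subset `U` of a subvariety `X` of the flag variety: pulled back to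
the frames of the flags in `U`, the function is locally a quotient of polynomial functions. (The
frames have local algebraic sections over the flag variety, so this is the usual notion.) -/
def IsRegularOn {i : Fin (m + 1)} {X : Set (IsotropicFlag β m i)} (U : Set X) (f : X → k) : Prop :=
  ∀ (v : IsotropicFrame β m) (hv : v.flag i ∈ X), (⟨v.flag i, hv⟩ : X) ∈ U →
    ∃ a ∈ polyFun k (Fin m → E), ∃ b ∈ polyFun k (Fin m → E), b v.vec ≠ 0 ∧
      ∀ (u : IsotropicFrame β m) (hu : u.flag i ∈ X), (⟨u.flag i, hu⟩ : X) ∈ U →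
        b u.vec ≠ 0 → f ⟨u.flag i, hu⟩ = a u.vec / b u.vec

/-- Isomorphy of subvarieties of two flag varieties: a homeomorphism under which the regular
functions on open subsets correspond to each other. -/
def IsIsomorphicTo {E' : Type*} [AddCommGroup E'] [Module k E']
    {β' : LinearMap.BilinForm k E'} {m' : ℕ} {i : Fin (m + 1)} {i' : Fin (m' + 1)}
    (X : Set (IsotropicFlag β m i)) (Y : Set (IsotropicFlag β' m' i')) : Prop :=
  ∃ φ : X ≃ₜ Y, ∀ (U : Set Y), IsOpen U → ∀ f : Y → k,
    IsRegularOn U f ↔ IsRegularOn (φ ⁻¹' U) (f ∘ φ)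

/-- The morphism `G/P_i → G/P` sending a flag to its last member `F_m`. -/
def IsotropicFlag.last {i : Fin (m + 1)} (F : IsotropicFlag β m i) : IsotropicFlag β m 0 where
  space _ := F.space (Fin.last i.val)
  mono := monotone_const
  finrank_space j := by
    have hi := i.isLt
    have hj : j.val = 0 := by have := j.isLt; simp at this; omega
    rw [F.finrank_space, hj]
    simp
    omega
  isotropic _ := F.isotropic _

end Flags

/-! ### The Weyl group of `Sp_{2m}` -/

/-- The index `j ∈ {0, …, m-1}` as an index of a basis of a `2m`-dimensional space. -/
def idx {m : ℕ} (j : Fin m) : Fin (2 * m) := ⟨j.val, by omega⟩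

/-- The simple reflections, as permutations of the basis indices (counted from `0`). For `j + 1 < m`
it exchanges `j` and `j + 1`, and also their mirror images; the last one exchanges
`m - 1` and `m`. -/
def simpleReflection {m : ℕ} (j : Fin m) : Equiv.Perm (Fin (2 * m)) :=
  if h : j.val + 1 < m then
    Equiv.swap (idx j) (idx ⟨j.val + 1, h⟩) *
      Equiv.swap (idx j).rev (idx ⟨j.val + 1, h⟩).rev
  else Equiv.swap (idx j) (idx j).rev

/-- `w_i`, the product in increasing order of the last `i` simple reflections. In particular
`w_m` is the standard Coxeter element, the product `s_1 ⋯ s_m` of all simple reflections. -/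
def weylElt (m i : ℕ) : Equiv.Perm (Fin (2 * m)) :=
  (((List.finRange m).drop (m - i)).map simpleReflection).prod

/-! ### Symplectic spaces over `𝔽_p` and their generalized Deligne–Lusztig varieties -/

section DeligneLusztig

variable {p : ℕ} [Fact p.Prime] {V : Type*} [AddCommGroup V] [Module (ZMod p) V]

/-- Bases `e_1, …, e_{2m}` of `V` with `⟨e_a, e_{2m+1-b}⟩ = ±δ_{ab}`. -/
def IsSymplecticBasis (B : LinearMap.BilinForm (ZMod p) V) {m : ℕ}
    (e : Module.Basis (Fin (2 * m)) (ZMod p) V) : Prop :=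
  ∀ a b, (a = b → B (e a) (e b.rev) = 1 ∨ B (e a) (e b.rev) = -1) ∧
    (a ≠ b → B (e a) (e b.rev) = 0)

/-- Totally isotropic subspaces. -/
def IsIsotropic (B : LinearMap.BilinForm (ZMod p) V) (W : Submodule (ZMod p) V) : Prop :=
  ∀ x ∈ W, ∀ y ∈ W, B x y = 0

/-- The space `W^⊥/W`; formally the quotient of `W^⊥` by `W ∩ W^⊥`, which is `W` when `W` is
isotropic. -/
abbrev PerpQuot (B : LinearMap.BilinForm (ZMod p) V) (W : Submodule (ZMod p) V) : Type _ :=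
  B.orthogonal W ⧸ W.submoduleOf (B.orthogonal W)

/-- The alternating form induced on `W^⊥/W`. -/
def perpQuotForm (B : LinearMap.BilinForm (ZMod p) V) (hB : B.IsAlt)
    (W : Submodule (ZMod p) V) : LinearMap.BilinForm (ZMod p) (PerpQuot B W) :=
  LinearMap.liftQ₂ (W.submoduleOf (B.orthogonal W)) (W.submoduleOf (B.orthogonal W))
    (B.restrict (B.orthogonal W))
    (by
      intro x hx
      rw [LinearMap.mem_ker]
      ext y
      exact y.2 x hx)
    (by
      intro y hy
      rw [LinearMap.mem_ker]
      ext x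
      have h : B y x = 0 := x.2 y hy
      have h' : B x y = 0 := by rw [← hB.neg_eq, h, neg_zero]
      exact h')

variable (k : Type*) [Field k] [Algebra (ZMod p) k]

/-- The Frobenius of `k ⊗ V`, with `c ⊗ x ↦ c ^ p ⊗ x`. -/
def frob (V : Type*) [AddCommGroup V] [Module (ZMod p) V] :
    k ⊗[ZMod p] V →ₗ[ZMod p] k ⊗[ZMod p] V :=
  (FiniteField.frobeniusAlgHom (ZMod p) k).toLinearMap.rTensor V

variable {k}

/-- The Frobenius translate `Φ(U)` of a subspace `U` of `k ⊗ V`, spanned by the image of `U`. -/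
def frobSpace (U : Submodule k (k ⊗[ZMod p] V)) : Submodule k (k ⊗[ZMod p] V) :=
  Submodule.span k (frob k V '' U)

/-- The member of dimension `d` of the `w`-translate of the standard flag: the span in `k ⊗ V` of
`e_{w(1)}, …, e_{w(d)}`. -/
def stdSpace (k : Type*) [Field k] [Algebra (ZMod p) k] {m : ℕ}
    (e : Module.Basis (Fin (2 * m)) (ZMod p) V) (w : Equiv.Perm (Fin (2 * m))) (d : ℕ) :
    Submodule k (k ⊗[ZMod p] V) :=
  Submodule.span k ((fun a => (1 : k) ⊗ₜ[ZMod p] e (w a)) '' {a | a.val < d})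

/-- The pair `(F, F')` of flags of type `P_i` has relative position `w`: it lies in the orbit of
`(w P_i, P_i)` under the symplectic group of `k ⊗ V`. This is the normalization opposite to the one
of Deligne and Lusztig. -/
def HasRelPos (B : LinearMap.BilinForm (ZMod p) V) {m : ℕ}
    (e : Module.Basis (Fin (2 * m)) (ZMod p) V) (i : Fin (m + 1)) (w : Equiv.Perm (Fin (2 * m)))
    (F F' : Fin (i.val + 1) → Submodule k (k ⊗[ZMod p] V)) : Prop :=
  ∃ g : (k ⊗[ZMod p] V) ≃ₗ[k] (k ⊗[ZMod p] V),
    (∀ x y, B.baseChange k (g x) (g y) = B.baseChange k x y) ∧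
    ∀ j, F j = (stdSpace k e w (m - i.val + j.val)).map g.toLinearMap ∧
      F' j = (stdSpace k e 1 (m - i.val + j.val)).map g.toLinearMap

variable (k)

/-- The generalized Deligne–Lusztig variety `X_{P_i}(w)`: the flags of type `P_i` that are in
relative position `w` to their Frobenius translate. -/
def DLVariety (B : LinearMap.BilinForm (ZMod p) V) {m : ℕ}
    (e : Module.Basis (Fin (2 * m)) (ZMod p) V) (i : Fin (m + 1)) (w : Equiv.Perm (Fin (2 * m))) :
    Set (IsotropicFlag (B.baseChange k) m i) :=
  {F | HasRelPos B e i w F.space fun j => frobSpace (F.space j)}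

/-- The stratum `S_i = X_{P_i}(w_i)`. -/
def stratum (B : LinearMap.BilinForm (ZMod p) V) {m : ℕ}
    (e : Module.Basis (Fin (2 * m)) (ZMod p) V) (i : Fin (m + 1)) :
    Set (IsotropicFlag (B.baseChange k) m i) :=
  DLVariety k B e i (weylElt m i.val)

/-- The Deligne–Lusztig variety `X_B(w)` of the symplectic group, for the standard Coxeter element
`w = s_1 ⋯ s_m`. -/
def coxeterDLVariety (B : LinearMap.BilinForm (ZMod p) V) {m : ℕ}
    (e : Module.Basis (Fin (2 * m)) (ZMod p) V) :
    Set (IsotropicFlag (B.baseChange k) m (Fin.last m)) :=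
  DLVariety k B e (Fin.last m) (weylElt m m)

/-- The variety `S_V` of Lagrangian subspaces `U` of `k ⊗ V` with `dim (U ∩ Φ(U)) ≥ m - 1`. -/
def lagrangianVariety (B : LinearMap.BilinForm (ZMod p) V) (m : ℕ) :
    Set (IsotropicFlag (B.baseChange k) m 0) :=
  {U | m ≤ Module.finrank k ↥(U.space 0 ⊓ frobSpace (U.space 0)) + 1}

/-- `X_W`, the set of points of the stratum `S_i` whose first member `F_{m-i}` is `k ⊗ W`. -/
def component (B : LinearMap.BilinForm (ZMod p) V) {m : ℕ}
    (e : Module.Basis (Fin (2 * m)) (ZMod p) V) (i : Fin (m + 1)) (W : Submodule (ZMod p) V) :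
    Set (IsotropicFlag (B.baseChange k) m i) :=
  {F | F ∈ stratum k B e i ∧ F.space 0 = W.baseChange k}

end DeligneLusztig

end DLSymplectic

end

open scoped TensorProduct
noncomputable section
namespace DLSymplectic

/-! ### Polynomials with exponents less than p in each variable. -/

section ReducedForm

variable {p : ℕ} {σ : Type*} [Fintype σ] [DecidableEq σ]

/-! For a flag F of type P_i write F_j for its member of dimension m - i + j. Being in position w_i
to Φ(F) amounts to incidences: F_0 = Φ F_0, F_j ⊆ Φ F_{j+1}, and F_j ≠ Φ F_j for j ≠ 0
(`mem_stratum_iff`). They suffice because a pair of flags with these incidences can be fitted to a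
hyperbolic basis with prescribed signs (`exists_hyperbolic_of_flags`), and two such bases differ by
an isometry. By Frobenius descent (`baseChange_rationalVectors`) F_0 = W ⊗ k for a unique isotropic
W, and passage to W^⊥/W identifies X_W with the Coxeter variety of Sp(W^⊥/W). The X_W are finitely
many, closed, disjoint and cover S_i. So (a) and (b) follow once the Coxeter variety is known to be
irreducible, of dimension the rank.

A flag in the Coxeter variety of rank n + 1 is spanned step by step by Φ^n x, …, Φ x, x, where ⟨x,
Φ^j x⟩ = 0 for 1 ≤ j ≤ n and ⟨x, Φ^{n+1} x⟩ ≠ 0. One coordinate of such an x never vanishes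
(`IsCone.ne_zero`). Normalizing it to 1 gives an affine slice homeomorphic to the variety
(`isHomeomorph_coxeterMap`); a homeomorphism is enough for irreducibility and dimension, and it
avoids extracting the p^n-th roots that recover x from the line of the flag.

The slice is treated by induction on the rank. Write a point of the next slice as (a, 1, x) and put
y = Φ x - x. Then the conditions say that y lies in the cone of the smaller rank and that a^p - a =
⟨x, y⟩ (`isCone_extendVec_iff`). The smaller cone consists of the scalar multiples t z of points z
of its slice, so over it the larger slice is a tower of Artin–Schreier coverings. At the generic
point, t z is independent modulo the elements w^p - w of L(t), by looking at degrees in t. So every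
translation of x by a vector over 𝔽_p is a Galois automorphism, and commutators of these translate a
by 2⟨v, w⟩. As p is odd, all of the Heisenberg group occurs. A polynomial relation at the new point
then survives all translations and must hold on the whole slice (`eval_eq_zero_of_generic`), which
makes the slice irreducible. The transcendence degree grows by one, from t.

For the closure in (c), a Lagrangian subspace in S_V without rational vectors comes from the Coxeter
variety, through the sequence D, D ∩ Φ D, D ∩ Φ D ∩ Φ² D, …. Around any point, S_V is described by
graphs of symmetric matrices A with A^(p) - A = x xᵀ. When x has 𝔽_p-independent coordinates the
graph contains no rational vector. Such x are dense and A ↦ A^(p) - A is open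
(`exists_artinSchreier_ne_zero`), so the image of the Coxeter variety is dense in S_V
(`lagrangianVariety_subset_closure`). Applied to W^⊥/W, and since containing W is a closed
condition, this shows that the closure of the image of X_W is the set of points of S_V that contain
W, which is S_{W^⊥/W}. -/

theorem prod_pow_update {R : Type*} [CommRing R] (x : σ → R) (α : σ → Fin p) (i : σ)
    (e : Fin p) :
    ∏ j, x j ^ (Function.update α i e j : ℕ)
      = x i ^ (e : ℕ) * ∏ j ∈ Finset.univ.erase i, x j ^ (α j : ℕ) := by
  rw [← Finset.mul_prod_erase Finset.univ _ (Finset.mem_univ i), Function.update_self]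
  congr 1
  refine Finset.prod_congr rfl fun j hj => ?_
  rw [Function.update_of_ne (Finset.ne_of_mem_erase hj)]

/-- If `x_i ^ p - x_i` lies in `S` for all `i`, then every element of `S[x]` is a combination of
the monomials in the `x_i` with exponents less than `p`. -/
theorem exists_reduced_form {S R : Type*} [CommRing S] [CommRing R] [Algebra S R] (hp : 1 < p)
    (x : σ → R) (c : σ → S) (hx : ∀ i, x i ^ p = x i + algebraMap S R (c i)) {r : R}
    (hr : r ∈ Algebra.adjoin S (Set.range x)) :
    ∃ d : (σ → Fin p) → S, r = ∑ α, algebraMap S R (d α) * ∏ i, x i ^ (α i : ℕ) := by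
  set T : Submodule S R := Submodule.span S (Set.range fun α : σ → Fin p => ∏ i, x i ^ (α i : ℕ))
    with hT
  have hgen : ∀ α : σ → Fin p, ∏ i, x i ^ (α i : ℕ) ∈ T := fun α =>
    Submodule.subset_span ⟨α, rfl⟩
  have hmul : ∀ i, ∀ t ∈ T, x i * t ∈ T := by
    intro i t ht
    induction ht using Submodule.span_induction with
    | mem t ht =>
      obtain ⟨α, rfl⟩ := ht
      dsimp only
      have h0 : ∏ j, x j ^ (α j : ℕ)
          = x i ^ (α i : ℕ) * ∏ j ∈ Finset.univ.erase i, x j ^ (α j : ℕ) :=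
        (Finset.mul_prod_erase Finset.univ _ (Finset.mem_univ i)).symm
      rw [h0, ← mul_assoc, ← pow_succ']
      -- Only the exponent p - 1 overflows; then x_i ^ p is replaced by x_i + c_i, giving the
      -- exponents 1 and 0.
      by_cases h : (α i : ℕ) + 1 < p
      · have := hgen (Function.update α i ⟨_, h⟩)
        rwa [prod_pow_update] at this
      · have h' : (α i : ℕ) + 1 = p := by have := (α i).isLt; omega
        rw [h', hx, add_mul]
        refine T.add_mem ?_ ?_
        · have := hgen (Function.update α i ⟨1, hp⟩)
          rwa [prod_pow_update, pow_one] at this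
        · have := hgen (Function.update α i ⟨0, by omega⟩)
          rw [prod_pow_update, pow_zero, one_mul] at this
          rw [← Algebra.smul_def]
          exact T.smul_mem _ this
    | zero => simp
    | add a b _ _ ha hb => rw [mul_add]; exact T.add_mem ha hb
    | smul s a _ ha => rw [mul_smul_comm]; exact T.smul_mem _ ha
  have h1 : (1 : R) ∈ T := by
    have := hgen fun _ => ⟨0, by omega⟩
    simpa using this
  have key : ∀ t ∈ T, r * t ∈ T := by
    induction hr using Algebra.adjoin_induction with
    | mem a ha => obtain ⟨i, rfl⟩ := ha; exact hmul i
    | algebraMap s => intro t ht; rw [← Algebra.smul_def]; exact T.smul_mem _ ht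
    | add a b _ _ ha hb => intro t ht; rw [add_mul]; exact T.add_mem (ha t ht) (hb t ht)
    | mul a b _ _ ha hb => intro t ht; rw [mul_assoc]; exact ha _ (hb t ht)
  have hrT : r ∈ T := by simpa using key 1 h1
  obtain ⟨d, hd⟩ := (Submodule.mem_span_range_iff_exists_fun S).1 hrT
  exact ⟨d, by simp only [← Algebra.smul_def]; exact hd.symm⟩

/-- A combination of monomials with exponents less than `p` that vanishes at all translates of a
point by vectors over `𝔽_p` is zero. -/
theorem reduced_form_eq_zero [Fact p.Prime] {R : Type*} [CommRing R] [IsDomain R]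
    [Algebra (ZMod p) R] (x : σ → R) (d : (σ → Fin p) → R)
    (h : ∀ g : σ → ZMod p,
      ∑ α, d α * ∏ i, (x i + algebraMap (ZMod p) R (g i)) ^ (α i : ℕ) = 0) : d = 0 := by
  classical
  let ex : (σ → Fin p) → (σ →₀ ℕ) := fun α => Finsupp.equivFunOnFinite.symm fun i => (α i : ℕ)
  have hex : Function.Injective ex := by
    intro α β hαβ
    ext i
    exact DFunLike.congr_fun hαβ i
  let P : MvPolynomial σ R := ∑ α, MvPolynomial.monomial (ex α) (d α)
  have hp0 : 0 < p := (Fact.out : p.Prime).pos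
  -- In each variable the degree is less than p, while P vanishes on a grid with p distinct values
  -- in each direction.
  have hP : P = 0 := by
    refine MvPolynomial.eq_zero_of_eval_zero_at_prod_finset P
      (fun i => Finset.univ.image fun g : ZMod p => x i + algebraMap (ZMod p) R g) ?_ ?_
    · intro i
      rw [Finset.card_image_of_injective, Finset.card_univ, ZMod.card]
      · refine lt_of_le_of_lt (MvPolynomial.degreeOf_sum_le i _ _) ?_
        rw [Finset.sup_lt_iff hp0]
        intro α _
        refine lt_of_le_of_lt (b := (α i : ℕ)) ?_ (α i).isLt
        by_cases hd : d α = 0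
        · simp [hd]
        · rw [MvPolynomial.degreeOf_monomial_eq _ _ hd]; rfl
      · intro a b hab
        exact (algebraMap (ZMod p) R).injective (add_left_cancel hab)
    · intro y hy
      have : ∀ i, ∃ g : ZMod p, x i + algebraMap (ZMod p) R g = y i := by
        intro i; simpa using hy i
      choose g hg using this
      rw [← h g]
      simp only [P, map_sum, MvPolynomial.eval_monomial]
      refine Finset.sum_congr rfl fun α _ => ?_
      congr 1
      rw [Finsupp.prod_fintype _ _ (by simp)]
      refine Finset.prod_congr rfl fun i _ => ?_
      rw [← hg]; rfl
  ext α
  have h1 : MvPolynomial.coeff (ex α) P = d α := by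
    simp only [P, MvPolynomial.coeff_sum, MvPolynomial.coeff_monomial, hex.eq_iff]
    simp
  rw [← h1, hP]; simp

end ReducedForm

/-! ### Openness of the Artin–Schreier map A ↦ A^p - A -/

section ArtinSchreierTrace

open MvPolynomial

variable {p : ℕ} [Fact p.Prime] {σ : Type*} [Fintype σ] [DecidableEq σ]
  {k : Type*} [Field k] [Algebra (ZMod p) k]

theorem algebraMap_zmod_pow {R : Type*} [CommRing R] [Algebra (ZMod p) R] (g : ZMod p) :
    (algebraMap (ZMod p) R g) ^ p = algebraMap (ZMod p) R g := by
  rw [← map_pow, ZMod.pow_card]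

theorem mem_adjoin_of_mem_adjoin {R : Type*} [CommRing R] [Algebra k R] (S : Subalgebra k R)
    (s : Set R) {r : R} (hr : r ∈ Algebra.adjoin k s) : r ∈ Algebra.adjoin S s := by
  have : Algebra.adjoin k s ≤ (Algebra.adjoin S s).restrictScalars k :=
    Algebra.adjoin_le Algebra.subset_adjoin
  exact this hr

/-- A polynomial that is invariant under all translations by vectors over `𝔽_p` is a polynomial in
the `X_i ^ p - X_i`. -/
theorem exists_eq_of_translation_invariant (F : MvPolynomial σ k)
    (hF : ∀ g : σ → ZMod p, aeval (fun i => X i + C (algebraMap (ZMod p) k (g i))) F = F) :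
    ∃ F0 : MvPolynomial σ k, ∀ A : σ → k, eval A F = eval (fun i => A i ^ p - A i) F0 := by
  have : CharP (MvPolynomial σ k) p := by
    have : CharP k p := (Algebra.charP_iff (ZMod p) k p).1 inferInstance
    infer_instance
  let φ : MvPolynomial σ k →ₐ[k] MvPolynomial σ k := aeval fun i => X i ^ p - X i
  let S : Subalgebra k (MvPolynomial σ k) := φ.range
  have hS : ∀ s ∈ S, ∀ g : σ → ZMod p,
      aeval (fun i => X i + C (algebraMap (ZMod p) k (g i))) s = s := by
    rintro s ⟨f, rfl⟩ g
    have : ((aeval (R := k) fun i => (X i + C (algebraMap (ZMod p) k (g i)) :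
        MvPolynomial σ k)).comp φ) = φ := by
      refine algHom_ext fun i => ?_
      simp only [φ, AlgHom.comp_apply, aeval_X, map_sub, map_pow]
      rw [add_pow_char, ← C_pow, algebraMap_zmod_pow]
      ring
    exact DFunLike.congr_fun this f
  have hp : 1 < p := (Fact.out : p.Prime).one_lt
  have hFmem : F ∈ Algebra.adjoin S (Set.range (X : σ → MvPolynomial σ k)) :=
    mem_adjoin_of_mem_adjoin S _ (by rw [adjoin_range_X]; trivial)
  obtain ⟨d, hd⟩ := exists_reduced_form hp (X : σ → MvPolynomial σ k)
    (fun i => (⟨φ (X i), X i, rfl⟩ : S)) (fun i => by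
      change _ = X i + φ (X i); simp [φ]) hFmem
  have h0 : (0 : ℕ) < p := by omega
  -- Translations fix F and the coefficients d α, so the reduced form with coefficients d α, its
  -- constant one diminished by F, vanishes at all translates of X. Hence F is the constant
  -- coefficient d 0, which lies in the ring of polynomials in the X_i ^ p - X_i.
  have hd' := reduced_form_eq_zero (p := p) (X : σ → MvPolynomial σ k)
    (fun α => (d α : MvPolynomial σ k) - if α = fun _ => ⟨0, h0⟩ then F else 0) (by
      intro g
      have h1 := hF g
      rw [hd, map_sum] at h1
      simp only [map_mul, map_prod, map_pow, aeval_X] at h1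
      simp only [sub_mul, Finset.sum_sub_distrib, ite_mul, zero_mul, Finset.sum_ite_eq',
        Finset.mem_univ, if_true, pow_zero, Finset.prod_const_one, mul_one]
      rw [sub_eq_zero]
      rw [← hd] at h1
      rw [← h1]
      refine Finset.sum_congr rfl fun α _ => ?_
      congr 1
      exact (hS _ (d α).2 g).symm)
  have h2 := congrFun hd' fun _ => ⟨0, h0⟩
  simp only [if_true, Pi.zero_apply, sub_eq_zero] at h2
  obtain ⟨F0, hF0⟩ := (d fun _ => ⟨0, h0⟩).2
  refine ⟨F0, fun A => ?_⟩
  rw [← h2, ← hF0]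
  change eval A (aeval _ F0) = _
  rw [← aeval_eq_eval, ← AlgHom.comp_apply]
  change _ = (aeval fun i => A i ^ p - A i : MvPolynomial σ k →ₐ[k] k) F0
  congr 1
  refine algHom_ext fun i => ?_
  simp

/-- The map A ↦ A^p - A is the quotient by the finite group of 𝔽_p-translations, hence open: near
the image of A₀ every point is the image of a point with f ≠ 0. The function F is the trace of f
over this group, after f has been cut down so that only one translate contributes at A₀. -/
theorem exists_artinSchreier_ne_zero (f : MvPolynomial σ k) (A₀ : σ → k) (hf : eval A₀ f ≠ 0) :
    ∃ F : MvPolynomial σ k, eval (fun i => A₀ i ^ p - A₀ i) F ≠ 0 ∧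
      ∀ A : σ → k, eval (fun i => A i ^ p - A i) F ≠ 0 →
        ∃ g : σ → ZMod p, eval (fun i => A i + algebraMap (ZMod p) k (g i)) f ≠ 0 := by
  have hp : 1 < p := (Fact.out : p.Prime).one_lt
  -- The extra factor is 1 at A₀ and 0 at every other point A₀ + g of its orbit, because g_s ^ (p -
  -- 1) = 1 when g_s ≠ 0.
  let h : MvPolynomial σ k := f * ∏ s, (1 - (X s - C (A₀ s)) ^ (p - 1))
  let τ : (σ → ZMod p) → MvPolynomial σ k →ₐ[k] MvPolynomial σ k := fun g =>
    aeval fun i => X i + C (algebraMap (ZMod p) k (g i))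
  have hτ : ∀ g A u, eval A (τ g u) = eval (fun i => A i + algebraMap (ZMod p) k (g i)) u := by
    intro g A u
    simp only [τ]
    rw [← aeval_eq_eval, ← aeval_eq_eval, ← AlgHom.comp_apply]
    congr 1
    refine algHom_ext fun i => ?_
    simp
  obtain ⟨F, hF⟩ := exists_eq_of_translation_invariant (∑ g, τ g h) (by
    intro g
    change τ g _ = _
    rw [map_sum]
    conv_rhs => rw [← Equiv.sum_comp (Equiv.addRight g)]
    refine Finset.sum_congr rfl fun g' _ => ?_
    rw [← AlgHom.comp_apply]
    congr 1
    refine algHom_ext fun i => ?_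
    simp only [τ, AlgHom.comp_apply, aeval_X, map_add, Equiv.coe_addRight, Pi.add_apply,
      algHom_C]
    simp only [algebraMap_eq]
    ring)
  refine ⟨F, ?_, ?_⟩
  · rw [← hF, map_sum, Finset.sum_eq_single 0]
    · rw [hτ]
      simp only [Pi.zero_apply, map_zero, add_zero, h, map_mul, map_prod, map_sub, map_one, map_pow,
        eval_X, eval_C, sub_self, zero_pow (show p - 1 ≠ 0 by omega), sub_zero,
        Finset.prod_const_one, mul_one]
      exact hf
    · intro g _ hg
      rw [hτ]
      obtain ⟨s, hs⟩ : ∃ s, g s ≠ 0 := by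
        by_contra! h'; exact hg (funext h')
      simp only [h, map_mul, map_prod]
      rw [Finset.prod_eq_zero (Finset.mem_univ s), mul_zero]
      simp only [map_sub, map_one, map_pow, eval_X, eval_C, add_sub_cancel_left]
      rw [← map_pow, ZMod.pow_card_sub_one_eq_one hs, map_one, sub_self]
    · simp
  · intro A hA
    rw [← hF, map_sum] at hA
    obtain ⟨g, -, hg⟩ := Finset.exists_ne_zero_of_sum_ne_zero hA
    rw [hτ] at hg
    refine ⟨g, fun h' => hg ?_⟩
    simp only [h, map_mul, h', zero_mul]

end ArtinSchreierTrace

/-! ### Frobenius pairings and their Artin–Schreier recursion -/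

section StdForm

variable {R : Type*} [CommRing R] {n : ℕ}

/-- The standard alternating form on `R ^ (2n)`. -/
def stdForm (x y : Fin n ⊕ Fin n → R) : R :=
  ∑ i, (x (Sum.inl i) * y (Sum.inr i) - x (Sum.inr i) * y (Sum.inl i))

/-- The value of the standard form at a vector and its `j`-th Frobenius twist. -/
def frobPairing (p : ℕ) (x : Fin n ⊕ Fin n → R) (j : ℕ) : R :=
  stdForm x fun i => x i ^ p ^ j

theorem stdForm_add_left (x x' y : Fin n ⊕ Fin n → R) :
    stdForm (fun i => x i + x' i) y = stdForm x y + stdForm x' y := by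
  simp only [stdForm, ← Finset.sum_add_distrib]
  exact Finset.sum_congr rfl fun i _ => by ring

theorem stdForm_add_right (x y y' : Fin n ⊕ Fin n → R) :
    stdForm x (fun i => y i + y' i) = stdForm x y + stdForm x y' := by
  simp only [stdForm, ← Finset.sum_add_distrib]
  exact Finset.sum_congr rfl fun i _ => by ring

theorem stdForm_sub_left (x x' y : Fin n ⊕ Fin n → R) :
    stdForm (fun i => x i - x' i) y = stdForm x y - stdForm x' y := by
  simp only [stdForm, ← Finset.sum_sub_distrib]
  exact Finset.sum_congr rfl fun i _ => by ring

theorem stdForm_sub_right (x y y' : Fin n ⊕ Fin n → R) :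
    stdForm x (fun i => y i - y' i) = stdForm x y - stdForm x y' := by
  simp only [stdForm, ← Finset.sum_sub_distrib]
  exact Finset.sum_congr rfl fun i _ => by ring

theorem stdForm_self (x : Fin n ⊕ Fin n → R) : stdForm x x = 0 :=
  Finset.sum_eq_zero fun i _ => by ring

theorem stdForm_neg_swap (x y : Fin n ⊕ Fin n → R) : stdForm x y = -stdForm y x := by
  simp only [stdForm, ← Finset.sum_neg_distrib]
  exact Finset.sum_congr rfl fun i _ => by ring

theorem map_stdForm {R' F : Type*} [CommRing R'] [FunLike F R R'] [RingHomClass F R R'] (f : F)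
    (x y : Fin n ⊕ Fin n → R) : f (stdForm x y) = stdForm (fun i => f (x i)) fun i => f (y i) := by
  simp [stdForm, map_sum]

theorem map_frobPairing {R' F : Type*} [CommRing R'] [FunLike F R R'] [RingHomClass F R R'] (f : F)
    (p : ℕ) (x : Fin n ⊕ Fin n → R) (j : ℕ) :
    f (frobPairing p x j) = frobPairing p (fun i => f (x i)) j := by
  simp [frobPairing, map_stdForm]

theorem frobPairing_smul (p : ℕ) (t : R) (x : Fin n ⊕ Fin n → R) (j : ℕ) :
    frobPairing p (fun i => t * x i) j = t ^ (1 + p ^ j) * frobPairing p x j := by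
  simp only [frobPairing, stdForm, Finset.mul_sum]
  exact Finset.sum_congr rfl fun i _ => by ring

theorem frobPairing_zero (p : ℕ) (x : Fin n ⊕ Fin n → R) : frobPairing p x 0 = 0 := by
  simp [frobPairing, stdForm_self]

/-- The vector with first coordinates `a` and `1` and remaining coordinates `x`. -/
def extendVec (a : R) (x : Fin n ⊕ Fin n → R) : Fin (n + 1) ⊕ Fin (n + 1) → R :=
  Sum.elim (Fin.cons a fun i => x (Sum.inl i)) (Fin.cons 1 fun i => x (Sum.inr i))

theorem frobPairing_extendVec (p : ℕ) (a : R) (x : Fin n ⊕ Fin n → R) (j : ℕ) :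
    frobPairing p (extendVec a x) j = a - a ^ p ^ j + frobPairing p x j := by
  simp [frobPairing, stdForm, extendVec, Fin.sum_univ_succ]
  ring

theorem stdForm_pow (p : ℕ) [Fact p.Prime] [CharP R p] (x y : Fin n ⊕ Fin n → R) :
    stdForm x y ^ p = stdForm (fun i => x i ^ p) fun i => y i ^ p :=
  map_stdForm (frobenius R p) x y

/-- How the pairings change under `x ↦ Φ x - x`. -/
theorem frobPairing_artinSchreier (p : ℕ) [Fact p.Prime] [CharP R p] (a : R)
    (x y : Fin n ⊕ Fin n → R) (hy : ∀ i, y i = x i ^ p - x i) (j : ℕ) :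
    frobPairing p y (j + 1) = frobPairing p (extendVec a x) (j + 1)
      + frobPairing p (extendVec a x) (j + 1) ^ p - frobPairing p (extendVec a x) (j + 2)
      - frobPairing p (extendVec a x) j ^ p := by
  have hpow : ∀ l, frobPairing p x l ^ p = stdForm (fun i => x i ^ p) fun i => x i ^ p ^ (l + 1) := by
    intro l
    rw [frobPairing, stdForm_pow]
    simp only [pow_succ, pow_mul]
  have h1 : frobPairing p y (j + 1) = frobPairing p x (j + 1) + frobPairing p x (j + 1) ^ p
      - frobPairing p x (j + 2) - frobPairing p x j ^ p := by
    rw [hpow, hpow]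
    have hy' : y = fun i => x i ^ p - x i := funext hy
    have hy2 : (fun i => y i ^ p ^ (j + 1)) = fun i => x i ^ p ^ (j + 2) - x i ^ p ^ (j + 1) := by
      funext i
      rw [hy i, sub_pow_char_pow, ← pow_mul, ← pow_succ']
    rw [frobPairing, hy2, hy', stdForm_sub_left, stdForm_sub_right, stdForm_sub_right]
    simp only [frobPairing]
    ring
  rw [h1]
  simp only [frobPairing_extendVec]
  rw [add_pow_char, add_pow_char, sub_pow_char, sub_pow_char]
  simp only [← pow_mul, ← pow_succ]
  ring

/-- The cone of vectors `x` with `⟨x, Φ^j x⟩ = 0` for `1 ≤ j < n` and `⟨x, Φ^n x⟩ ≠ 0`. -/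
def IsCone (p : ℕ) (x : Fin n ⊕ Fin n → R) : Prop :=
  (∀ j, 1 ≤ j → j < n → frobPairing p x j = 0) ∧ frobPairing p x n ≠ 0

/-- Let c_j and d_j be the pairings of the extended vector and of y. Then c_0 = 0 and d_{j+1} =
c_{j+1} + c_{j+1}^p - c_{j+2} - c_j^p. So c_1, …, c_n all vanish exactly when c_1 = 0, which is the
equation for a, and d_1, …, d_{n-1} vanish. In that case d_n = -c_{n+1}, which matches the two
inequalities. -/
theorem isCone_extendVec_iff (p : ℕ) [Fact p.Prime] [CharP R p] (hn : 0 < n) (a : R)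
    (x y : Fin n ⊕ Fin n → R) (hy : ∀ i, y i = x i ^ p - x i) :
    IsCone p (extendVec a x) ↔ a ^ p = a + stdForm x y ∧ IsCone p y := by
  have h1 : frobPairing p (extendVec a x) 1 = a - a ^ p + stdForm x y := by
    rw [frobPairing_extendVec, pow_one, frobPairing]
    have hy' : y = fun i => x i ^ p - x i := funext hy
    rw [hy', stdForm_sub_right, stdForm_self, pow_one, sub_zero]
  have h0 := frobPairing_zero p (extendVec a x)
  have hrec := frobPairing_artinSchreier p a x y hy
  have hp : p ≠ 0 := (Fact.out : p.Prime).ne_zero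
  have vanish : (a ^ p = a + stdForm x y) → (∀ j, 1 ≤ j → j < n → frobPairing p y j = 0) →
      ∀ j, j < n → frobPairing p (extendVec a x) j = 0 ∧
        frobPairing p (extendVec a x) (j + 1) = 0 := by
    intro ha hc j
    induction j with
    | zero => intro _; exact ⟨h0, by rw [h1, ha]; ring⟩
    | succ j ih =>
      intro hj
      obtain ⟨ih1, ih2⟩ := ih (by omega)
      refine ⟨ih2, ?_⟩
      have := hrec j
      rw [hc (j + 1) (by omega) hj, ih1, ih2, zero_pow hp] at this
      linear_combination this
  constructor
  · rintro ⟨hc1, hc2⟩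
    have hz : ∀ j, j < n + 1 → frobPairing p (extendVec a x) j = 0 := by
      intro j hj
      rcases Nat.eq_zero_or_pos j with rfl | h
      · exact h0
      · exact hc1 j h hj
    refine ⟨?_, ?_, ?_⟩
    · have := hz 1 (by omega)
      rw [h1] at this
      linear_combination -this
    · intro j hj1 hj2
      obtain ⟨j, rfl⟩ := Nat.exists_eq_succ_of_ne_zero (by omega : j ≠ 0)
      rw [Nat.succ_eq_add_one, hrec, hz _ (by omega), hz _ (by omega), hz _ (by omega), zero_pow hp]
      ring
    · obtain ⟨l, rfl⟩ := Nat.exists_eq_succ_of_ne_zero (by omega : n ≠ 0)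
      rw [Nat.succ_eq_add_one] at *
      rw [hrec, hz _ (by omega), hz l (by omega), zero_pow hp]
      simpa using hc2
  · rintro ⟨ha, hc1, hc2⟩
    have hv := vanish ha hc1
    refine ⟨fun j hj1 hj2 => ?_, ?_⟩
    · rcases Nat.lt_or_ge j n with h | h
      · exact (hv j h).1
      · obtain ⟨l, rfl⟩ := Nat.exists_eq_succ_of_ne_zero (by omega : j ≠ 0)
        exact (hv l (by omega)).2
    · obtain ⟨l, rfl⟩ := Nat.exists_eq_succ_of_ne_zero (by omega : n ≠ 0)
      rw [Nat.succ_eq_add_one] at *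
      rw [hrec, (hv l (by omega)).1, (hv l (by omega)).2, zero_pow hp] at hc2
      simpa using hc2

end StdForm

/-! ### The equations u^p = u and x^p = x + c -/

section PrimeField

variable {p : ℕ} [Fact p.Prime] {Ω : Type*} [Field Ω] [Algebra (ZMod p) Ω]

/-- The polynomial X^p - X has at most p roots, and the prime field already supplies p of them. -/
theorem exists_algebraMap_eq_of_pow_eq {u : Ω} (hu : u ^ p = u) :
    ∃ c : ZMod p, algebraMap (ZMod p) Ω c = u := by
  classical
  have hp : 1 < p := (Fact.out : p.Prime).one_lt
  have h1 : (Polynomial.X ^ p - Polynomial.X : Polynomial Ω) ≠ 0 :=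
    FiniteField.X_pow_card_sub_X_ne_zero Ω hp
  have h2 : Finset.univ.image (algebraMap (ZMod p) Ω) ⊆
      (Polynomial.X ^ p - Polynomial.X : Polynomial Ω).roots.toFinset := by
    intro u hu
    obtain ⟨c, -, rfl⟩ := Finset.mem_image.1 hu
    rw [Multiset.mem_toFinset, Polynomial.mem_roots h1]
    simp [algebraMap_zmod_pow]
  have h3 := Finset.eq_of_subset_of_card_le h2 (by
    rw [Finset.card_image_of_injective _ (algebraMap (ZMod p) Ω).injective, Finset.card_univ,
      ZMod.card]
    refine (Multiset.toFinset_card_le _).trans ((Polynomial.card_roots' _).trans ?_)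
    rw [FiniteField.X_pow_card_sub_X_natDegree_eq Ω hp])
  have h4 : u ∈ (Polynomial.X ^ p - Polynomial.X : Polynomial Ω).roots.toFinset := by
    rw [Multiset.mem_toFinset, Polynomial.mem_roots h1]
    simp [hu]
  rw [← h3] at h4
  simpa using h4

/-- Artin–Schreier polynomials are separable, so a separably closed field suffices. This lets the
tower below live in a separable closure, which is Galois. -/
theorem exists_pow_eq_add [IsSepClosed Ω] (c : Ω) : ∃ x : Ω, x ^ p = x + c := by
  have : CharP Ω p := (Algebra.charP_iff (ZMod p) Ω p).1 inferInstance
  obtain ⟨x, hx⟩ := IsSepClosed.exists_root_C_mul_X_pow_add_C_mul_X_add_C (k := Ω) (n := p) 1 (-1)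
    (-c) (by simp) (Fact.out : p.Prime).two_le (by simp)
  exact ⟨x, by linear_combination hx⟩

end PrimeField

/-! ### The Heisenberg group as a Galois group -/

section GaloisStep

variable {p : ℕ} [Fact p.Prime] {n : ℕ} {K Ω : Type*} [Field K] [Field Ω] [Algebra K Ω]
  [Algebra (ZMod p) Ω] [Algebra (ZMod p) K] [IsScalarTower (ZMod p) K Ω]

/-- An Artin–Schreier extension by elements independent modulo `x ^ p - x` has all translations by
vectors over `𝔽_p` as automorphisms. -/
theorem exists_algEquiv_translation {ι : Type*} [Fintype ι] [IsGalois K Ω] (y : ι → K)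
    (hy : ∀ l : ι → ZMod p, ∀ w : K,
      w ^ p = w + ∑ i, algebraMap (ZMod p) K (l i) * y i → l = 0)
    (x : ι → Ω) (hx : ∀ i, x i ^ p = x i + algebraMap K Ω (y i)) (v : ι → ZMod p) :
    ∃ σ : Ω ≃ₐ[K] Ω, ∀ i, σ (x i) = x i + algebraMap (ZMod p) Ω (v i) := by
  classical
  have : CharP Ω p := (Algebra.charP_iff (ZMod p) Ω p).1 inferInstance
  have hfix : ∀ (σ : Ω ≃ₐ[K] Ω) (c : ZMod p), σ (algebraMap (ZMod p) Ω c) = algebraMap _ _ c := by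
    intro σ c
    rw [IsScalarTower.algebraMap_apply (ZMod p) K Ω, σ.commutes]
  -- The translations that occur form a subgroup of an 𝔽_p-vector space, that is, a subspace.
  let H : AddSubgroup (ι → ZMod p) :=
    { carrier := {v | ∃ σ : Ω ≃ₐ[K] Ω, ∀ i, σ (x i) = x i + algebraMap (ZMod p) Ω (v i)}
      zero_mem' := ⟨AlgEquiv.refl, by simp⟩
      add_mem' := by
        rintro v w ⟨σ, hσ⟩ ⟨τ, hτ⟩
        refine ⟨τ.trans σ, fun i => ?_⟩
        rw [AlgEquiv.trans_apply, hτ, map_add, hσ, hfix, Pi.add_apply, map_add, add_assoc]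
      neg_mem' := by
        rintro v ⟨σ, hσ⟩
        refine ⟨σ.symm, fun i => ?_⟩
        rw [AlgEquiv.symm_apply_eq, map_add, hσ, hfix, Pi.neg_apply, map_neg]
        ring }
  let H' : Submodule (ZMod p) (ι → ZMod p) := AddSubgroup.toZModSubmodule p H
  by_cases hH : H' = ⊤
  · have : v ∈ H' := by rw [hH]; trivial
    exact this
  · exfalso
    -- A proper subspace is killed by some nonzero functional l. Then w = ∑ l_i x_i is Galois
    -- invariant, so it lies in K, and w^p - w = ∑ l_i y_i contradicts the independence.
    obtain ⟨f, hf', hf⟩ := Submodule.exists_le_ker_of_lt_top H' (lt_top_iff_ne_top.2 hH)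
    let l : ι → ZMod p := fun i => f (Pi.single i 1)
    have hl : ∀ w : ι → ZMod p, f w = ∑ i, w i * l i := by
      intro w
      conv_lhs => rw [pi_eq_sum_univ' w, map_sum]
      refine Finset.sum_congr rfl fun i _ => ?_
      rw [map_smul, smul_eq_mul]
    have hsum : ∀ σ : Ω ≃ₐ[K] Ω, σ (∑ i, algebraMap (ZMod p) Ω (l i) * x i)
        = ∑ i, algebraMap (ZMod p) Ω (l i) * x i := by
      intro σ
      have : ∀ i, ∃ c, algebraMap (ZMod p) Ω c = σ (x i) - x i := by
        intro i
        refine exists_algebraMap_eq_of_pow_eq ?_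
        rw [sub_pow_char, ← map_pow, hx, map_add, σ.commutes]
        ring
      choose w hw using this
      have hwH : w ∈ H' := ⟨σ, fun i => by rw [hw]; ring⟩
      have h0 : f w = 0 := hf hwH
      rw [hl] at h0
      have h1 := congrArg (algebraMap (ZMod p) Ω) h0
      rw [map_sum, map_zero] at h1
      rw [map_sum, ← sub_eq_zero, ← Finset.sum_sub_distrib, ← h1]
      refine Finset.sum_congr rfl fun i _ => ?_
      rw [map_mul, hfix, map_mul, hw]
      ring
    obtain ⟨w, hw⟩ := (InfiniteGalois.mem_range_algebraMap_iff_fixed (k := K) _).2 hsum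
    have : l = 0 := by
      refine hy l w ((algebraMap K Ω).injective ?_)
      rw [map_pow, map_add, hw, map_sum, ← frobenius_def, map_sum, ← Finset.sum_add_distrib]
      refine Finset.sum_congr rfl fun i _ => ?_
      rw [frobenius_def, mul_pow, algebraMap_zmod_pow, hx, map_mul,
        ← IsScalarTower.algebraMap_apply]
      ring
    exact hf' (LinearMap.ext fun w => by rw [hl, this]; simp)

/-- The Galois group of the tower `x ^ p - x = y`, `a ^ p - a = ⟨x, y⟩` contains the translations
of `a` by elements of `𝔽_p`: it is a Heisenberg group, whose commutators are these. -/
theorem exists_algEquiv_central [IsGalois K Ω] (hp : p ≠ 2) (y : Fin (n + 1) ⊕ Fin (n + 1) → K)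
    (x : Fin (n + 1) ⊕ Fin (n + 1) → Ω) (hx : ∀ i, x i ^ p = x i + algebraMap K Ω (y i)) (a : Ω)
    (ha : a ^ p = a + stdForm x fun i => algebraMap K Ω (y i))
    (htr : ∀ v : Fin (n + 1) ⊕ Fin (n + 1) → ZMod p,
      ∃ σ : Ω ≃ₐ[K] Ω, ∀ i, σ (x i) = x i + algebraMap (ZMod p) Ω (v i)) (c : ZMod p) :
    ∃ σ : Ω ≃ₐ[K] Ω, (∀ i, σ (x i) = x i) ∧ σ a = a + algebraMap (ZMod p) Ω c := by
  have : CharP Ω p := (Algebra.charP_iff (ZMod p) Ω p).1 inferInstance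
  have hfix : ∀ (σ : Ω ≃ₐ[K] Ω) (c : ZMod p), σ (algebraMap (ZMod p) Ω c) = algebraMap _ _ c := by
    intro σ c
    rw [IsScalarTower.algebraMap_apply (ZMod p) K Ω, σ.commutes]
  let cst : (Fin (n + 1) ⊕ Fin (n + 1) → ZMod p) → Fin (n + 1) ⊕ Fin (n + 1) → Ω :=
    fun v i => algebraMap (ZMod p) Ω (v i)
  have hcpow : ∀ v i, cst v i ^ p = cst v i := fun v i => algebraMap_zmod_pow _
  -- A lift of the translation by v sends a to a + ⟨v, x⟩ up to a root of u^p = u, because this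
  -- keeps the equation a^p - a = ⟨x, y⟩.
  have hact : ∀ (v : Fin (n + 1) ⊕ Fin (n + 1) → ZMod p) (σ : Ω ≃ₐ[K] Ω),
      (∀ i, σ (x i) = x i + algebraMap (ZMod p) Ω (v i)) →
      ∃ s : ZMod p, σ a = a + stdForm (cst v) x + algebraMap (ZMod p) Ω s := by
    intro v σ hσ
    obtain ⟨s, hs⟩ := exists_algebraMap_eq_of_pow_eq (p := p) (u := σ a - a - stdForm (cst v) x) (by
      rw [sub_pow_char, sub_pow_char, ← map_pow, ha, stdForm_pow, map_add, map_stdForm]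
      simp only [hσ, hcpow, hx, σ.commutes]
      rw [stdForm_add_left, stdForm_add_right]
      ring)
    exact ⟨s, by rw [hs]; ring⟩
  have h2 : (2 : ZMod p) ≠ 0 := by
    have : ((2 : ℕ) : ZMod p) ≠ 0 := by
      rw [Ne, ZMod.natCast_eq_zero_iff]
      intro h
      exact hp ((Nat.prime_dvd_prime_iff_eq Fact.out Nat.prime_two).1 h)
    exact_mod_cast this
  -- The commutator of lifts of v and w translates a by ⟨v, w⟩ - ⟨w, v⟩ = 2⟨v, w⟩; hence the value c
  -- / 2, and the need for p to be odd.
  let v : Fin (n + 1) ⊕ Fin (n + 1) → ZMod p := Pi.single (Sum.inl 0) (c / 2)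
  let w : Fin (n + 1) ⊕ Fin (n + 1) → ZMod p := Pi.single (Sum.inr 0) 1
  have hvw : stdForm (cst v) (cst w) = algebraMap (ZMod p) Ω (c / 2) := by
    rw [stdForm, Finset.sum_eq_single 0]
    · simp [cst, v, w]
    · intro i _ hi
      simp [cst, v, w, hi]
    · simp
  obtain ⟨σ, hσ⟩ := htr v
  obtain ⟨τ, hτ⟩ := htr w
  obtain ⟨s, hs⟩ := hact v σ hσ
  obtain ⟨t, ht⟩ := hact w τ hτ
  refine ⟨(σ.trans τ).trans (τ.trans σ).symm, fun i => ?_, ?_⟩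
  · rw [AlgEquiv.trans_apply, AlgEquiv.symm_apply_eq, AlgEquiv.trans_apply, AlgEquiv.trans_apply, hσ,
      hτ, map_add, map_add, hσ, hτ, hfix, hfix]
    ring
  · rw [AlgEquiv.trans_apply, AlgEquiv.symm_apply_eq, AlgEquiv.trans_apply, AlgEquiv.trans_apply, hs,
      map_add, map_add, map_add, hfix, hfix, map_stdForm]
    simp only [hτ, hfix, cst]
    rw [ht, map_add σ, map_add σ, map_add σ, hs, map_stdForm]
    simp only [hσ, hfix, cst]
    rw [stdForm_add_right, stdForm_add_right]
    have e1 := stdForm_neg_swap (cst w) (cst v)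
    change a + stdForm (cst w) x + algebraMap (ZMod p) Ω t
      + (stdForm (cst v) x + stdForm (cst v) (cst w)) + algebraMap (ZMod p) Ω s
      = a + stdForm (cst v) x + algebraMap (ZMod p) Ω s + (stdForm (cst w) x
        + stdForm (cst w) (cst v)) + algebraMap (ZMod p) Ω t + algebraMap (ZMod p) Ω c
    rw [e1, hvw]
    have : algebraMap (ZMod p) Ω c = algebraMap (ZMod p) Ω (c / 2) + algebraMap (ZMod p) Ω (c / 2) := by
      rw [← map_add]; congr 1; field_simp; ring
    rw [this]; ring

end GaloisStep

/-! ### From the generic point to all points of the slice -/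

section Vanishing

open MvPolynomial

theorem eq_extendVec {R : Type*} [CommRing R] {n : ℕ} (u : Fin (n + 1) ⊕ Fin (n + 1) → R)
    (hu : u (Sum.inr 0) = 1) :
    u = extendVec (u (Sum.inl 0)) (Sum.elim (fun i => u (Sum.inl i.succ)) fun i =>
      u (Sum.inr i.succ)) := by
  funext i
  rcases i with i | i
  · refine Fin.cases ?_ (fun i => ?_) i <;> simp [extendVec]
  · refine Fin.cases ?_ (fun i => ?_) i <;> simp [extendVec, hu]

theorem aeval_prod {σ k A B : Type*} [CommRing k] [CommRing A] [CommRing B] [Algebra k A]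
    [Algebra k B] (x : σ → A) (y : σ → B) (f : MvPolynomial σ k) :
    aeval (fun i => (x i, y i)) f = (aeval x f, aeval y f) := by
  have : aeval (fun i => (x i, y i)) = (aeval x : MvPolynomial σ k →ₐ[k] A).prod (aeval y) :=
    algHom_ext fun i => by simp
  rw [this]; rfl

theorem aeval_extendVec_mem_adjoin {n : ℕ} {k R : Type*} (S : Type*) [CommRing k] [CommRing S]
    [CommRing R] [Algebra k R] [Algebra S R] (a : R) (x : Fin n ⊕ Fin n → R)
    (hx : ∀ i, x i ∈ (algebraMap S R).range) (hk : ∀ c : k, algebraMap k R c ∈ (algebraMap S R).range)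
    (f : MvPolynomial (Fin (n + 1) ⊕ Fin (n + 1)) k) :
    aeval (extendVec a x) f ∈ Algebra.adjoin S (Set.range fun _ : Unit => a) := by
  have key : ∀ r ∈ (algebraMap S R).range, r ∈ Algebra.adjoin S (Set.range fun _ : Unit => a) := by
    rintro _ ⟨s, rfl⟩
    exact Subalgebra.algebraMap_mem _ s
  induction f using MvPolynomial.induction_on with
  | C c => rw [aeval_C]; exact key _ (hk c)
  | add f g hf hg => rw [map_add]; exact add_mem hf hg
  | mul_X f i hf =>
    rw [map_mul, aeval_X]
    refine mul_mem hf ?_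
    rcases i with i | i
    · refine Fin.cases ?_ (fun i => ?_) i
      · exact Algebra.subset_adjoin ⟨(), rfl⟩
      · exact key _ (hx (Sum.inl i))
    · refine Fin.cases ?_ (fun i => ?_) i
      · exact one_mem _
      · exact key _ (hx (Sum.inr i))

variable {p : ℕ} [Fact p.Prime] {n : ℕ} {k K Ω : Type*} [Field k] [Field K] [Field Ω] [Algebra K Ω]
  [Algebra (ZMod p) Ω] [Algebra (ZMod p) K] [IsScalarTower (ZMod p) K Ω]
  [Algebra k K] [Algebra k Ω] [IsScalarTower k K Ω] [Algebra (ZMod p) k]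

/-- Over the tower `x ^ p - x = y`, `a ^ p - a = ⟨x, y⟩`, the elements of `S[x, a]` are
determined by their values at the generic point as soon as those of `S` are. -/
theorem eq_zero_of_generic_eq_zero [IsGalois K Ω] (hp : p ≠ 2)
    (y : Fin (n + 1) ⊕ Fin (n + 1) → K)
    (hy : ∀ l : Fin (n + 1) ⊕ Fin (n + 1) → ZMod p, ∀ w : K,
      w ^ p = w + ∑ i, algebraMap (ZMod p) K (l i) * y i → l = 0)
    {S R : Type*} [CommRing S] [CommRing R] [Algebra S R] (φ : R →+* Ω)
    (hφ : ∀ s : S, ∃ κ : K, φ (algebraMap S R s) = algebraMap K Ω κ)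
    (hinj : ∀ s : S, φ (algebraMap S R s) = 0 → s = 0)
    (X : Fin (n + 1) ⊕ Fin (n + 1) → R) (c : Fin (n + 1) ⊕ Fin (n + 1) → S)
    (hX : ∀ i, X i ^ p = X i + algebraMap S R (c i))
    (hc : ∀ i, φ (algebraMap S R (c i)) = algebraMap K Ω (y i)) (A : R)
    (hA : A ^ p = A + stdForm X fun i => algebraMap S R (c i)) (r : R)
    (hr : r ∈ Algebra.adjoin (Algebra.adjoin S (Set.range X)) (Set.range fun _ : Unit => A))
    (hr0 : φ r = 0) : r = 0 := by
  have hp1 : 1 < p := (Fact.out : p.Prime).one_lt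
  set x : Fin (n + 1) ⊕ Fin (n + 1) → Ω := fun i => φ (X i) with hxdef
  have hx : ∀ i, x i ^ p = x i + algebraMap K Ω (y i) := by
    intro i
    rw [hxdef, ← map_pow, hX, map_add, hc]
  set a : Ω := φ A with hadef
  have ha : a ^ p = a + stdForm x fun i => algebraMap K Ω (y i) := by
    rw [hadef, ← map_pow, hA, map_add, map_stdForm]
    simp only [hc, hxdef]
  have hXS : ∀ i, X i ∈ Algebra.adjoin S (Set.range X) := fun i => Algebra.subset_adjoin ⟨i, rfl⟩
  have hform : (stdForm X fun i => algebraMap S R (c i)) ∈ Algebra.adjoin S (Set.range X) :=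
    sum_mem fun i _ => sub_mem (mul_mem (hXS _) (Subalgebra.algebraMap_mem _ _))
      (mul_mem (hXS _) (Subalgebra.algebraMap_mem _ _))
  obtain ⟨d, hd⟩ := exists_reduced_form hp1 (fun _ : Unit => A) (fun _ => ⟨_, hform⟩)
    (fun _ => hA) hr
  have htr := exists_algEquiv_translation y hy x hx
  have hfixS : ∀ (σ : Ω ≃ₐ[K] Ω) (s : S), σ (φ (algebraMap S R s)) = φ (algebraMap S R s) := by
    intro σ s
    obtain ⟨κ, hκ⟩ := hφ s
    rw [hκ]; exact σ.commutes _
  have hform' : ∀ s ∈ Algebra.adjoin S (Set.range X),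
      ∃ e : (Fin (n + 1) ⊕ Fin (n + 1) → Fin p) → S,
      s = ∑ α, algebraMap S R (e α) * ∏ i, X i ^ (α i : ℕ) := fun s hs =>
    exists_reduced_form hp1 X c hX hs
  have hσform : ∀ (σ : Ω ≃ₐ[K] Ω) (e : (Fin (n + 1) ⊕ Fin (n + 1) → Fin p) → S),
      σ (φ (∑ α, algebraMap S R (e α) * ∏ i, X i ^ (α i : ℕ)))
        = ∑ α, φ (algebraMap S R (e α)) * ∏ i, σ (x i) ^ (α i : ℕ) := by
    intro σ e
    simp only [map_sum, map_mul, map_prod, map_pow, hfixS, hxdef]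
  -- Galois translations turn one vanishing reduced form at x into its vanishing at all translates
  -- of x, which kills the coefficients. These lie in S, where φ is injective.
  have hS'0 : ∀ s ∈ Algebra.adjoin S (Set.range X), φ s = 0 → s = 0 := by
    intro s hs h0
    obtain ⟨e, he⟩ := hform' s hs
    have h1 : (fun α => φ (algebraMap S R (e α))) = 0 := by
      refine reduced_form_eq_zero (p := p) x _ fun g => ?_
      obtain ⟨σ, hσ⟩ := htr g
      have h2 := congrArg σ h0
      rw [he, hσform, map_zero] at h2
      rw [← h2]
      simp only [hσ]
    have h2 : e = 0 := funext fun α => hinj _ (congrFun h1 α)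
    rw [he, h2]; simp
  -- The same argument one storey higher: the central automorphisms translate a but fix x and S,
  -- hence also the coefficients, which lie in S[X].
  have hd0 : (fun β => φ (d β : R)) = 0 := by
    refine reduced_form_eq_zero (p := p) (fun _ : Unit => a) _ fun g => ?_
    obtain ⟨σ, hσx, hσa⟩ := exists_algEquiv_central hp y x hx a ha htr (g ())
    have h2 := congrArg σ hr0
    rw [hd, map_zero, map_sum, map_sum] at h2
    rw [← h2]
    refine Finset.sum_congr rfl fun β _ => ?_
    rw [map_mul, map_mul, map_prod, map_prod]
    congr 1
    · obtain ⟨e, he⟩ := hform' _ (d β).2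
      change φ (d β : R) = σ (φ (d β : R))
      have h3 := hσform σ e
      have h4 := hσform AlgEquiv.refl e
      rw [← he] at h3 h4
      simp only [hσx] at h3
      rw [h3]
      exact h4
    · refine Finset.prod_congr rfl fun i _ => ?_
      rw [map_pow, map_pow, ← hσa]
  rw [hd]
  refine Finset.sum_eq_zero fun β _ => ?_
  have : algebraMap (Algebra.adjoin S (Set.range X)) R (d β) = 0 :=
    hS'0 _ (d β).2 (congrFun hd0 β)
  rw [this, zero_mul]

/-- A polynomial that vanishes at the generic point of the slice vanishes on the slice. -/
theorem eval_eq_zero_of_generic [IsGalois K Ω] (hp : p ≠ 2)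
    (y : Fin (n + 1) ⊕ Fin (n + 1) → K)
    (hy : ∀ l : Fin (n + 1) ⊕ Fin (n + 1) → ZMod p, ∀ w : K,
      w ^ p = w + ∑ i, algebraMap (ZMod p) K (l i) * y i → l = 0)
    (hgen : ∀ f : MvPolynomial (Fin (n + 1) ⊕ Fin (n + 1)) k, aeval y f = 0 →
      ∀ u : Fin (n + 1) ⊕ Fin (n + 1) → k, IsCone p u → aeval u f = 0)
    (x : Fin (n + 1) ⊕ Fin (n + 1) → Ω) (hx : ∀ i, x i ^ p = x i + algebraMap K Ω (y i)) (a : Ω)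
    (ha : a ^ p = a + stdForm x fun i => algebraMap K Ω (y i))
    (f : MvPolynomial (Fin (n + 2) ⊕ Fin (n + 2)) k) (hf : aeval (extendVec a x) f = 0)
    (u : Fin (n + 2) ⊕ Fin (n + 2) → k) (hu : u (Sum.inr 0) = 1) (huc : IsCone p u) :
    aeval u f = 0 := by
  have : CharP k p := (Algebra.charP_iff (ZMod p) k p).1 inferInstance
  have hp1 : 1 < p := (Fact.out : p.Prime).one_lt
  obtain ⟨a₀, x₀, rfl⟩ : ∃ a₀ x₀, u = extendVec a₀ x₀ := ⟨_, _, eq_extendVec u hu⟩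
  let y₀ : Fin (n + 1) ⊕ Fin (n + 1) → k := fun i => x₀ i ^ p - x₀ i
  obtain ⟨ha₀, hy₀⟩ := (isCone_extendVec_iff p (Nat.succ_pos n) a₀ x₀ y₀ fun _ => rfl).1 huc
  -- The generic point and the given point are combined into one point over Ω × k. On the subring
  -- generated by the y-coordinates, vanishing of the first component forces vanishing of the
  -- second, by the hypothesis on y. The preceding lemma carries this up the tower.
  let X : Fin (n + 1) ⊕ Fin (n + 1) → Ω × k := fun i => (x i, x₀ i)
  let Y : Fin (n + 1) ⊕ Fin (n + 1) → Ω × k := fun i => (algebraMap K Ω (y i), y₀ i)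
  let A : Ω × k := (a, a₀)
  let S : Subalgebra k (Ω × k) := Algebra.adjoin k (Set.range Y)
  have hS : ∀ s ∈ S, ∃ f : MvPolynomial (Fin (n + 1) ⊕ Fin (n + 1)) k,
      s = (algebraMap K Ω (aeval y f), aeval y₀ f) := by
    intro s hs
    obtain ⟨f, rfl⟩ : s ∈ (aeval Y : MvPolynomial _ k →ₐ[k] Ω × k).range := by
      rw [← Algebra.adjoin_range_eq_range_aeval]; exact hs
    refine ⟨f, ?_⟩
    change aeval (fun i => (algebraMap K Ω (y i), y₀ i)) f = _
    rw [aeval_prod]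
    congr 1
    exact aeval_algebraMap_apply Ω y f
  have hS0 : ∀ s ∈ S, s.1 = 0 → s = 0 := by
    intro s hs h0
    obtain ⟨f, rfl⟩ := hS s hs
    have h1 : aeval y f = 0 := (algebraMap K Ω).injective (by rw [map_zero]; exact h0)
    rw [h1, map_zero, hgen f h1 y₀ hy₀]; rfl
  have hYS : ∀ i, Y i ∈ S := fun i => Algebra.subset_adjoin ⟨i, rfl⟩
  have hX : ∀ i, X i ^ p = X i + algebraMap S (Ω × k) ⟨Y i, hYS i⟩ := by
    intro i
    refine Prod.ext (hx i) ?_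
    change x₀ i ^ p = x₀ i + (x₀ i ^ p - x₀ i)
    ring
  have hA : A ^ p = A + stdForm X fun i => algebraMap S (Ω × k) ⟨Y i, hYS i⟩ := by
    refine Prod.ext ?_ ?_
    · change a ^ p = a + RingHom.fst Ω k (stdForm X Y)
      rw [map_stdForm]; exact ha
    · change a₀ ^ p = a₀ + RingHom.snd Ω k (stdForm X Y)
      rw [map_stdForm]; exact ha₀
  have hr : aeval (extendVec A X) f ∈
      Algebra.adjoin (Algebra.adjoin S (Set.range X)) (Set.range fun _ : Unit => A) := by
    refine aeval_extendVec_mem_adjoin (Algebra.adjoin S (Set.range X)) A X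
      (fun i => ⟨⟨X i, Algebra.subset_adjoin ⟨i, rfl⟩⟩, rfl⟩) (fun c => ?_) f
    exact ⟨algebraMap S _ (algebraMap k S c), rfl⟩
  have hr' : aeval (extendVec A X) f = (0, aeval (extendVec a₀ x₀) f) := by
    have : extendVec A X = fun i => (extendVec a x i, extendVec a₀ x₀ i) := by
      funext i
      rcases i with i | i <;> refine Fin.cases ?_ (fun i => ?_) i <;> rfl
    rw [this, aeval_prod, hf]
  have h0 := eq_zero_of_generic_eq_zero hp y hy (S := S) (RingHom.fst Ω k)
    (fun s => by obtain ⟨f, hf⟩ := hS s s.2; exact ⟨aeval y f, congrArg Prod.fst hf⟩)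
    (fun s hs => Subtype.ext (hS0 s s.2 hs)) X (fun i => ⟨Y i, hYS i⟩) hX (fun i => rfl) A hA _ hr
    (by rw [hr']; rfl)
  rw [hr'] at h0
  exact congrArg Prod.snd h0

end Vanishing

/-! ### Artin–Schreier equations over a rational function field -/

section RationalFunctions

open Polynomial

variable {p : ℕ} [Fact p.Prime] {L K : Type*} [Field L] [Field K] [Algebra L[X] K]
  [IsFractionRing L[X] K]

/-- In a rational function field, `c T` is of the form `w ^ p - w` only if `c = 0`. -/
theorem eq_zero_of_pow_eq_add_X_mul (w : K) (c : L)
    (h : w ^ p = w + algebraMap L[X] K X * algebraMap L[X] K (C c)) : c = 0 := by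
  have hp : 1 < p := (Fact.out : p.Prime).one_lt
  have hint : IsIntegral L[X] w := by
    refine ⟨X ^ p - (X + C (X * C c)), monic_X_pow_sub ?_, ?_⟩
    · refine lt_of_le_of_lt (degree_X_add_C _).le ?_
      exact_mod_cast hp
    · rw [eval₂_sub, eval₂_pow, eval₂_X, eval₂_add, eval₂_X, eval₂_C, h, map_mul, sub_self]
  obtain ⟨q, rfl⟩ := IsIntegrallyClosed.isIntegral_iff.1 hint
  have hq : q ^ p = q + X * C c := by
    apply IsFractionRing.injective L[X] K
    rw [map_pow, map_add, map_mul, h]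
  -- If q had positive degree then q ^ p would have larger degree than the right-hand side. So q is
  -- constant, and the coefficient of X gives c = 0.
  have hdeg : p * q.natDegree ≤ max q.natDegree 1 := by
    rw [← natDegree_pow, hq]
    refine (natDegree_add_le _ _).trans (max_le_max le_rfl ?_)
    refine natDegree_mul_le.trans ?_
    simp
  have hd0 : q.natDegree = 0 := by
    by_contra h0
    have : q.natDegree < p * q.natDegree := by
      conv_lhs => rw [← one_mul q.natDegree]
      exact Nat.mul_lt_mul_of_pos_right hp (Nat.pos_of_ne_zero h0)
    have : max q.natDegree 1 = q.natDegree := max_eq_left (Nat.one_le_iff_ne_zero.2 h0)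
    omega
  rw [eq_C_of_natDegree_eq_zero hd0, ← C_pow] at hq
  have := congrArg (fun r => coeff r 1) hq
  symm
  simpa only [coeff_add, coeff_C, coeff_mul_C, coeff_X_one, one_ne_zero, if_false, zero_add,
    one_mul, one_ne_zero] using this

/-- A relation satisfied by T z with T transcendental over L is an identity in L[T], where T may be
specialized to b. -/
theorem aeval_smul_eq_zero {k σ : Type*} [Field k] [Algebra k L] [Algebra k K]
    [IsScalarTower k L[X] K] (z : σ → L) (f : MvPolynomial σ k)
    (h : MvPolynomial.aeval (fun i => algebraMap L[X] K X * algebraMap L[X] K (C (z i))) f = 0)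
    (b : k) : MvPolynomial.aeval (fun i => algebraMap k L b * z i) f = 0 := by
  have h1 : MvPolynomial.aeval (fun i => X * C (z i)) f = 0 := by
    apply IsFractionRing.injective L[X] K
    rw [map_zero, ← h, ← MvPolynomial.aeval_algebraMap_apply]
    congr 2
    funext i
    rw [Function.comp_apply, map_mul]
  let ev : L[X] →ₐ[k] L := (Polynomial.aeval (R := L) (algebraMap k L b)).restrictScalars k
  have h2 : ev.comp (MvPolynomial.aeval fun i => X * C (z i))
      = MvPolynomial.aeval fun i => algebraMap k L b * z i :=
    MvPolynomial.algHom_ext fun i => by simp [ev]; ring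
  rw [← h2, AlgHom.comp_apply, h1, map_zero]

end RationalFunctions

/-! ### Construction of a generic point of the slice -/

section GenericPoint

open MvPolynomial

universe u

/-- A generic point of the slice of the cone. -/
structure IsGenericPoint (p : ℕ) (k : Type u) [Field k] [Algebra (ZMod p) k] {n : ℕ} {L : Type u}
    [Field L] [Algebra k L] (z : Fin (n + 1) ⊕ Fin (n + 1) → L) : Prop where
  one : z (Sum.inr 0) = 1
  cone : IsCone p z
  indep : ∀ l : Fin (n + 1) ⊕ Fin (n + 1) → ZMod p,
    ∑ i, algebraMap k L (algebraMap (ZMod p) k (l i)) * z i = 0 → l = 0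
  vanish : ∀ f : MvPolynomial (Fin (n + 1) ⊕ Fin (n + 1)) k, aeval z f = 0 →
    ∀ u : Fin (n + 1) ⊕ Fin (n + 1) → k, u (Sum.inr 0) = 1 → IsCone p u → aeval u f = 0
  trdeg : Algebra.trdeg k L = (n + 1 : ℕ)
  isAlgebraic : Algebra.IsAlgebraic (Algebra.adjoin k (Set.range z)) L

variable {p : ℕ} [Fact p.Prime]

/-- The elements algebraic over k[s] form a subfield of L, and L is algebraic over K; so it is
enough that this subfield contains K. -/
theorem isAlgebraic_adjoin_of_subfield {k L : Type*} [Field k] [Field L] [Algebra k L] (s : Set L)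
    (K : Type*) [Field K] [Algebra K L] [Algebra.IsAlgebraic K L]
    (h : ∀ S : Subfield L, (∀ x, x ∈ S ↔ IsAlgebraic (Algebra.adjoin k s) x) → ∀ κ : K, algebraMap K L κ ∈ S) :
    Algebra.IsAlgebraic (Algebra.adjoin k s) L := by
  let C : Subalgebra (Algebra.adjoin k s) L := Subalgebra.algebraicClosure _ L
  let S : Subfield L :=
    { C.toSubring with
      inv_mem' := fun x hx => IsAlgebraic.inv hx }
  have hS := h S fun x => Iff.rfl
  refine ⟨fun x => ?_⟩
  have hx : IsAlgebraic K x := Algebra.IsAlgebraic.isAlgebraic x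
  let g : K →+* C := (algebraMap K L).codRestrict C hS
  have hx' : IsAlgebraic C x :=
    hx.ringHom_of_comp_eq g (RingHom.id L) (RingHom.injective _) (RingHom.ext fun _ => rfl)
  exact hx'.restrictScalars (Algebra.adjoin k s)

/-- The cone is swept out by the multiples of its slice, so t z is a generic point of the cone over
L(t). The next generic point is (a, 1, x) with x^p - x = t z and a^p - a = ⟨x, t z⟩, taken in a
separable closure of L(t), which contains all the roots and is Galois. The independence of the
coordinates over 𝔽_p is carried along because it makes t z independent modulo the w^p - w at the
next stage. -/
theorem isGenericPoint_extendVec (hp : p ≠ 2) {k : Type u} [Field k] [Algebra (ZMod p) k]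
    (hcone : ∀ (n : ℕ) (u : Fin (n + 1) ⊕ Fin (n + 1) → k), IsCone p u → u (Sum.inr 0) ≠ 0)
    {n : ℕ} {L : Type u} [Field L] [Algebra k L] {z : Fin (n + 1) ⊕ Fin (n + 1) → L}
    (hz : IsGenericPoint p k z) (K E : Type u) [Field K] [Algebra (Polynomial L) K]
    [IsFractionRing (Polynomial L) K] [Field E] [Algebra K E] [IsSepClosure K E]
    [Algebra k K] [IsScalarTower k (Polynomial L) K] [Algebra k E] [IsScalarTower k K E]
    [Algebra L K] [IsScalarTower L (Polynomial L) K] [IsScalarTower k L K]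
    [Algebra (ZMod p) K] [Algebra (ZMod p) E] [IsScalarTower (ZMod p) K E] :
    ∃ z' : Fin (n + 2) ⊕ Fin (n + 2) → E, IsGenericPoint p k z' := by
  have hk : CharP k p := (Algebra.charP_iff (ZMod p) k p).1 inferInstance
  have hE : CharP E p := (Algebra.charP_iff (ZMod p) E p).1 inferInstance
  have : IsSepClosed E := IsSepClosure.sep_closed K
  have hprime : p.Prime := Fact.out
  set t : K := algebraMap (Polynomial L) K Polynomial.X with ht
  have hCL : ∀ c : L, algebraMap (Polynomial L) K (Polynomial.C c) = algebraMap L K c := fun c =>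
    (IsScalarTower.algebraMap_apply L (Polynomial L) K c).symm
  have hzmod : ∀ l : ZMod p, algebraMap (ZMod p) K l
      = algebraMap L K (algebraMap k L (algebraMap (ZMod p) k l)) := fun l =>
    RingHom.congr_fun (RingHom.ext_zmod (algebraMap (ZMod p) K)
      ((algebraMap L K).comp ((algebraMap k L).comp (algebraMap (ZMod p) k)))) l
  have hzmodE : ∀ l : ZMod p, algebraMap k E (algebraMap (ZMod p) k l) = algebraMap (ZMod p) E l :=
    fun l => RingHom.congr_fun (RingHom.ext_zmod
      ((algebraMap k E).comp (algebraMap (ZMod p) k)) (algebraMap (ZMod p) E)) l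
  have ht0 : t ≠ 0 := by
    rw [ht, Ne, IsFractionRing.to_map_eq_zero_iff]
    exact Polynomial.X_ne_zero
  let y : Fin (n + 1) ⊕ Fin (n + 1) → K := fun i => t * algebraMap L K (z i)
  have hy : ∀ l : Fin (n + 1) ⊕ Fin (n + 1) → ZMod p, ∀ w : K,
      w ^ p = w + ∑ i, algebraMap (ZMod p) K (l i) * y i → l = 0 := by
    intro l w hw
    refine hz.indep l (eq_zero_of_pow_eq_add_X_mul (p := p) (K := K) w _ ?_)
    rw [hw, hCL, map_sum, Finset.mul_sum]
    congr 1
    refine Finset.sum_congr rfl fun i _ => ?_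
    rw [hzmod, map_mul]
    simp only [y]
    ring
  -- A point of the cone is scaled into the slice by its coordinate b, which is nonzero; the
  -- relation is transported by specializing t to b.
  have hgen : ∀ f : MvPolynomial (Fin (n + 1) ⊕ Fin (n + 1)) k, aeval y f = 0 →
      ∀ u : Fin (n + 1) ⊕ Fin (n + 1) → k, IsCone p u → aeval u f = 0 := by
    intro f hf u hu
    have hb := hcone n u hu
    set b := u (Sum.inr 0) with hbdef
    let fb : MvPolynomial (Fin (n + 1) ⊕ Fin (n + 1)) k := aeval (fun i => C b * X i) f
    have hfb : ∀ {A : Type u} [CommRing A] [Algebra k A] (w : Fin (n + 1) ⊕ Fin (n + 1) → A),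
        aeval w fb = aeval (fun i => algebraMap k A b * w i) f := by
      intro A _ _ w
      have : (aeval w).comp (aeval fun i => C b * X i) = aeval (R := k) fun i => algebraMap k A b * w i :=
        algHom_ext fun i => by simp
      rw [← this]; rfl
    have h1 : aeval z fb = 0 := by
      rw [hfb]
      refine aeval_smul_eq_zero (K := K) z f ?_ b
      rw [← hf]
      congr 2
      funext i
      rw [hCL]
    have h2 := hz.vanish fb h1 (fun i => b⁻¹ * u i) (inv_mul_cancel₀ hb) (by
      refine ⟨fun j hj1 hj2 => ?_, ?_⟩
      · rw [frobPairing_smul, hu.1 j hj1 hj2, mul_zero]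
      · rw [frobPairing_smul]
        exact mul_ne_zero (pow_ne_zero _ (inv_ne_zero hb)) hu.2)
    rw [hfb] at h2
    rw [← h2]
    congr 2
    funext i
    simp [mul_inv_cancel_left₀ hb]
  choose x hx using fun i => exists_pow_eq_add (p := p) (algebraMap K E (y i))
  obtain ⟨a, ha⟩ := exists_pow_eq_add (p := p) (stdForm x fun i => algebraMap K E (y i))
  have hgal : IsGalois K E := inferInstance
  have hcy : IsCone p fun i => algebraMap K E (y i) := by
    have : ∀ j, frobPairing p (fun i => algebraMap K E (y i)) j
        = algebraMap K E (t ^ (1 + p ^ j) * algebraMap L K (frobPairing p z j)) := by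
      intro j
      rw [← map_frobPairing, map_frobPairing (algebraMap L K), ← frobPairing_smul]
    refine ⟨fun j hj1 hj2 => ?_, ?_⟩
    · rw [this, hz.cone.1 j hj1 hj2]; simp
    · rw [this, Ne, map_eq_zero, mul_eq_zero, map_eq_zero, not_or]
      exact ⟨pow_ne_zero _ ht0, hz.cone.2⟩
  have hfix : ∀ (σ : E ≃ₐ[K] E) (c : ZMod p), σ (algebraMap (ZMod p) E c) = algebraMap _ _ c := by
    intro σ c
    rw [IsScalarTower.algebraMap_apply (ZMod p) K E, σ.commutes]
  refine ⟨extendVec a x, rfl, ?_, ?_, ?_, ?_, ?_⟩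
  · refine (isCone_extendVec_iff p (Nat.succ_pos n) a x _ fun i => ?_).2 ⟨ha, hcy⟩
    rw [hx]; ring
  · intro l hl
    have htr := exists_algEquiv_translation y hy x hx
    simp only [hzmodE] at hl
    simp only [Fintype.sum_sum_type, Fin.sum_univ_succ (n := n + 1), extendVec, Sum.elim_inl,
      Sum.elim_inr, Fin.cons_zero, Fin.cons_succ] at hl
    -- The central translation moves only a, so the coefficient of a vanishes. The translations of x
    -- then remove the other coefficients, except that of the coordinate 1, which is left alone.
    have h1 : l (Sum.inl 0) = 0 := by
      obtain ⟨σ, hσx, hσa⟩ := exists_algEquiv_central hp y x hx a ha htr 1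
      have h2 := congrArg σ hl
      simp only [map_add, map_mul, map_sum, hfix, hσx, hσa, map_one, map_zero] at h2
      have h3 : algebraMap (ZMod p) E (l (Sum.inl 0)) = 0 := by linear_combination h2 - hl
      simpa using h3
    have h4 : ∀ v : Fin (n + 1) ⊕ Fin (n + 1) → ZMod p,
        ∑ i, l (Sum.inl (Fin.succ i)) * v (Sum.inl i)
          + ∑ i, l (Sum.inr (Fin.succ i)) * v (Sum.inr i) = 0 := by
      intro v
      obtain ⟨σ, hσ⟩ := htr v
      rw [h1, map_zero, zero_mul] at hl
      have h2 := congrArg σ hl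
      simp only [map_add, map_mul, map_sum, hfix, hσ, map_one, map_zero, mul_add,
        Finset.sum_add_distrib] at h2
      apply (algebraMap (ZMod p) E).injective
      simp only [map_add, map_mul, map_sum, map_zero]
      linear_combination h2 - hl
    have h5 : ∀ i, l (Sum.inl (Fin.succ i)) = 0 := by
      intro i
      simpa [Pi.single_apply] using h4 (Pi.single (Sum.inl i) 1)
    have h6 : ∀ i, l (Sum.inr (Fin.succ i)) = 0 := by
      intro i
      simpa [Pi.single_apply] using h4 (Pi.single (Sum.inr i) 1)
    have h7 : l (Sum.inr 0) = 0 := by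
      simpa [h1, h5, h6] using hl
    funext i
    rcases i with i | i
    · exact Fin.cases h1 h5 i
    · exact Fin.cases h7 h6 i
  · exact fun f hf u hu huc => eval_eq_zero_of_generic hp y hy hgen x hx a ha f hf u hu huc
  · have h1 : Algebra.trdeg k L + Algebra.trdeg L (Polynomial L) = Algebra.trdeg k (Polynomial L) :=
      trdeg_add_eq k L
    have h2 : Algebra.trdeg k (Polynomial L) + Algebra.trdeg (Polynomial L) K = Algebra.trdeg k K :=
      trdeg_add_eq k (Polynomial L)
    have h3 : Algebra.trdeg k K + Algebra.trdeg K E = Algebra.trdeg k E :=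
      trdeg_add_eq k K
    have : Algebra.IsAlgebraic (Polynomial L) K :=
      IsLocalization.isAlgebraic _ (nonZeroDivisors (Polynomial L))
    have : Algebra.IsAlgebraic K E := inferInstance
    rw [trdeg_eq_zero (R := Polynomial L), add_zero] at h2
    rw [trdeg_eq_zero (R := K), add_zero] at h3
    rw [← h3, ← h2, ← h1, hz.trdeg, Polynomial.trdeg_of_isDomain]
    push_cast
    rfl
  · have : Algebra.IsAlgebraic K E := inferInstance
    refine isAlgebraic_adjoin_of_subfield _ K fun S hS => ?_
    have hmem : ∀ w ∈ Algebra.adjoin k (Set.range (extendVec a x)), w ∈ S := by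
      intro w hw
      rw [hS]
      exact isAlgebraic_algebraMap (⟨w, hw⟩ : Algebra.adjoin k (Set.range (extendVec a x)))
    have hkS : ∀ c : k, algebraMap k E c ∈ S := fun c => hmem _ (Subalgebra.algebraMap_mem _ c)
    have hxS : ∀ i, x i ∈ S := by
      intro i
      refine hmem _ (Algebra.subset_adjoin ?_)
      rcases i with i | i
      · exact ⟨Sum.inl i.succ, rfl⟩
      · exact ⟨Sum.inr i.succ, rfl⟩
    have hyS : ∀ i, algebraMap K E (y i) ∈ S := by
      intro i
      have : algebraMap K E (y i) = x i ^ p - x i := by rw [hx]; ring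
      rw [this]
      exact sub_mem (pow_mem (hxS i) p) (hxS i)
    -- The coordinate of z at `Sum.inr 0` is 1, so t is itself one of the coordinates of y = Φ x -
    -- x.
    have htS : algebraMap K E t ∈ S := by
      have := hyS (Sum.inr 0)
      simpa [y, hz.one] using this
    have ht0' : algebraMap K E t ≠ 0 := by simpa using ht0
    have hzS : ∀ i, algebraMap K E (algebraMap L K (z i)) ∈ S := by
      intro i
      have : algebraMap K E (algebraMap L K (z i)) = algebraMap K E (y i) / algebraMap K E t := by
        rw [eq_div_iff ht0', mul_comm, ← map_mul]
      rw [this]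
      exact div_mem (hyS i) htS
    have hLS : ∀ c : L, algebraMap K E (algebraMap L K c) ∈ S := by
      intro c
      let g : L →+* E := (algebraMap K E).comp (algebraMap L K)
      have hadj : ∀ w ∈ Algebra.adjoin k (Set.range z), g w ∈ S := by
        intro w hw
        induction hw using Algebra.adjoin_induction with
        | mem w hw => obtain ⟨i, rfl⟩ := hw; exact hzS i
        | algebraMap c =>
          have : g (algebraMap k L c) = algebraMap k E c := by
            simp only [g, RingHom.comp_apply]
            rw [← IsScalarTower.algebraMap_apply k L K, ← IsScalarTower.algebraMap_apply k K E]
          rw [this]; exact hkS c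
        | add v w _ _ hv hw => rw [map_add]; exact add_mem hv hw
        | mul v w _ _ hv hw => rw [map_mul]; exact mul_mem hv hw
      have halg := hz.isAlgebraic
      have hc : IsAlgebraic (Algebra.adjoin k (Set.range z)) c := Algebra.IsAlgebraic.isAlgebraic c
      let B := Algebra.adjoin k (Set.range (extendVec a x))
      let C : Subalgebra B E := Subalgebra.algebraicClosure B E
      let h : Algebra.adjoin k (Set.range z) →+* C :=
        (g.comp (algebraMap (Algebra.adjoin k (Set.range z)) L)).codRestrict C
          fun w => (hS _).1 (hadj w w.2)
      have hc' : IsAlgebraic C (g c) := hc.ringHom_of_comp_eq h g (by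
        intro v w hvw
        exact Subtype.ext (g.injective (congrArg (algebraMap C E) hvw))) (RingHom.ext fun _ => rfl)
      exact (hS _).2 (hc'.restrictScalars B)
    have hpolyS : ∀ q : Polynomial L, algebraMap K E (algebraMap (Polynomial L) K q) ∈ S := by
      intro q
      induction q using Polynomial.induction_on' with
      | add q r hq hr => rw [map_add, map_add]; exact add_mem hq hr
      | monomial m c =>
        rw [← Polynomial.C_mul_X_pow_eq_monomial, map_mul, map_pow, map_mul, map_pow, hCL]
        exact mul_mem (hLS c) (pow_mem htS m)
    intro κ
    obtain ⟨q, r, -, rfl⟩ := IsFractionRing.div_surjective (A := Polynomial L) κ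
    rw [map_div₀]
    exact div_mem (hpolyS q) (hpolyS r)

/-- In rank one nothing has to vanish: the slice consists of the (a, 1) with a ≠ a^p, a line without
its 𝔽_p-points, and (T, 1) is generic. -/
theorem isGenericPoint_one {k : Type u} [Field k] [Algebra (ZMod p) k] (L : Type u) [Field L]
    [Algebra (Polynomial k) L] [IsFractionRing (Polynomial k) L] [Algebra k L]
    [IsScalarTower k (Polynomial k) L] :
    IsGenericPoint (n := 0) p k
      (extendVec (algebraMap (Polynomial k) L Polynomial.X) (Sum.elim Fin.elim0 Fin.elim0)) := by
  have hprime : p.Prime := Fact.out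
  have hinj : Function.Injective (algebraMap (Polynomial k) L) := IsFractionRing.injective _ _
  refine ⟨rfl, ⟨fun j hj1 hj2 => by omega, ?_⟩, ?_, ?_, ?_, ?_⟩
  · rw [frobPairing_extendVec]
    simp only [frobPairing, stdForm, Finset.univ_eq_empty, Finset.sum_empty, add_zero, zero_add,
      pow_one]
    rw [← map_pow, ← map_sub, Ne, map_eq_zero_iff _ hinj, sub_eq_zero]
    intro h
    have := congrArg Polynomial.natDegree h
    rw [Polynomial.natDegree_X, Polynomial.natDegree_X_pow] at this
    exact hprime.one_lt.ne this
  · intro l hl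
    have hc : ∀ c : k, algebraMap k L c = algebraMap (Polynomial k) L (Polynomial.C c) := fun c =>
      IsScalarTower.algebraMap_apply k (Polynomial k) L c
    simp only [Fintype.sum_sum_type, Fin.sum_univ_succ (n := 0), extendVec, Sum.elim_inl,
      Sum.elim_inr, Fin.cons_zero, Finset.univ_eq_empty, Finset.sum_empty, add_zero, mul_one,
      hc, ← map_mul, ← map_add] at hl
    rw [map_eq_zero_iff _ hinj] at hl
    have h0 := congrArg (fun q => Polynomial.coeff q 0) hl
    have h1 := congrArg (fun q => Polynomial.coeff q 1) hl
    simp only [Polynomial.coeff_add, Polynomial.coeff_mul_X_zero, Polynomial.coeff_C_zero, zero_add,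
      Polynomial.coeff_zero, map_eq_zero] at h0
    simp only [Polynomial.coeff_mul_X, Polynomial.coeff_C_zero,
      Polynomial.coeff_zero, h0, map_zero, add_zero, map_eq_zero] at h1
    funext i
    rcases i with i | i
    · rw [Fin.fin_one_eq_zero i]; exact h1
    · rw [Fin.fin_one_eq_zero i]; exact h0
  · intro f hf u hu _
    have h1 : aeval (extendVec (Polynomial.X : Polynomial k) (Sum.elim Fin.elim0 Fin.elim0)) f = 0 := by
      apply hinj
      rw [map_zero, ← hf, ← aeval_algebraMap_apply]
      congr 2
      funext i
      rcases i with i | i <;> rw [Fin.fin_one_eq_zero i] <;> simp [extendVec]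
    have h2 : (Polynomial.aeval (u (Sum.inl 0))).comp
        (aeval (extendVec (Polynomial.X : Polynomial k) (Sum.elim Fin.elim0 Fin.elim0)))
        = aeval u := by
      refine algHom_ext fun i => ?_
      rcases i with i | i <;> rw [Fin.fin_one_eq_zero i] <;> simp [extendVec, hu]
    rw [← h2, AlgHom.comp_apply, h1, map_zero]
  · have h2 : Algebra.trdeg k (Polynomial k) + Algebra.trdeg (Polynomial k) L = Algebra.trdeg k L :=
      trdeg_add_eq k (Polynomial k)
    have : Algebra.IsAlgebraic (Polynomial k) L :=
      IsLocalization.isAlgebraic _ (nonZeroDivisors (Polynomial k))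
    rw [trdeg_eq_zero (R := Polynomial k), add_zero] at h2
    rw [← h2, Polynomial.trdeg_of_isDomain]
    simp
  · refine isAlgebraic_adjoin_of_subfield _ L fun S hS => ?_
    have hmem : ∀ w ∈ Algebra.adjoin k (Set.range (extendVec (algebraMap (Polynomial k) L
        Polynomial.X) (Sum.elim Fin.elim0 Fin.elim0))), w ∈ S := by
      intro w hw
      rw [hS]
      exact isAlgebraic_algebraMap (⟨w, hw⟩ : Algebra.adjoin k _)
    have hX : algebraMap (Polynomial k) L Polynomial.X ∈ S :=
      hmem _ (Algebra.subset_adjoin ⟨Sum.inl 0, rfl⟩)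
    have hpolyS : ∀ q : Polynomial k, algebraMap (Polynomial k) L q ∈ S := by
      intro q
      induction q using Polynomial.induction_on' with
      | add q r hq hr => rw [map_add]; exact add_mem hq hr
      | monomial m c =>
        rw [← Polynomial.C_mul_X_pow_eq_monomial, map_mul, map_pow]
        refine mul_mem ?_ (pow_mem hX m)
        have : algebraMap (Polynomial k) L (Polynomial.C c) = algebraMap k L c :=
          (IsScalarTower.algebraMap_apply k (Polynomial k) L c).symm
        rw [this]
        exact hmem _ (Subalgebra.algebraMap_mem _ c)
    intro κ
    obtain ⟨q, r, -, rfl⟩ := IsFractionRing.div_surjective (A := Polynomial k) κ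
    exact div_mem (hpolyS q) (hpolyS r)

theorem exists_isGenericPoint (hp : p ≠ 2) {k : Type u} [Field k] [Algebra (ZMod p) k]
    (hcone : ∀ (n : ℕ) (u : Fin (n + 1) ⊕ Fin (n + 1) → k), IsCone p u → u (Sum.inr 0) ≠ 0)
    (n : ℕ) : ∃ (L : Type u) (_ : Field L) (_ : Algebra k L) (z : Fin (n + 1) ⊕ Fin (n + 1) → L),
      IsGenericPoint p k z := by
  induction n with
  | zero => exact ⟨FractionRing (Polynomial k), _, _, _, isGenericPoint_one _⟩
  | succ n ih =>
    obtain ⟨L, _, _, z, hz⟩ := ih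
    let K := FractionRing (Polynomial L)
    obtain ⟨E, _, _, _⟩ : ∃ (E : Type u) (_ : Field E) (_ : Algebra K E), IsSepClosure K E :=
      ⟨SeparableClosure K, _, _, inferInstance⟩
    let _ : Algebra (ZMod p) K := ((algebraMap k K).comp (algebraMap (ZMod p) k)).toAlgebra
    let _ : Algebra (ZMod p) E := ((algebraMap K E).comp (algebraMap (ZMod p) K)).toAlgebra
    let _ : Algebra k E := ((algebraMap K E).comp (algebraMap k K)).toAlgebra
    have : IsScalarTower (ZMod p) K E := IsScalarTower.of_algebraMap_eq fun _ => rfl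
    have : IsScalarTower k K E := IsScalarTower.of_algebraMap_eq fun _ => rfl
    obtain ⟨z', hz'⟩ := isGenericPoint_extendVec hp hcone hz K E
    exact ⟨E, _, _, z', hz'⟩

end GenericPoint

/-! ### Krull dimension of irreducible affine sets -/

section KrullDimension

open MvPolynomial

/-- Lying over and going up lift chains of primes, and incomparability keeps contracted chains
strict. -/
theorem ringKrullDim_eq_of_isIntegral {R S : Type*} [CommRing R] [CommRing S] [Algebra R S]
    [Algebra.IsIntegral R S] (hinj : Function.Injective (algebraMap R S)) :
    ringKrullDim R = ringKrullDim S := by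
  refine le_antisymm ?_ ?_
  · refine iSup_le fun l => ?_
    have hgu : Algebra.HasGoingUp R S := inferInstance
    obtain ⟨P, -, hP, hPc⟩ := Ideal.exists_ideal_over_prime_of_isIntegral l.head.asIdeal (⊥ : Ideal S)
      (by rw [← RingHom.ker_eq_comap_bot, (RingHom.injective_iff_ker_eq_bot _).1 hinj]; exact bot_le)
    have : P.LiesOver l.head.asIdeal := ⟨hPc.symm⟩
    obtain ⟨L, hL, -⟩ := Ideal.exists_ltSeries_of_hasGoingUp l P
    rw [← hL]
    exact Order.LTSeries.length_le_krullDim L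
  · refine Order.krullDim_le_of_strictMono (PrimeSpectrum.comap (algebraMap R S)) fun P Q h => ?_
    exact Ideal.IsIntegral.comap_lt_comap (I := P.asIdeal) (J := Q.asIdeal) h

universe u

/-- Noether normalization reduces this to a polynomial ring, whose number of variables is read off
from the transcendence degree. -/
theorem ringKrullDim_eq_of_trdeg {k A : Type u} [Field k] [CommRing A] [IsDomain A] [Algebra k A]
    [Algebra.FiniteType k A] {n : ℕ} (h : Algebra.trdeg k A = n) : ringKrullDim A = n := by
  obtain ⟨s, g, hg, hint⟩ := exists_integral_inj_algHom_of_fg k A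
  let _ : Algebra (MvPolynomial (Fin s) k) A := g.toRingHom.toAlgebra
  have : IsScalarTower k (MvPolynomial (Fin s) k) A := IsScalarTower.of_algebraMap_eq fun c =>
    (g.commutes c).symm
  have hI : Algebra.IsIntegral (MvPolynomial (Fin s) k) A := ⟨hint⟩
  have hinj : Function.Injective (algebraMap (MvPolynomial (Fin s) k) A) := hg
  have : FaithfulSMul (MvPolynomial (Fin s) k) A := (faithfulSMul_iff_algebraMap_injective _ _).2 hinj
  have h2 : Algebra.trdeg k (MvPolynomial (Fin s) k) + Algebra.trdeg (MvPolynomial (Fin s) k) A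
    = Algebra.trdeg k A := trdeg_add_eq k _
  have : Algebra.IsAlgebraic (MvPolynomial (Fin s) k) A := inferInstance
  rw [trdeg_eq_zero (R := MvPolynomial (Fin s) k), add_zero, h, MvPolynomial.trdeg_of_isDomain] at h2
  have hs : s = n := by simpa using h2
  rw [← ringKrullDim_eq_of_isIntegral hinj, MvPolynomial.ringKrullDim_of_isNoetherianRing,
    ringKrullDim_eq_zero_of_field, zero_add, hs]
  simp

variable {σ : Type*} [Finite σ] {k : Type*} [Field k] [IsAlgClosed k] {X : Type*}
  [TopologicalSpace X]

/-- A space with a bijection to the zero locus of a prime ideal `P`, whose topology comes from the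
Zariski topology, is irreducible, and its dimension is that of the quotient by `P`. -/
theorem irreducibleSpace_and_krullDim_of_prime (j : X → σ → k)
    (hj : ∀ U : Set X, IsOpen U ↔ ∀ x ∈ U, ∃ f : MvPolynomial σ k, aeval (j x) f ≠ 0 ∧
      ∀ y, aeval (j y) f ≠ 0 → y ∈ U)
    (P : Ideal (MvPolynomial σ k)) [hP : P.IsPrime] (hr : Set.range j = zeroLocus k P) :
    IrreducibleSpace X ∧ topologicalKrullDim X = ringKrullDim (MvPolynomial σ k ⧸ P) := by
  let Z : Ideal (MvPolynomial σ k) → Set X := fun Q => {x | ∀ f ∈ Q, aeval (j x) f = 0}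
  let I : Set X → Ideal (MvPolynomial σ k) := fun S => vanishingIdeal k (j '' S)
  have hI : ∀ S f, f ∈ I S ↔ ∀ x ∈ S, aeval (j x) f = 0 := fun S f => by
    simp only [I, mem_vanishingIdeal_iff, Set.forall_mem_image]
  have hZclosed : ∀ Q, IsClosed (Z Q) := by
    intro Q
    rw [← isOpen_compl_iff, hj]
    intro x hx
    simp only [Z, Set.mem_compl_iff, Set.mem_ofPred_eq, not_forall] at hx
    obtain ⟨f, hf, hfx⟩ := hx
    exact ⟨f, hfx, fun y hy hy' => hy (hy' f hf)⟩
  have hZI : ∀ S, IsClosed S → Z (I S) = S := by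
    intro S hS
    refine Set.Subset.antisymm (fun x hx => ?_) fun x hx f hf => (hI S f).1 hf x hx
    by_contra hxS
    obtain ⟨f, hf, hf'⟩ := (hj Sᶜ).1 hS.isOpen_compl x hxS
    refine hf (hx f ((hI S f).2 fun y hy => ?_))
    by_contra h
    exact hf' y h hy
  -- The Nullstellensatz; since P ≤ Q, all of the zero locus of Q is in the image of j.
  have hIZ : ∀ Q : Ideal (MvPolynomial σ k), Q.IsPrime → P ≤ Q → I (Z Q) = Q := by
    intro Q hQ hPQ
    have : j '' Z Q = zeroLocus k Q := by
      refine Set.Subset.antisymm ?_ fun y hy => ?_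
      · rintro _ ⟨x, hx, rfl⟩; exact hx
      · obtain ⟨x, rfl⟩ : y ∈ Set.range j := by rw [hr]; exact fun f hf => hy f (hPQ hf)
        exact ⟨x, hy, rfl⟩
    simp only [I, this]
    exact IsPrime.vanishingIdeal_zeroLocus Q
  have hPI : ∀ S, P ≤ I S := by
    intro S f hf
    rw [hI]
    intro x _
    have : j x ∈ zeroLocus k P := hr ▸ ⟨x, rfl⟩
    exact this f hf
  have hIprime : ∀ S, IsIrreducible S → (I S).IsPrime := by
    intro S hS
    refine ⟨?_, ?_⟩
    · rw [Ne, Ideal.eq_top_iff_one, hI]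
      intro h
      obtain ⟨x, hx⟩ := hS.nonempty
      simpa using h x hx
    · intro f g hfg
      by_contra h
      rw [not_or] at h
      obtain ⟨h1, h2⟩ := h
      rw [hI] at h1 h2
      push Not at h1 h2
      obtain ⟨x, hx, hfx⟩ := h1
      obtain ⟨y, hy, hgy⟩ := h2
      have hopen : ∀ f : MvPolynomial σ k, IsOpen {x | aeval (j x) f ≠ 0} := fun f =>
        (hj _).2 fun x hx => ⟨f, hx, fun y hy => hy⟩
      obtain ⟨w, hw, hw1, hw2⟩ := hS.isPreirreducible _ _ (hopen f) (hopen g) ⟨x, hx, hfx⟩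
        ⟨y, hy, hgy⟩
      have := (hI S _).1 hfg w hw
      rw [map_mul] at this
      exact (mul_ne_zero hw1 hw2) this
  have hZirr : ∀ Q : Ideal (MvPolynomial σ k), Q.IsPrime → P ≤ Q → IsIrreducible (Z Q) := by
    intro Q hQ hPQ
    have hQI := hIZ Q hQ hPQ
    refine ⟨?_, ?_⟩
    · by_contra h
      rw [Set.not_nonempty_iff_eq_empty] at h
      refine hQ.ne_top ?_
      rw [← hQI, h, Ideal.eq_top_iff_one, hI]
      simp
    · rintro U V hU hV ⟨x, hx, hxU⟩ ⟨y, hy, hyV⟩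
      obtain ⟨f, hf, hf'⟩ := (hj U).1 hU x hxU
      obtain ⟨g, hg, hg'⟩ := (hj V).1 hV y hyV
      by_contra h
      have h0 : f * g ∈ Q := by
        rw [← hQI, hI]
        intro w hw
        rw [map_mul]
        by_contra hne
        exact h ⟨w, hw, hf' w (left_ne_zero_of_mul hne), hg' w (right_ne_zero_of_mul hne)⟩
      rcases hQ.mem_or_mem h0 with h1 | h1
      · exact hf (hx f h1)
      · exact hg (hy g h1)
  constructor
  · have : Z P = Set.univ := Set.eq_univ_of_forall fun x f hf => by
      have : j x ∈ zeroLocus k P := hr ▸ ⟨x, rfl⟩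
      exact this f hf
    have h1 := hZirr P hP le_rfl
    rw [this] at h1
    exact (irreducibleSpace_def X).2 h1
  · rw [ringKrullDim_quotient, topologicalKrullDim, ← Order.krullDim_orderDual]
    -- Irreducible closed subsets correspond to the primes above P with reversed inclusions.
    let F : (TopologicalSpace.IrreducibleCloseds X)ᵒᵈ ≃o PrimeSpectrum.zeroLocus (P : Set (MvPolynomial σ k)) :=
      { toFun := fun S => ⟨⟨I (OrderDual.ofDual S).carrier, hIprime _ (OrderDual.ofDual S).isIrreducible'⟩, hPI _⟩
        invFun := fun Q => OrderDual.toDual ⟨Z Q.1.asIdeal, hZirr _ Q.1.2 Q.2, hZclosed _⟩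
        left_inv := fun S => TopologicalSpace.IrreducibleCloseds.ext (hZI _ (OrderDual.ofDual S).isClosed')
        right_inv := fun Q => Subtype.ext (PrimeSpectrum.ext (hIZ _ Q.1.2 Q.2))
        map_rel_iff' := by
          intro S T
          change I _ ≤ I _ ↔ (OrderDual.ofDual T).carrier ⊆ (OrderDual.ofDual S).carrier
          constructor
          · intro h
            rw [← hZI _ (OrderDual.ofDual S).isClosed', ← hZI _ (OrderDual.ofDual T).isClosed']
            exact fun x hx f hf => hx f (h hf)
          · intro h f hf
            rw [hI] at hf ⊢
            exact fun x hx => hf x (h hx) }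
    exact Order.krullDim_eq_of_orderIso F

end KrullDimension

/-! ### Polynomial functions and Zariski open sets -/

section PolyFun

variable {k : Type*} [Field k] {M M' : Type*} [AddCommGroup M] [Module k M] [AddCommGroup M']
  [Module k M']

theorem dual_mem_polyFun (f : Module.Dual k M) : (f : M → k) ∈ polyFun k M :=
  Algebra.subset_adjoin ⟨f, rfl⟩

theorem const_mem_polyFun (c : k) : (fun _ : M => c) ∈ polyFun k M :=
  Subalgebra.algebraMap_mem (polyFun k M) c

theorem polyFun_comp (P : M → M') (hP : ∀ g : Module.Dual k M', (fun x => g (P x)) ∈ polyFun k M)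
    {f : M' → k} (hf : f ∈ polyFun k M') : (fun x => f (P x)) ∈ polyFun k M := by
  induction hf using Algebra.adjoin_induction with
  | mem f hf => obtain ⟨g, rfl⟩ := hf; exact hP g
  | algebraMap c => exact const_mem_polyFun c
  | add f g _ _ hf hg => exact add_mem hf hg
  | mul f g _ _ hf hg => exact mul_mem hf hg

theorem polyFun_comp_affine (L : M →ₗ[k] M') (v : M') {f : M' → k} (hf : f ∈ polyFun k M') :
    (fun x => f (L x + v)) ∈ polyFun k M := by
  refine polyFun_comp (fun x => L x + v) (fun g => ?_) hf
  simp only [map_add]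
  exact add_mem (dual_mem_polyFun (g.comp L)) (const_mem_polyFun (g v))

theorem polyFun_comp_linear (L : M →ₗ[k] M') {f : M' → k} (hf : f ∈ polyFun k M') :
    (fun x => f (L x)) ∈ polyFun k M := by
  simpa using polyFun_comp_affine L 0 hf

/-- Products of polynomial functions make the generating open sets stable under intersection, so
they are a basis. -/
theorem isOpen_zariski_iff {U : Set M} : @IsOpen M (zariskiTopology k M) U ↔
    ∀ x ∈ U, ∃ f ∈ polyFun k M, f x ≠ 0 ∧ ∀ y, f y ≠ 0 → y ∈ U := by
  constructor
  · intro h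
    induction h with
    | basic U hU =>
      obtain ⟨f, hf, rfl⟩ := hU
      exact fun x hx => ⟨f, hf, hx, fun y hy => hy⟩
    | univ => exact fun x _ => ⟨fun _ => 1, const_mem_polyFun 1, one_ne_zero, fun _ _ => trivial⟩
    | inter U V _ _ hU hV =>
      rintro x ⟨hxU, hxV⟩
      obtain ⟨f, hf, hfx, hfU⟩ := hU x hxU
      obtain ⟨g, hg, hgx, hgV⟩ := hV x hxV
      exact ⟨f * g, mul_mem hf hg, mul_ne_zero hfx hgx, fun y hy =>
        ⟨hfU y (left_ne_zero_of_mul hy), hgV y (right_ne_zero_of_mul hy)⟩⟩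
    | sUnion S _ hS =>
      rintro x ⟨U, hUS, hxU⟩
      obtain ⟨f, hf, hfx, hfU⟩ := hS U hUS x hxU
      exact ⟨f, hf, hfx, fun y hy => ⟨U, hUS, hfU y hy⟩⟩
  · intro h
    choose! f hf hfx hfU using h
    have : U = ⋃ x ∈ U, {y | f x y ≠ 0} := by
      ext y
      simp only [Set.mem_iUnion, exists_prop]
      exact ⟨fun hy => ⟨y, hy, hfx y hy⟩, fun ⟨x, hx, hy⟩ => hfU x hx y hy⟩
    rw [this]
    let _ := zariskiTopology k M
    exact isOpen_biUnion fun x hx => TopologicalSpace.isOpen_generateFrom_of_mem ⟨f x, hf x hx, rfl⟩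

theorem isOpen_induced_zariski_iff {X : Type*} (j : X → M) {U : Set X} :
    @IsOpen X ((zariskiTopology k M).induced j) U ↔
      ∀ x ∈ U, ∃ f ∈ polyFun k M, f (j x) ≠ 0 ∧ ∀ y, f (j y) ≠ 0 → y ∈ U := by
  constructor
  · rintro ⟨V, hV, rfl⟩ x hx
    obtain ⟨f, hf, hfx, hfV⟩ := isOpen_zariski_iff.1 hV (j x) hx
    exact ⟨f, hf, hfx, fun y hy => hfV _ hy⟩
  · intro h
    choose! f hf hfx hfU using h
    have : U = ⋃ x ∈ U, j ⁻¹' {y | f x y ≠ 0} := by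
      ext y
      simp only [Set.mem_iUnion, exists_prop]
      exact ⟨fun hy => ⟨y, hy, hfx y hy⟩, fun ⟨x, hx, hy⟩ => hfU x hx y hy⟩
    rw [this]
    let _ := (zariskiTopology k M).induced j
    refine isOpen_biUnion fun x hx => ?_
    refine ⟨_, ?_, rfl⟩
    exact TopologicalSpace.isOpen_generateFrom_of_mem ⟨f x, hf x hx, rfl⟩

theorem mem_polyFun_pi_iff {σ : Type*} [Finite σ] {f : (σ → k) → k} :
    f ∈ polyFun k (σ → k) ↔ ∃ F : MvPolynomial σ k, ∀ x, f x = MvPolynomial.aeval x F := by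
  constructor
  · intro hf
    induction hf using Algebra.adjoin_induction with
    | mem f hf =>
      obtain ⟨g, rfl⟩ := hf
      classical
      have := Fintype.ofFinite σ
      refine ⟨∑ i, MvPolynomial.C (g (Pi.single i 1)) * MvPolynomial.X i, fun x => ?_⟩
      change g x = _
      rw [LinearMap.pi_apply_eq_sum_univ g x, map_sum]
      refine Finset.sum_congr rfl fun i _ => ?_
      have : (fun j => if i = j then (1 : k) else 0) = Pi.single i 1 := by
        ext j; simp [Pi.single_apply, eq_comm]
      rw [this]
      simp [mul_comm]
    | algebraMap c => exact ⟨MvPolynomial.C c, fun x => by simp⟩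
    | add f g _ _ hf hg =>
      obtain ⟨F, hF⟩ := hf
      obtain ⟨G, hG⟩ := hg
      exact ⟨F + G, fun x => by rw [map_add, ← hF, ← hG]; rfl⟩
    | mul f g _ _ hf hg =>
      obtain ⟨F, hF⟩ := hf
      obtain ⟨G, hG⟩ := hg
      exact ⟨F * G, fun x => by rw [map_mul, ← hF, ← hG]; rfl⟩
  · rintro ⟨F, hF⟩
    have : f = fun x => MvPolynomial.aeval x F := funext hF
    rw [this]
    clear hF this
    induction F using MvPolynomial.induction_on with
    | C c => simpa using const_mem_polyFun c
    | add F G hF hG =>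
      simp only [map_add]
      exact add_mem hF hG
    | mul_X F i hF =>
      simp only [map_mul, MvPolynomial.aeval_X]
      exact mul_mem hF (dual_mem_polyFun (LinearMap.proj i : Module.Dual k (σ → k)))

end PolyFun

/-! ### Irreducibility and dimension of the slice -/

section Slice

open MvPolynomial

universe u

/-- The slice of the cone by the hyperplane on which the coordinate dual to the first is `1`. -/
structure Slice (p : ℕ) (k : Type*) [Field k] (n : ℕ) where
  vec : Fin (n + 1) ⊕ Fin (n + 1) → k
  one : vec (Sum.inr 0) = 1
  cone : IsCone p vec

instance (p : ℕ) (k : Type*) [Field k] (n : ℕ) : TopologicalSpace (Slice p k n) :=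
  (zariskiTopology k (Fin (n + 1) ⊕ Fin (n + 1) → k)).induced Slice.vec

/-- The variable `none` stands for the inverse of q. The exponent N and the numerator g depend on f
alone, so the same numerator serves at the generic point and at every point of the slice. -/
theorem exists_clear_denominators {σ : Type*} {k : Type u} [Field k] (q : MvPolynomial σ k)
    (f : MvPolynomial (Option σ) k) : ∃ (N : ℕ) (g : MvPolynomial σ k), ∀ (A : Type u) [Field A]
      [Algebra k A] (w : Option σ → A), w none * aeval (fun i => w (some i)) q = 1 →
      aeval w f * aeval (fun i => w (some i)) q ^ N = aeval (fun i => w (some i)) g := by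
  induction f using MvPolynomial.induction_on with
  | C c => exact ⟨0, C c, fun A _ _ w _ => by simp⟩
  | add f g hf hg =>
    obtain ⟨N, f', hf⟩ := hf
    obtain ⟨N', g', hg⟩ := hg
    refine ⟨N + N', f' * q ^ N' + g' * q ^ N, fun A _ _ w hw => ?_⟩
    simp only [map_add, map_mul, map_pow]
    rw [← hf A w hw, ← hg A w hw]
    ring
  | mul_X f i hf =>
    obtain ⟨N, f', hf⟩ := hf
    rcases i with _ | i
    · refine ⟨N + 1, f', fun A _ _ w hw => ?_⟩
      rw [← hf A w hw, map_mul, aeval_X]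
      linear_combination (aeval w f * aeval (fun i => w (some i)) q ^ N) * hw
    · refine ⟨N, f' * X i, fun A _ _ w hw => ?_⟩
      rw [map_mul, map_mul, ← hf A w hw, aeval_X, aeval_X]
      ring

/-- Adjoining the inverse of ⟨x, Φ^{n+1} x⟩ as a coordinate makes the slice a closed affine set. It
is the zero locus of the kernel of evaluation at the generic point, which is prime as L is a field.
-/
theorem irreducibleSpace_slice_and_krullDim {p : ℕ} [Fact p.Prime] (hp : p ≠ 2) {k : Type u}
    [Field k] [IsAlgClosed k] [Algebra (ZMod p) k]
    (hcone : ∀ (n : ℕ) (u : Fin (n + 1) ⊕ Fin (n + 1) → k), IsCone p u → u (Sum.inr 0) ≠ 0)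
    (n : ℕ) : IrreducibleSpace (Slice p k n) ∧ topologicalKrullDim (Slice p k n) = (n + 1 : ℕ) := by
  obtain ⟨L, _, _, z, hz⟩ := exists_isGenericPoint hp hcone n
  let q : MvPolynomial (Fin (n + 1) ⊕ Fin (n + 1)) k := frobPairing p X (n + 1)
  have hq : ∀ {A : Type u} [Field A] [Algebra k A] (x : Fin (n + 1) ⊕ Fin (n + 1) → A),
      aeval x q = frobPairing p x (n + 1) := by
    intro A _ _ x
    rw [map_frobPairing]
    simp only [aeval_X]
  let w : Option (Fin (n + 1) ⊕ Fin (n + 1)) → L := fun o => o.elim (frobPairing p z (n + 1))⁻¹ z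
  let j : Slice p k n → Option (Fin (n + 1) ⊕ Fin (n + 1)) → k := fun x o =>
    o.elim (frobPairing p x.vec (n + 1))⁻¹ x.vec
  have hw : w none * aeval (fun i => w (some i)) q = 1 := by
    rw [hq]
    exact inv_mul_cancel₀ hz.cone.2
  have hjq : ∀ x, j x none * aeval (fun i => j x (some i)) q = 1 := by
    intro x
    rw [hq]
    exact inv_mul_cancel₀ x.cone.2
  let φ : MvPolynomial (Option (Fin (n + 1) ⊕ Fin (n + 1))) k →ₐ[k] L := aeval w
  have hPprime : (RingHom.ker φ).IsPrime := RingHom.ker_isPrime _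
  have hmemP : ∀ f, f ∈ RingHom.ker φ ↔ aeval w f = 0 := fun f => RingHom.mem_ker
  have hr : Set.range j = zeroLocus k (RingHom.ker φ) := by
    refine Set.Subset.antisymm ?_ fun y hy => ?_
    · rintro _ ⟨x, rfl⟩ f hf
      rw [hmemP] at hf
      obtain ⟨N, g, hg⟩ := exists_clear_denominators q f
      have h1 := hg L w hw
      rw [hf, zero_mul] at h1
      have h2 := hz.vanish g h1.symm x.vec x.one x.cone
      have h3 := hg k (j x) (hjq x)
      have h4 : aeval (fun i => j x (some i)) g = 0 := h2
      rw [h4] at h3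
      refine (mul_eq_zero.1 h3).resolve_right (pow_ne_zero _ ?_)
      exact right_ne_zero_of_mul (hjq x ▸ one_ne_zero)
    · let x : Fin (n + 1) ⊕ Fin (n + 1) → k := fun i => y (some i)
      have h1 : y none * frobPairing p x (n + 1) = 1 := by
        have := hy (X none * frobPairing p (fun i => X (some i)) (n + 1) - 1) (by
          rw [hmemP, map_sub, map_mul, map_frobPairing, map_one, sub_eq_zero]
          simp only [aeval_X]
          rw [← hq]; exact hw)
        rw [map_sub, map_mul, map_frobPairing, map_one, sub_eq_zero] at this
        simpa only [aeval_X] using this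
      have h2 : x (Sum.inr 0) = 1 := by
        have := hy (X (some (Sum.inr 0)) - 1) (by
          rw [hmemP, map_sub, aeval_X, map_one, sub_eq_zero]; exact hz.one)
        rwa [map_sub, aeval_X, map_one, sub_eq_zero] at this
      have h3 : IsCone p x := by
        refine ⟨fun l hl1 hl2 => ?_, right_ne_zero_of_mul (h1 ▸ one_ne_zero)⟩
        have := hy (frobPairing p (fun i => X (some i)) l) (by
          rw [hmemP, map_frobPairing]
          simp only [aeval_X]
          exact hz.cone.1 l hl1 hl2)
        rw [map_frobPairing] at this
        simpa only [aeval_X] using this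
      refine ⟨⟨x, h2, h3⟩, ?_⟩
      funext o
      rcases o with _ | i
      · exact (eq_inv_of_mul_eq_one_left h1).symm
      · rfl
  have hj : ∀ U : Set (Slice p k n), IsOpen U ↔ ∀ x ∈ U,
      ∃ f : MvPolynomial (Option (Fin (n + 1) ⊕ Fin (n + 1))) k, aeval (j x) f ≠ 0 ∧
      ∀ y, aeval (j y) f ≠ 0 → y ∈ U := by
    intro U
    refine (isOpen_induced_zariski_iff (k := k) (Slice.vec : Slice p k n → _)).trans ?_
    refine forall_congr' fun x => forall_congr' fun hx => ?_
    constructor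
    · rintro ⟨f, hf, hfx, hfU⟩
      obtain ⟨F, hF⟩ := mem_polyFun_pi_iff.1 hf
      have h : ∀ y, aeval (j y) (rename some F) = f y.vec := by
        intro y
        rw [aeval_rename, hF]
        rfl
      refine ⟨rename some F, by rwa [h], fun y hy => hfU y (by rwa [h] at hy)⟩
    · rintro ⟨f, hfx, hfU⟩
      obtain ⟨N, g, hg⟩ := exists_clear_denominators q f
      have h : ∀ y, aeval (j y) f ≠ 0 ↔ aeval y.vec g ≠ 0 := by
        intro y
        have h3 : _ = aeval y.vec g := hg k (j y) (hjq y)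
        rw [← h3, mul_ne_zero_iff]
        have : aeval (fun i => j y (some i)) q ≠ 0 := right_ne_zero_of_mul (hjq y ▸ one_ne_zero)
        exact ⟨fun h => ⟨h, pow_ne_zero _ this⟩, fun h => h.1⟩
      exact ⟨fun y => aeval y g, mem_polyFun_pi_iff.2 ⟨g, fun _ => rfl⟩, (h x).1 hfx,
        fun y hy => hfU y ((h y).2 hy)⟩
  obtain ⟨hirr, hdim⟩ := irreducibleSpace_and_krullDim_of_prime j hj (RingHom.ker φ) hr
  refine ⟨hirr, hdim.trans ?_⟩
  have e := Ideal.quotientKerAlgEquivOfSurjective (AlgHom.rangeRestrict_surjective φ)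
  have hker : RingHom.ker φ.rangeRestrict = RingHom.ker φ := by
    ext f
    simp only [RingHom.mem_ker]
    exact Subtype.ext_iff
  have hft : Algebra.FiniteType k φ.range :=
    Algebra.FiniteType.of_surjective φ.rangeRestrict (AlgHom.rangeRestrict_surjective φ)
  rw [← hker, ringKrullDim_eq_of_ringEquiv e.toRingEquiv]
  refine ringKrullDim_eq_of_trdeg (k := k) ?_
  have hle : Algebra.adjoin k (Set.range z) ≤ φ.range := by
    refine Algebra.adjoin_le ?_
    rintro _ ⟨i, rfl⟩
    exact ⟨X (some i), by simp [φ, w]⟩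
  -- L is algebraic over the coordinate ring `φ.range`, so the two have the same transcendence
  -- degree.
  have halg : Algebra.IsAlgebraic φ.range L := by
    have := hz.isAlgebraic
    exact ⟨fun x => IsAlgebraic.tower_top_of_subalgebra_le hle (Algebra.IsAlgebraic.isAlgebraic x)⟩
  have htr : Algebra.trdeg k φ.range + Algebra.trdeg φ.range L = Algebra.trdeg k L :=
    trdeg_add_eq k _
  rw [trdeg_eq_zero (R := φ.range), add_zero] at htr
  rw [htr, hz.trdeg]

end Slice

/-! ### Isotropic subspaces and dual families -/

section Lagrangian

variable {K : Type*} [Field K] {E : Type*} [AddCommGroup E] [Module K E] [FiniteDimensional K E]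
  {β : LinearMap.BilinForm K E}

theorem two_mul_finrank_le (hn : β.Nondegenerate) {D : Submodule K E}
    (hD : D ≤ β.orthogonal D) : 2 * Module.finrank K D ≤ Module.finrank K E := by
  have h1 := Submodule.finrank_mono hD
  have h2 := LinearMap.BilinForm.finrank_orthogonal hn D
  have h3 := D.finrank_le
  omega

theorem orthogonal_eq_self (hn : β.Nondegenerate) {D : Submodule K E}
    (hD : D ≤ β.orthogonal D) (hdim : Module.finrank K E = 2 * Module.finrank K D) :
    β.orthogonal D = D := by
  refine (Submodule.eq_of_le_of_finrank_le hD ?_).symm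
  rw [LinearMap.BilinForm.finrank_orthogonal hn D]
  omega

omit [FiniteDimensional K E] in
theorem sup_span_singleton_le_orthogonal (ha : β.IsAlt) {D : Submodule K E}
    (hD : D ≤ β.orthogonal D) {x : E} (hx : x ∈ β.orthogonal D) :
    D ⊔ Submodule.span K {x} ≤ β.orthogonal (D ⊔ Submodule.span K {x}) := by
  intro y hy z hz
  obtain ⟨y₁, hy₁, y₂, hy₂, rfl⟩ := Submodule.mem_sup.1 hy
  obtain ⟨z₁, hz₁, z₂, hz₂, rfl⟩ := Submodule.mem_sup.1 hz
  obtain ⟨c, rfl⟩ := Submodule.mem_span_singleton.1 hy₂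
  obtain ⟨d, rfl⟩ := Submodule.mem_span_singleton.1 hz₂
  have h1 : β z₁ y₁ = 0 := hD hy₁ z₁ hz₁
  have h2 : β z₁ x = 0 := hx z₁ hz₁
  have h3 : β x y₁ = 0 := by rw [← ha.neg_eq, hx y₁ hy₁, neg_zero]
  have h4 : β x x = 0 := ha x
  simp [h1, h2, h3, h4]

theorem exists_linearIndependent_span_eq {K : Type*} [Field K] {E : Type*} [AddCommGroup E]
    [Module K E] [FiniteDimensional K E] (D : Submodule K E) {d : ℕ}
    (hd : Module.finrank K D = d) :
    ∃ v : Fin d → E, LinearIndependent K v ∧ Submodule.span K (Set.range v) = D := by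
  let b := Module.finBasisOfFinrankEq K D hd
  refine ⟨fun a => b a, b.linearIndependent.map' D.subtype (Submodule.ker_subtype D), ?_⟩
  have : (Set.range fun a => (b a : E)) = D.subtype '' Set.range b := by
    rw [← Set.range_comp]; rfl
  rw [this, Submodule.span_image, b.span_eq, Submodule.map_subtype_top]

theorem exists_lagrangian_ge (ha : β.IsAlt) (hn : β.Nondegenerate) {m : ℕ}
    (hdim : Module.finrank K E = 2 * m) {D : Submodule K E} (hD : D ≤ β.orthogonal D) :
    ∃ L, D ≤ L ∧ L ≤ β.orthogonal L ∧ Module.finrank K L = m := by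
  have hle := two_mul_finrank_le hn hD
  obtain ⟨d, hd⟩ : ∃ d, Module.finrank K D + d = m := ⟨m - Module.finrank K D, by omega⟩
  induction d generalizing D with
  | zero => exact ⟨D, le_rfl, hD, hd⟩
  | succ d ih =>
    have h1 : ¬ β.orthogonal D ≤ D := by
      intro h
      have := Submodule.finrank_mono h
      rw [LinearMap.BilinForm.finrank_orthogonal hn D] at this
      omega
    obtain ⟨x, hx, hxD⟩ := Set.not_subset.1 h1
    have h2 := sup_span_singleton_le_orthogonal ha hD hx
    have h3 : Module.finrank K D < Module.finrank K ↥(D ⊔ Submodule.span K {x}) := by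
      refine Submodule.finrank_lt_finrank_of_lt (lt_of_le_of_ne le_sup_left fun h => hxD ?_)
      rw [h]
      exact Submodule.mem_sup_right (Submodule.mem_span_singleton_self x)
    have h4 : Module.finrank K ↥(D ⊔ Submodule.span K {x}) ≤ Module.finrank K D + 1 := by
      refine (Submodule.finrank_add_le_finrank_add_finrank _ _).trans ?_
      have := finrank_span_le_card (R := K) ({x} : Set E)
      simp at this
      omega
    obtain ⟨L, hL1, hL2⟩ := ih h2 (two_mul_finrank_le hn h2) (by omega)
    exact ⟨L, le_sup_left.trans hL1, hL2⟩

theorem exists_dual_functionals {K : Type*} [Field K] {E : Type*} [AddCommGroup E]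
    [Module K E] {ι : Type*} [DecidableEq ι] {f : ι → E} (hf : LinearIndependent K f) :
    ∃ g : ι → Module.Dual K E, ∀ a b, g b (f a) = if a = b then 1 else 0 := by
  let F := Module.Basis.extend hf.linearIndepOn_id
  have hmem : ∀ a, f a ∈ hf.linearIndepOn_id.extend (Set.subset_univ _) := fun a =>
    hf.linearIndepOn_id.subset_extend _ ⟨a, rfl⟩
  have hF : ∀ a, F ⟨f a, hmem a⟩ = f a := fun a => Module.Basis.extend_apply_self _ _
  refine ⟨fun b => F.coord ⟨f b, hmem b⟩, fun a b => ?_⟩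
  classical
  rw [← hF a, Module.Basis.coord_apply, Module.Basis.repr_self, Finsupp.single_apply]
  simp only [Subtype.mk.injEq, hf.injective.eq_iff]

theorem exists_dual_family (hn : β.Nondegenerate) {ι : Type*} [DecidableEq ι] {f : ι → E}
    (hf : LinearIndependent K f) : ∃ g : ι → E, ∀ a b, β (f a) (g b) = if a = b then 1 else 0 := by
  have key : ∀ φ : Module.Dual K E, ∃ g, ∀ x, β x g = φ x := by
    intro φ
    have hinj : Function.Injective (LinearMap.flip β) := by
      refine LinearMap.ker_eq_bot.1 (LinearMap.separatingRight_iff_flip_ker_eq_bot.1 hn.2)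
    have hsurj : Function.Surjective (LinearMap.flip β) :=
      (LinearMap.injective_iff_surjective_of_finrank_eq_finrank
        (Subspace.dual_finrank_eq (K := K) (V := E)).symm).1 hinj
    obtain ⟨g, hg⟩ := hsurj φ
    exact ⟨g, fun x => by rw [← hg]; rfl⟩
  obtain ⟨ℓ, hℓ⟩ := exists_dual_functionals hf
  choose g hg using fun b => key (ℓ b)
  exact ⟨g, fun a b => by rw [hg, hℓ]⟩

omit [FiniteDimensional K E] in
/-- A dual family of an isotropic family can be corrected to an isotropic one. -/
theorem exists_isotropic_dual_family (ha : β.IsAlt) {ι : Type*} [Fintype ι] [DecidableEq ι]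
    {f g : ι → E} (hf : ∀ a b, β (f a) (f b) = 0)
    (hfg : ∀ a b, β (f a) (g b) = if a = b then 1 else 0) (r : ι → ℕ)
    (hr : Function.Injective r) :
    ∃ h : ι → E, (∀ a b, β (f a) (h b) = if a = b then 1 else 0) ∧ (∀ a b, β (h a) (h b) = 0) ∧
      ∀ b, (∀ a, r b ≤ r a) → h b = g b := by
  -- For each pair only the vector with the larger value of r is corrected, by the full pairing.
  -- This needs no division by 2 and leaves the vector of smallest r unchanged.
  let s : ι → ι → K := fun b a => if r a < r b then β (g a) (g b) else 0
  have hgf : ∀ a b, β (g a) (f b) = if a = b then -1 else 0 := by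
    intro a b
    rw [← ha.neg_eq, hfg]
    by_cases h : a = b <;> simp [h, eq_comm]
  refine ⟨fun b => g b + ∑ d, s b d • f d, fun a b => ?_, fun a b => ?_, fun b hb => ?_⟩
  · simp [hf, hfg]
  · have h1 : β (g a) (∑ d, s b d • f d) = - s b a := by
      simp [hgf]
    have h2 : β (∑ d, s a d • f d) (g b) = s a b := by
      simp [hfg]
    have h3 : β (∑ d, s a d • f d) (∑ d, s b d • f d) = 0 := by
      simp [hf]
    have h4 : β (g b) (g a) = - β (g a) (g b) := (ha.neg_eq _ _).symm
    rw [map_add, map_add, LinearMap.add_apply, LinearMap.add_apply, h1, h2, h3]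
    rcases lt_trichotomy (r a) (r b) with h | h | h
    · simp [s, h, h.not_gt]
    · rw [hr h]
      simp [s, ha (g b)]
    · simp [s, h, h.not_gt, h4]
  · have : ∀ d, s b d = 0 := fun d => if_neg (hb d).not_gt
    simp [this]

end Lagrangian

/-! ### Hyperbolic families and isometries -/

section HyperbolicBasis

variable {K : Type*} [Field K] {E : Type*} [AddCommGroup E] [Module K E]
  {β : LinearMap.BilinForm K E} {m : ℕ}

/-- Families `e_1, …, e_{2m}` with `⟨e_a, e_{2m+1-b}⟩ = ε_a δ_{ab}`. -/
def IsHyperbolic (β : LinearMap.BilinForm K E) (ε : Fin (2 * m) → K) (h : Fin (2 * m) → E) : Prop :=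
  ∀ a b, β (h a) (h b.rev) = if a = b then ε a else 0

theorem IsHyperbolic.linearIndependent {ε : Fin (2 * m) → K} {h : Fin (2 * m) → E}
    (hh : IsHyperbolic β ε h) (hε : ∀ a, ε a ≠ 0) : LinearIndependent K h := by
  rw [Fintype.linearIndependent_iff]
  intro c hc a
  have h1 : β (∑ i, c i • h i) (h a.rev) = c a * ε a := by
    simp [hh _ a]
  rw [hc] at h1
  simpa [hε a] using h1.symm

theorem IsHyperbolic.apply_sum {ε : Fin (2 * m) → K} {h : Fin (2 * m) → E}
    (hh : IsHyperbolic β ε h) (c : Fin (2 * m) → K) (a : Fin (2 * m)) :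
    β (∑ i, c i • h i) (h a.rev) = c a * ε a := by
  simp [hh _ a]

theorem IsHyperbolic.neg_rev (ha : β.IsAlt) {ε : Fin (2 * m) → K} {h : Fin (2 * m) → E}
    (hh : IsHyperbolic β ε h) (a : Fin (2 * m)) : ε a.rev = - ε a := by
  have h1 := hh a a
  have h2 := hh a.rev a.rev
  rw [Fin.rev_rev, if_pos rfl] at h2
  rw [if_pos rfl] at h1
  rw [← h1, ← h2, ha.neg_eq]

theorem IsHyperbolic.nondegenerate (ha : β.IsAlt) {ε : Fin (2 * m) → K}
    {h : Module.Basis (Fin (2 * m)) K E}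
    (hh : IsHyperbolic β ε h) (hε : ∀ a, ε a ≠ 0) : β.Nondegenerate := by
  have h1 : β.SeparatingLeft := by
    intro x hx
    rw [← h.sum_repr x] at hx ⊢
    refine Finset.sum_eq_zero fun a _ => ?_
    have h2 := hh.apply_sum (h.repr x) a
    rw [hx] at h2
    have : h.repr x a = 0 := by simpa [hε a] using h2.symm
    rw [this, zero_smul]
  exact ⟨h1, fun x hx => h1 x fun y => by rw [← ha.neg_eq, hx y, neg_zero]⟩

/-- An isotropic family of `m` vectors extends to a hyperbolic family. -/
theorem exists_isHyperbolic [FiniteDimensional K E] (ha : β.IsAlt)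
    (ε : Fin (2 * m) → K) (hε : ∀ a, ε a.rev = - ε a)
    {f g : Fin m → E} (hf : ∀ a b, β (f a) (f b) = 0)
    (hfg : ∀ a b, β (f a) (g b) = if a = b then 1 else 0) (hg : ∀ a b, β (g a) (g b) = 0) :
    ∃ h : Fin (2 * m) → E, IsHyperbolic β ε h ∧ (∀ a, h (idx a) = f a) ∧
      ∀ a, h (idx a).rev = ε (idx a) • g a := by
  let h : Fin (2 * m) → E := fun x =>
    if hx : x.val < m then f ⟨x.val, hx⟩ else
      ε x.rev • g ⟨x.rev.val, by have := x.isLt; rw [Fin.val_rev]; omega⟩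
  have h1 : ∀ a, h (idx a) = f a := fun a => dif_pos a.isLt
  have h2 : ∀ a, h (idx a).rev = ε (idx a) • g a := by
    intro a
    have ha' := a.isLt
    have : ¬ (idx a).rev.val < m := by simp only [Fin.val_rev, idx]; omega
    simp only [h, dif_neg this, Fin.rev_rev]
    rfl
  have hcase : ∀ x : Fin (2 * m), ∃ a : Fin m, x = idx a ∨ x = (idx a).rev := by
    intro x
    by_cases hx : x.val < m
    · exact ⟨⟨x, hx⟩, Or.inl rfl⟩
    · refine ⟨⟨x.rev.val, by have := x.isLt; rw [Fin.val_rev]; omega⟩, Or.inr ?_⟩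
      exact (Fin.rev_rev x).symm
  have hne : ∀ a b : Fin m, idx a ≠ (idx b).rev := by
    intro a b hab
    have := congrArg Fin.val hab
    simp only [idx, Fin.val_rev] at this
    omega
  have hinj : ∀ a b : Fin m, idx a = idx b ↔ a = b := by
    intro a b
    simp [idx, Fin.ext_iff]
  have hgf : ∀ a b, β (g a) (f b) = if a = b then -1 else 0 := by
    intro a b
    rw [← ha.neg_eq, hfg]
    by_cases h : a = b <;> simp [h, eq_comm]
  refine ⟨h, fun x y => ?_, h1, h2⟩
  obtain ⟨a, rfl | rfl⟩ := hcase x <;> obtain ⟨b, rfl | rfl⟩ := hcase y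
  · rw [h1, h2, map_smul, hfg]
    simp only [hinj]
    by_cases h : a = b <;> simp [h]
  · rw [Fin.rev_rev, h1, h1, hf, if_neg (hne a b)]
  · rw [h2, h2, map_smul, map_smul, LinearMap.smul_apply, hg, if_neg (hne b a).symm]
    simp
  · rw [Fin.rev_rev, h2, h1, map_smul, LinearMap.smul_apply, hgf, hε]
    simp only [Fin.rev_inj, hinj]
    by_cases h : a = b <;> simp [h]

theorem exists_isometry [FiniteDimensional K E] {ε : Fin (2 * m) → K} (hε : ∀ a, ε a ≠ 0)
    {e : Module.Basis (Fin (2 * m)) K E} (he : IsHyperbolic β ε e)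
    {h : Fin (2 * m) → E} (hh : IsHyperbolic β ε h) :
    ∃ g : E ≃ₗ[K] E, (∀ x y, β (g x) (g y) = β x y) ∧ ∀ a, g (e a) = h a := by
  have hli := hh.linearIndependent hε
  have hcard : Fintype.card (Fin (2 * m)) = Module.finrank K E := by
    rw [Module.finrank_eq_card_basis e]
  let b := basisOfLinearIndependentOfCardEqFinrank' h hli hcard
  have hb : ∀ a, b a = h a := fun a => by simp [b]
  let g := e.equiv b (Equiv.refl _)
  have hg : ∀ a, g (e a) = h a := fun a => by simp [g, hb]
  refine ⟨g, fun x y => ?_, hg⟩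
  have : β.compl₁₂ g.toLinearMap g.toLinearMap = β := by
    refine e.ext fun a => e.ext fun c => ?_
    have h1 := hh a c.rev
    have h2 := he a c.rev
    rw [Fin.rev_rev] at h1 h2
    simp [hg, h1, h2]
  exact LinearMap.congr_fun (LinearMap.congr_fun this x) y

/-- A nondegenerate alternating form on a space of dimension `2m` has a hyperbolic basis. -/
theorem exists_hyperbolic_basis [FiniteDimensional K E] (ha : β.IsAlt) (hn : β.Nondegenerate)
    (hdim : Module.finrank K E = 2 * m) (ε : Fin (2 * m) → K) (hε0 : ∀ a, ε a ≠ 0)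
    (hε : ∀ a, ε a.rev = - ε a) (D : Submodule K E) (hD : D ≤ β.orthogonal D) :
    ∃ e : Module.Basis (Fin (2 * m)) K E, IsHyperbolic β ε e ∧
      D ≤ Submodule.span K (Set.range fun a : Fin m => e (idx a)) := by
  obtain ⟨L, hDL, hL, hLm⟩ := exists_lagrangian_ge ha hn hdim hD
  obtain ⟨b, hfL, hbL⟩ := exists_linearIndependent_span_eq L hLm
  have hmem : ∀ a, b a ∈ L := fun a => hbL ▸ Submodule.subset_span ⟨a, rfl⟩
  obtain ⟨g, hg⟩ := exists_dual_family hn hfL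
  have hf : ∀ a a', β (b a) (b a') = 0 := fun a a' => hL (hmem a') _ (hmem a)
  obtain ⟨g', hg1, hg2, -⟩ := exists_isotropic_dual_family ha hf hg Fin.val Fin.val_injective
  obtain ⟨h, hh, hh1, -⟩ := exists_isHyperbolic ha ε hε hf hg1 hg2
  refine ⟨basisOfLinearIndependentOfCardEqFinrank' h (hh.linearIndependent hε0) (by simp [hdim]),
    by simpa using hh, ?_⟩
  simp only [coe_basisOfLinearIndependentOfCardEqFinrank', hh1]
  exact hDL.trans hbL.ge

end HyperbolicBasis

/-! ### Frobenius on k ⊗ V and descent -/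

section Frobenius

variable {p : ℕ} [Fact p.Prime] {k : Type*} [Field k] [Algebra (ZMod p) k]
  {V : Type*} [AddCommGroup V] [Module (ZMod p) V]

theorem frob_tmul (c : k) (x : V) : frob k V (c ⊗ₜ x) = (c ^ p) ⊗ₜ[ZMod p] x := by
  simp [frob]

theorem charP_of_algebra (p : ℕ) [Fact p.Prime] (k : Type*) [Field k] [Algebra (ZMod p) k] :
    CharP k p :=
  (Algebra.charP_iff (ZMod p) k p).1 inferInstance

theorem frob_smul (c : k) (x : k ⊗[ZMod p] V) : frob k V (c • x) = c ^ p • frob k V x := by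
  induction x with
  | zero => simp
  | tmul d x => simp [TensorProduct.smul_tmul', frob_tmul, mul_pow]
  | add x y hx hy => simp [hx, hy]

theorem frob_sum_smul {ι : Type*} (s : Finset ι) (c : ι → k) (v : ι → k ⊗[ZMod p] V) :
    frob k V (∑ i ∈ s, c i • v i) = ∑ i ∈ s, c i ^ p • frob k V (v i) := by
  simp [map_sum, frob_smul]

theorem frob_baseChange {V' : Type*} [AddCommGroup V'] [Module (ZMod p) V'] (f : V →ₗ[ZMod p] V')
    (x : k ⊗[ZMod p] V) : frob k V' (f.baseChange k x) = f.baseChange k (frob k V x) :=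
  LinearMap.rTensor_baseChange _ _ _

theorem repr_frob {ι : Type*} (e : Module.Basis ι (ZMod p) V) (x : k ⊗[ZMod p] V) (a : ι) :
    (e.baseChange k).repr (frob k V x) a = (e.baseChange k).repr x a ^ p := by
  have := charP_of_algebra p k
  induction x with
  | zero => simp [(Fact.out : p.Prime).ne_zero]
  | tmul d x =>
    simp [frob_tmul, Algebra.smul_def, mul_pow, algebraMap_zmod_pow]
  | add x y hx hy => simp [hx, hy, add_pow_char]

theorem frob_injective [Module.Finite (ZMod p) V] : Function.Injective (frob (p := p) k V) := by
  rw [injective_iff_map_eq_zero]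
  intro x hx
  let e := Module.finBasis (ZMod p) V
  rw [← (e.baseChange k).repr.map_eq_zero_iff]
  ext a
  have h := repr_frob e x a
  rw [hx] at h
  simpa [(Fact.out : p.Prime).ne_zero] using h.symm

theorem baseChange_form_frob (B : LinearMap.BilinForm (ZMod p) V) (x y : k ⊗[ZMod p] V) :
    B.baseChange k (frob k V x) (frob k V y) = B.baseChange k x y ^ p := by
  have := charP_of_algebra p k
  have hp := (Fact.out : p.Prime).ne_zero
  induction x with
  | zero => simp [hp]
  | tmul c x =>
    induction y with
    | zero => simp [hp]
    | tmul d y =>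
      simp [frob_tmul, Algebra.smul_def, mul_pow, algebraMap_zmod_pow]
    | add x y hx hy => simp [hx, hy, add_pow_char]
  | add x y hx hy => simp [hx, hy, add_pow_char]

variable [IsAlgClosed k]

theorem exists_pow_eq (p : ℕ) [Fact p.Prime] (c : k) : ∃ d : k, d ^ p = c :=
  IsAlgClosed.exists_pow_nat_eq c (Fact.out : p.Prime).pos

/-- The set of images is already a subspace: k is perfect, so a scalar c can be moved inside as its
p-th root. -/
theorem mem_frobSpace_iff {D : Submodule k (k ⊗[ZMod p] V)} {y : k ⊗[ZMod p] V} :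
    y ∈ frobSpace D ↔ ∃ x ∈ D, frob k V x = y := by
  constructor
  · intro hy
    induction hy using Submodule.span_induction with
    | mem y hy => exact hy
    | zero => exact ⟨0, D.zero_mem, map_zero _⟩
    | add y z _ _ hy hz =>
      obtain ⟨a, ha, rfl⟩ := hy
      obtain ⟨b, hb, rfl⟩ := hz
      exact ⟨a + b, D.add_mem ha hb, map_add _ _ _⟩
    | smul c y _ hy =>
      obtain ⟨a, ha, rfl⟩ := hy
      obtain ⟨d, rfl⟩ := exists_pow_eq p c
      exact ⟨d • a, D.smul_mem d ha, frob_smul _ _⟩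
  · rintro ⟨x, hx, rfl⟩
    exact Submodule.subset_span ⟨x, hx, rfl⟩

omit [IsAlgClosed k] in
theorem frob_mem_frobSpace {D : Submodule k (k ⊗[ZMod p] V)} {x : k ⊗[ZMod p] V} (hx : x ∈ D) :
    frob k V x ∈ frobSpace D :=
  Submodule.subset_span ⟨x, hx, rfl⟩

omit [IsAlgClosed k] in
theorem frobSpace_mono {D D' : Submodule k (k ⊗[ZMod p] V)} (h : D ≤ D') :
    frobSpace D ≤ frobSpace D' :=
  Submodule.span_mono (Set.image_mono h)

omit [IsAlgClosed k] in
theorem frobSpace_baseChange (W : Submodule (ZMod p) V) :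
    frobSpace (W.baseChange k) = W.baseChange k := by
  apply le_antisymm
  · refine Submodule.span_le.2 ?_
    rintro _ ⟨x, ⟨y, rfl⟩, rfl⟩
    rw [SetLike.mem_coe, frob_baseChange]
    exact ⟨_, rfl⟩
  · conv_lhs => rw [Submodule.baseChange_eq_span]
    rw [Submodule.span_le]
    rintro _ ⟨w, hw, rfl⟩
    refine Submodule.subset_span ⟨1 ⊗ₜ w, Submodule.tmul_mem_baseChange_of_mem _ hw, ?_⟩
    simp [frob_tmul]

variable [Module.Finite (ZMod p) V]

omit [IsAlgClosed k] in
theorem frob_mem_frobSpace_iff [IsAlgClosed k] {D : Submodule k (k ⊗[ZMod p] V)}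
    {x : k ⊗[ZMod p] V} : frob k V x ∈ frobSpace D ↔ x ∈ D := by
  refine ⟨fun h => ?_, frob_mem_frobSpace⟩
  obtain ⟨y, hy, hxy⟩ := mem_frobSpace_iff.1 h
  rwa [← frob_injective hxy]

theorem frobSpace_inf (D D' : Submodule k (k ⊗[ZMod p] V)) :
    frobSpace (D ⊓ D') = frobSpace D ⊓ frobSpace D' := by
  refine le_antisymm (le_inf (frobSpace_mono inf_le_left) (frobSpace_mono inf_le_right)) ?_
  rintro _ ⟨h1, h2⟩
  obtain ⟨x, hx, rfl⟩ := mem_frobSpace_iff.1 h1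
  exact frob_mem_frobSpace ⟨hx, frob_mem_frobSpace_iff.1 h2⟩

theorem linearIndependent_frob {ι : Type*} {v : ι → k ⊗[ZMod p] V} (hv : LinearIndependent k v) :
    LinearIndependent k fun i => frob k V (v i) := by
  rw [linearIndependent_iff'] at hv ⊢
  intro s c hc i hi
  choose d hd using fun i => exists_pow_eq p (c i)
  simp only [← hd] at hc
  rw [← frob_sum_smul] at hc
  rw [← hd, hv s d (frob_injective (hc.trans (map_zero _).symm)) i hi,
    zero_pow (Fact.out : p.Prime).ne_zero]

omit [IsAlgClosed k] [Module.Finite (ZMod p) V] in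
theorem frobSpace_span (s : Set (k ⊗[ZMod p] V)) :
    frobSpace (Submodule.span k s) = Submodule.span k (frob k V '' s) := by
  refine le_antisymm (Submodule.span_le.2 ?_) (Submodule.span_mono
    (Set.image_mono Submodule.subset_span))
  rintro _ ⟨x, hx, rfl⟩
  rw [SetLike.mem_coe]
  induction hx using Submodule.span_induction with
  | mem x hx => exact Submodule.subset_span ⟨x, hx, rfl⟩
  | zero => rw [map_zero]; exact Submodule.zero_mem _
  | add y z _ _ hy hz => rw [map_add]; exact Submodule.add_mem _ hy hz
  | smul c y _ hy => rw [frob_smul]; exact Submodule.smul_mem _ _ hy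

theorem finrank_frobSpace (D : Submodule k (k ⊗[ZMod p] V)) :
    Module.finrank k (frobSpace D) = Module.finrank k D := by
  obtain ⟨b, hb, hD⟩ := exists_linearIndependent_span_eq D rfl
  have h1 := finrank_span_eq_card (linearIndependent_frob hb)
  rw [Set.range_comp' (frob k V), ← frobSpace_span, hD] at h1
  simpa using h1

omit [Module.Finite (ZMod p) V] in
-- Φ - 1 is surjective: additivity reduces this to pure tensors, where it is an Artin–Schreier
-- equation.
theorem exists_frob_eq_add (y : k ⊗[ZMod p] V) : ∃ x, frob k V x = x + y := by
  induction y with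
  | zero => exact ⟨0, by simp⟩
  | tmul c v =>
    obtain ⟨d, hd⟩ := exists_pow_eq_add (p := p) c
    exact ⟨d ⊗ₜ v, by rw [frob_tmul, hd, TensorProduct.add_tmul]⟩
  | add y z hy hz =>
    obtain ⟨a, ha⟩ := hy
    obtain ⟨b, hb⟩ := hz
    exact ⟨a + b, by rw [map_add, ha, hb]; abel⟩

omit [IsAlgClosed k] in
theorem exists_eq_tmul_of_frob_eq {x : k ⊗[ZMod p] V} (hx : frob k V x = x) :
    ∃ v : V, x = 1 ⊗ₜ v := by
  let e := Module.finBasis (ZMod p) V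
  have h : ∀ a, ∃ c : ZMod p, algebraMap (ZMod p) k c = (e.baseChange k).repr x a := by
    intro a
    refine exists_algebraMap_eq_of_pow_eq ?_
    rw [← repr_frob, hx]
  choose c hc using h
  refine ⟨∑ a, c a • e a, ?_⟩
  rw [← (e.baseChange k).sum_repr x, TensorProduct.tmul_sum]
  refine Finset.sum_congr rfl fun a _ => ?_
  rw [← hc, Module.Basis.baseChange_apply, TensorProduct.tmul_smul, algebraMap_smul]

/-- The vectors of `V` that lie in a subspace of `k ⊗ V`. -/
def rationalVectors (D : Submodule k (k ⊗[ZMod p] V)) : Submodule (ZMod p) V :=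
  (D.restrictScalars (ZMod p)).comap (TensorProduct.mk (ZMod p) k V 1)

omit [IsAlgClosed k] [Module.Finite (ZMod p) V] in
theorem mem_rationalVectors {D : Submodule k (k ⊗[ZMod p] V)} {v : V} :
    v ∈ rationalVectors D ↔ (1 : k) ⊗ₜ[ZMod p] v ∈ D := Iff.rfl

omit [IsAlgClosed k] [Module.Finite (ZMod p) V] in
theorem baseChange_rationalVectors_le (D : Submodule k (k ⊗[ZMod p] V)) :
    (rationalVectors D).baseChange k ≤ D := by
  rw [Submodule.baseChange_eq_span, Submodule.span_le]
  rintro _ ⟨w, hw, rfl⟩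
  exact hw

omit [IsAlgClosed k] [Module.Finite (ZMod p) V] in
theorem baseChange_le_iff_le_rationalVectors {W : Submodule (ZMod p) V}
    {D : Submodule k (k ⊗[ZMod p] V)} : W.baseChange k ≤ D ↔ W ≤ rationalVectors D := by
  constructor
  · exact fun h w hw => h (Submodule.tmul_mem_baseChange_of_mem _ hw)
  · exact fun h => (Submodule.baseChange_mono k h).trans (baseChange_rationalVectors_le D)

/-- Frobenius descent: a subspace that is stable under Frobenius is defined over `𝔽_p`. -/
theorem baseChange_rationalVectors {D : Submodule k (k ⊗[ZMod p] V)} (hD : frobSpace D ≤ D) :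
    (rationalVectors D).baseChange k = D := by
  classical
  refine le_antisymm (baseChange_rationalVectors_le D) ?_
  let e := Module.finBasis (ZMod p) V
  let s : k ⊗[ZMod p] V → Finset (Fin (Module.finrank (ZMod p) V)) := fun x =>
    Finset.univ.filter fun a => (e.baseChange k).repr x a ≠ 0
  -- Induction on the number of nonzero coordinates. After one coordinate of y has been scaled to 1,
  -- Φ y - y has fewer nonzero ones, so it lies in the span of the rational vectors. There it equals
  -- Φ z - z for some z; then y - z is fixed by Φ, hence rational.
  have key : ∀ N, ∀ x ∈ D, (s x).card ≤ N → x ∈ (rationalVectors D).baseChange k := by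
    intro N
    induction N with
    | zero =>
      intro x _ hN
      have : x = 0 := by
        rw [← (e.baseChange k).repr.map_eq_zero_iff]
        ext a
        by_contra h
        have : a ∈ s x := by simpa [s] using h
        rw [Finset.card_eq_zero.1 (Nat.le_zero.1 hN)] at this
        simp at this
      rw [this]; exact Submodule.zero_mem _
    | succ N ih =>
      intro x hx hN
      by_cases hx0 : ∃ a, (e.baseChange k).repr x a ≠ 0
      · obtain ⟨a, ha⟩ := hx0
        let y := ((e.baseChange k).repr x a)⁻¹ • x
        have hy : y ∈ D := D.smul_mem _ hx
        have hya : (e.baseChange k).repr y a = 1 := by simp [y, ha]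
        have hsy : s (frob k V y - y) ⊆ (s x).erase a := by
          intro c hc
          simp only [s, Finset.mem_filter, Finset.mem_univ, true_and, map_sub, Finsupp.sub_apply,
            repr_frob] at hc
          rw [Finset.mem_erase]
          refine ⟨?_, ?_⟩
          · rintro rfl
            simp [hya] at hc
          · simp only [s, Finset.mem_filter, Finset.mem_univ, true_and]
            intro h0
            simp [y, h0, (Fact.out : p.Prime).ne_zero] at hc
        have has : a ∈ s x := by simpa [s] using ha
        have hcard : (s (frob k V y - y)).card ≤ N := by
          have := Finset.card_le_card hsy
          rw [Finset.card_erase_of_mem has] at this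
          omega
        have h1 := ih _ (D.sub_mem (hD (frob_mem_frobSpace hy)) hy) hcard
        have h2 : ∃ z ∈ (rationalVectors D).baseChange k, frob k V z - z = frob k V y - y := by
          obtain ⟨t, ht⟩ := h1
          obtain ⟨u, hu⟩ := exists_frob_eq_add t
          refine ⟨(rationalVectors D).subtype.baseChange k u, ⟨u, rfl⟩, ?_⟩
          rw [frob_baseChange, hu, map_add, ht]
          abel
        obtain ⟨z, hz, hzy⟩ := h2
        have h3 : frob k V (y - z) = y - z := by
          rw [map_sub, ← sub_eq_zero]
          rw [← sub_eq_zero] at hzy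
          rw [← neg_eq_zero, ← hzy]
          abel
        obtain ⟨v, hv⟩ := exists_eq_tmul_of_frob_eq h3
        have hvD : v ∈ rationalVectors D := by
          rw [mem_rationalVectors, ← hv]
          exact D.sub_mem hy (baseChange_rationalVectors_le D hz)
        have h4 : y ∈ (rationalVectors D).baseChange k := by
          have : y = 1 ⊗ₜ v + z := by rw [← hv]; abel
          rw [this]
          exact Submodule.add_mem _ (Submodule.tmul_mem_baseChange_of_mem _ hvD) hz
        have h5 : x = (e.baseChange k).repr x a • y := by simp [y, smul_smul, ha]
        rw [h5]
        exact Submodule.smul_mem _ _ h4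
      · push Not at hx0
        have : x = 0 := by
          rw [← (e.baseChange k).repr.map_eq_zero_iff]
          ext a
          exact hx0 a
        rw [this]; exact Submodule.zero_mem _
  exact fun x hx => key _ x hx le_rfl

omit [IsAlgClosed k] [Module.Finite (ZMod p) V] in
theorem finrank_submodule_baseChange (W : Submodule (ZMod p) V) :
    Module.finrank k (W.baseChange k) = Module.finrank (ZMod p) W := by
  rw [← (Submodule.toBaseChange.toLinearEquiv k W).finrank_eq, Module.finrank_baseChange]

omit [IsAlgClosed k] [Module.Finite (ZMod p) V] in
theorem rationalVectors_baseChange (W : Submodule (ZMod p) V) :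
    rationalVectors (W.baseChange k) = W := by
  have h : W ≤ rationalVectors (W.baseChange k) := baseChange_le_iff_le_rationalVectors.1 le_rfl
  refine le_antisymm ?_ h
  rw [← Submodule.baseChange_le_iff (A := k)]
  exact baseChange_rationalVectors_le _

end Frobenius

/-! ### Base change of the form -/

section BaseChangeForm

variable {p : ℕ} [Fact p.Prime] {k : Type*} [Field k] [Algebra (ZMod p) k]
  {V : Type*} [AddCommGroup V] [Module (ZMod p) V] {B : LinearMap.BilinForm (ZMod p) V}

theorem isAlt_baseChange (hB : B.IsAlt) : (B.baseChange k).IsAlt := by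
  -- Antisymmetry is needed first, for the cross terms of a sum of tensors.
  have hanti : ∀ x y, B.baseChange k x y = - B.baseChange k y x := by
    intro x y
    induction x with
    | zero => simp
    | tmul c x =>
      induction y with
      | zero => simp
      | tmul d y =>
        rw [LinearMap.BilinForm.baseChange_tmul, LinearMap.BilinForm.baseChange_tmul,
          ← hB.neg_eq, neg_smul, mul_comm]
      | add y z hy hz => rw [map_add, hy, hz, map_add, LinearMap.add_apply]; ring
    | add y z hy hz => rw [map_add, LinearMap.add_apply, hy, hz, map_add]; ring
  intro x
  induction x with
  | zero => simp
  | tmul c x => rw [LinearMap.BilinForm.baseChange_tmul, hB, zero_smul]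
  | add x y hx hy =>
    rw [map_add, map_add, LinearMap.add_apply, LinearMap.add_apply, hx, hy, hanti x y]
    ring

variable {m : ℕ} {e : Module.Basis (Fin (2 * m)) (ZMod p) V}

/-- The signs of a symplectic basis, as elements of `k`. -/
def sgn (k : Type*) [Field k] [Algebra (ZMod p) k] (B : LinearMap.BilinForm (ZMod p) V)
    (e : Module.Basis (Fin (2 * m)) (ZMod p) V) (a : Fin (2 * m)) : k :=
  algebraMap (ZMod p) k (B (e a) (e a.rev))

theorem sgn_ne_zero (he : IsSymplecticBasis B e) (a : Fin (2 * m)) : sgn k B e a ≠ 0 := by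
  rw [sgn, Ne, FaithfulSMul.algebraMap_eq_zero_iff]
  rcases (he a a).1 rfl with h | h <;> rw [h] <;> simp

theorem isHyperbolic_baseChange (he : IsSymplecticBasis B e) :
    IsHyperbolic (B.baseChange k) (sgn k B e) (e.baseChange k) := by
  intro a b
  rw [Module.Basis.baseChange_apply, Module.Basis.baseChange_apply,
    LinearMap.BilinForm.baseChange_tmul]
  split_ifs with h
  · subst h
    rw [sgn, Algebra.smul_def]; ring
  · rw [(he a b).2 h, zero_smul]

theorem nondegenerate_baseChange (hB : B.IsAlt) (he : IsSymplecticBasis B e) :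
    (B.baseChange k).Nondegenerate :=
  (isHyperbolic_baseChange he).nondegenerate (isAlt_baseChange hB) (sgn_ne_zero he)

theorem baseChange_orthogonal (hB : B.IsAlt) (hB' : B.Nondegenerate)
    (he : IsSymplecticBasis B e) (W : Submodule (ZMod p) V) :
    (B.orthogonal W).baseChange k = (B.baseChange k).orthogonal (W.baseChange k) := by
  have : Module.Finite (ZMod p) V := Module.Finite.of_basis e
  refine Submodule.eq_of_le_of_finrank_eq ?_ ?_
  · rintro _ ⟨x, rfl⟩ _ ⟨y, rfl⟩
    induction x with
    | zero => simp
    | add x z hx hz => rw [map_add, map_add, hx, hz, add_zero]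
    | tmul c x =>
      induction y with
      | zero => simp
      | add y z hy hz => rw [map_add, map_add, LinearMap.add_apply, hy, hz, add_zero]
      | tmul d y =>
        rw [LinearMap.baseChange_tmul, LinearMap.baseChange_tmul,
          LinearMap.BilinForm.baseChange_tmul]
        have : B y.1 x.1 = 0 := x.2 y.1 y.2
        simp [this]
  · rw [finrank_submodule_baseChange, LinearMap.BilinForm.finrank_orthogonal hB',
      LinearMap.BilinForm.finrank_orthogonal (nondegenerate_baseChange hB he),
      finrank_submodule_baseChange, Module.finrank_baseChange]

end BaseChangeForm

/-! ### The permutations w_i -/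

section WeylElement

theorem simpleReflection_val {m : ℕ} (j : Fin m) (x : Fin (2 * m)) :
    (simpleReflection j x).val = if j.val + 1 < m then
      (if x.val = j.val then j.val + 1 else if x.val = j.val + 1 then j.val else
        if x.val = 2 * m - 1 - j.val then 2 * m - 2 - j.val else
        if x.val = 2 * m - 2 - j.val then 2 * m - 1 - j.val else x.val)
      else (if x.val = j.val then 2 * m - 1 - j.val else
        if x.val = 2 * m - 1 - j.val then j.val else x.val) := by
  have hj := j.isLt
  have hx := x.isLt
  unfold simpleReflection
  by_cases h : j.val + 1 < m
  · simp only [h, dif_pos, Equiv.Perm.mul_apply, Equiv.swap_apply_def, if_true]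
    split_ifs <;> simp only [Fin.ext_iff, idx, Fin.val_rev] at * <;> omega
  · simp only [h, dif_neg, not_false_iff, Equiv.swap_apply_def, if_false]
    split_ifs <;> simp only [Fin.ext_iff, idx, Fin.val_rev] at * <;> omega

theorem weylElt_succ {m i : ℕ} (hi : i < m) :
    weylElt m (i + 1) = simpleReflection ⟨m - (i + 1), by omega⟩ * weylElt m i := by
  have h : m - (i + 1) < (List.finRange m).length := by
    rw [List.length_finRange]; omega
  rw [weylElt, List.drop_eq_getElem_cons h, List.map_cons, List.prod_cons, weylElt,
    List.getElem_finRange, show m - (i + 1) + 1 = m - i by omega]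
  rfl

/-- The reflections push m - i, …, m - 2 up by one. The last index goes to m + i - 1, the mirror
image of the index m - i that the shift leaves free; for i = 0 the last two cases do not occur. -/
theorem weylElt_apply {m i : ℕ} (hi : i ≤ m) (a : Fin m) :
    (weylElt m i (idx a)).val = if a.val < m - i then a.val else
      if a.val + 1 < m then a.val + 1 else m + i - 1 := by
  have ha := a.isLt
  induction i with
  | zero =>
    have : weylElt m 0 = 1 := by
      rw [weylElt, List.drop_eq_nil_of_le (by simp)]
      rfl
    rw [this, if_pos (by omega)]
    rfl
  | succ i ih =>
    rw [weylElt_succ (by omega), Equiv.Perm.mul_apply, simpleReflection_val, ih (by omega)]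
    simp only
    split_ifs <;> omega

end WeylElement

/-! ### Pairs of flags in position w_i -/

section RelativePosition

variable {K : Type*} [Field K] {E : Type*} [AddCommGroup E] [Module K E]

theorem eq_sup_span_singleton [FiniteDimensional K E] {D D' : Submodule K E} {x : E}
    (h : D ≤ D') (hx : x ∈ D') (hxD : x ∉ D)
    (hdim : Module.finrank K D' = Module.finrank K D + 1) : D' = D ⊔ Submodule.span K {x} := by
  have h1 : D ⊔ Submodule.span K {x} ≤ D' :=
    sup_le h ((Submodule.span_singleton_le_iff_mem _ _).2 hx)
  refine (Submodule.eq_of_le_of_finrank_le h1 ?_).symm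
  have : Module.finrank K D < Module.finrank K ↥(D ⊔ Submodule.span K {x}) := by
    refine Submodule.finrank_lt_finrank_of_lt (lt_of_le_of_ne le_sup_left fun h => hxD ?_)
    rw [h]
    exact Submodule.mem_sup_right (Submodule.mem_span_singleton_self x)
  omega

/-- Two isotropic flags in general position, apart from the inclusions between them, are the
standard flag and its translate by `w_i` with respect to some hyperbolic basis. -/
theorem exists_hyperbolic_of_flags [FiniteDimensional K E] {β : LinearMap.BilinForm K E}
    (ha : β.IsAlt) (hn : β.Nondegenerate) {m n i : ℕ} (hm : n + i = m)
    (hdim : Module.finrank K E = 2 * m) (ε : Fin (2 * m) → K) (hε0 : ∀ a, ε a ≠ 0)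
    (hε : ∀ a, ε a.rev = - ε a) (F F' : ℕ → Submodule K E)
    (hF : ∀ j ≤ i, Module.finrank K (F j) = n + j) (hF' : ∀ j ≤ i, Module.finrank K (F' j) = n + j)
    (hmono : ∀ j < i, F j ≤ F (j + 1)) (hmono' : ∀ j < i, F' j ≤ F' (j + 1))
    (hiso : F i ≤ β.orthogonal (F i)) (hiso' : F' i ≤ β.orthogonal (F' i))
    (h0 : F 0 = F' 0) (hle : ∀ j < i, F j ≤ F' (j + 1)) (hne : ∀ j, 1 ≤ j → j ≤ i → F j ≠ F' j) :
    ∃ h : Fin (2 * m) → E, IsHyperbolic β ε h ∧ ∀ j ≤ i,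
      F j = Submodule.span K ((fun a => h (weylElt m i a)) '' {a | a.val < n + j}) ∧
      F' j = Submodule.span K (h '' {a | a.val < n + j}) := by
  classical
  -- x_j generates F'_{j+1} modulo F'_j. For j ≥ 1 it can be taken in F_j, which lies in F'_{j+1}
  -- but not in F'_j.
  have hx : ∀ j, ∃ x, j < i → x ∈ F' (j + 1) ∧ x ∉ F' j ∧ (1 ≤ j → x ∈ F j) := by
    intro j
    by_cases hj : j < i
    · rcases Nat.eq_zero_or_pos j with rfl | hj1
      · have : ¬ F' (0 + 1) ≤ F' 0 := by
          intro h
          have := Submodule.finrank_mono h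
          rw [hF' _ (by omega), hF' _ (by omega)] at this
          omega
        obtain ⟨x, hx1, hx2⟩ := Set.not_subset.1 this
        exact ⟨x, fun _ => ⟨hx1, hx2, fun h => absurd h (by omega)⟩⟩
      · have : ¬ F j ≤ F' j := by
          intro h
          refine hne j hj1 hj.le (Submodule.eq_of_le_of_finrank_eq h ?_)
          rw [hF _ hj.le, hF' _ hj.le]
        obtain ⟨x, hx1, hx2⟩ := Set.not_subset.1 this
        exact ⟨x, fun _ => ⟨hle j hj hx1, hx2, fun _ => hx1⟩⟩
    · exact ⟨0, fun h => absurd h hj⟩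
  choose x hx using hx
  obtain ⟨b, -, hb⟩ := exists_linearIndependent_span_eq (F 0) (hF 0 (Nat.zero_le _))
  let f : ℕ → E := fun a => if h : a < n + 0 then b ⟨a, h⟩ else x (a - n)
  have hfx : ∀ j, f (n + j) = x j := by
    intro j
    simp only [f, dif_neg (show ¬ n + j < n + 0 by omega)]
    congr 1
    omega
  have hf0 : F 0 = Submodule.span K (f '' {a | a < n + 0}) := by
    rw [← hb]
    congr 1
    ext y
    constructor
    · rintro ⟨a, rfl⟩
      exact ⟨a.val, a.isLt, dif_pos a.isLt⟩
    · rintro ⟨a, ha, rfl⟩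
      exact ⟨⟨a, ha⟩, (dif_pos (show a < n + 0 from ha) : f a = _).symm⟩
  have hA : ∀ j ≤ i, F' j = Submodule.span K (f '' {a | a < n + j}) := by
    intro j
    induction j with
    | zero => intro _; rw [← h0, hf0]
    | succ j ih =>
      intro hj
      obtain ⟨hx1, hx2, -⟩ := hx j (by omega)
      rw [eq_sup_span_singleton (hmono' j (by omega)) hx1 hx2
        (by rw [hF' _ hj, hF' _ (by omega)]; rfl), ih (by omega), ← hfx]
      have : {a | a < n + (j + 1)} = insert (n + j) {a | a < n + j} := by
        ext a
        simp only [Set.mem_ofPred_eq, Set.mem_insert_iff]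
        omega
      rw [this, Set.image_insert_eq, Submodule.span_insert, sup_comm]
  -- The other flag uses the same vectors with x_0, of index n, left out. Its last member needs one
  -- further vector, the y found below.
  have hB : ∀ j < i, F j = Submodule.span K (f '' {a | a < n + j + 1 ∧ a ≠ n}) := by
    intro j
    induction j with
    | zero =>
      intro _
      rw [hf0]
      congr 2
      ext a
      simp only [Set.mem_ofPred_eq]
      omega
    | succ j ih =>
      intro hj
      obtain ⟨hx1, hx2, hx3⟩ := hx (j + 1) hj
      rw [eq_sup_span_singleton (hmono j (by omega)) (hx3 (by omega))
        (fun h => hx2 (hle j (by omega) h)) (by rw [hF _ hj.le, hF _ (by omega)]; rfl),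
        ih (by omega), ← hfx]
      have : {a | a < n + (j + 1) + 1 ∧ a ≠ n} =
          insert (n + (j + 1)) {a | a < n + j + 1 ∧ a ≠ n} := by
        ext a
        simp only [Set.mem_ofPred_eq, Set.mem_insert_iff]
        omega
      rw [this, Set.image_insert_eq, Submodule.span_insert, sup_comm]
  let f' : Fin m → E := fun a => f a
  have hrange : Set.range f' = f '' {a | a < n + i} := by
    ext y
    constructor
    · rintro ⟨a, rfl⟩
      exact ⟨a.val, by have := a.isLt; simp only [Set.mem_ofPred_eq]; omega, rfl⟩
    · rintro ⟨a, ha, rfl⟩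
      exact ⟨⟨a, hm ▸ ha⟩, rfl⟩
  have hspan : Submodule.span K (Set.range f') = F' i := by rw [hrange, ← hA i le_rfl]
  have hli : LinearIndependent K f' := by
    rw [linearIndependent_iff_card_eq_finrank_span, Set.finrank, hspan, hF' i le_rfl, hm,
      Fintype.card_fin]
  have hmem : ∀ a, f' a ∈ F' i := fun a => hspan ▸ Submodule.subset_span ⟨a, rfl⟩
  have hff : ∀ a b, β (f' a) (f' b) = 0 := fun a b => hiso' (hmem b) _ (hmem a)
  obtain ⟨g₀, hg₀⟩ := exists_dual_family hn hli
  have hval : ∀ a : Fin m, (idx a).val = a.val := fun a => rfl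
  have hidx : ∀ a : Fin (2 * m), ∀ h : a.val < m, a = idx ⟨a.val, h⟩ := fun a h => rfl
  have hstd : ∀ h : Fin (2 * m) → E, (∀ a, h (idx a) = f' a) → ∀ j ≤ i,
      F' j = Submodule.span K (h '' {a | a.val < n + j}) := by
    intro h hh j hj
    rw [hA j hj]
    congr 1
    ext y
    constructor
    · rintro ⟨a, ha, rfl⟩
      simp only [Set.mem_ofPred_eq] at ha
      exact ⟨idx ⟨a, by omega⟩, ha, hh _⟩
    · rintro ⟨a, ha, rfl⟩
      simp only [Set.mem_ofPred_eq] at ha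
      refine ⟨a.val, ha, ?_⟩
      rw [hidx a (by omega), hh]
      rfl
  rcases Nat.eq_zero_or_pos i with hi0 | hi0
  · subst hi0
    obtain ⟨g, hg1, hg2, -⟩ := exists_isotropic_dual_family ha hff hg₀ Fin.val Fin.val_injective
    obtain ⟨h, hh, hh1, -⟩ := exists_isHyperbolic ha ε hε hff hg1 hg2
    refine ⟨h, hh, fun j hj => ⟨?_, hstd h hh1 j hj⟩⟩
    have hj0 : j = 0 := by omega
    subst hj0
    have : weylElt m 0 = 1 := by
      rw [weylElt, List.drop_eq_nil_of_le (by simp)]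
      rfl
    rw [h0, this]
    exact hstd h hh1 0 le_rfl
  · obtain ⟨y, hy1, hy2⟩ : ∃ y, y ∈ F i ∧ y ∉ F' i := by
      refine Set.not_subset.1 fun h => hne i hi0 le_rfl (Submodule.eq_of_le_of_finrank_eq h ?_)
      rw [hF _ le_rfl, hF' _ le_rfl]
    obtain ⟨l, rfl⟩ : ∃ l, i = l + 1 := ⟨i - 1, by omega⟩
    have hFi : F (l + 1) = F l ⊔ Submodule.span K {y} :=
      eq_sup_span_singleton (hmono l (by omega)) hy1 (fun h => hy2 (hle l (by omega) h))
        (by rw [hF _ le_rfl, hF _ (by omega)]; rfl)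
    let b₀ : Fin m := ⟨n, by omega⟩
    -- Except for the one of index n, the basis vectors lie in the isotropic space F_i together with
    -- y. So a multiple of y can serve as the dual partner of the exceptional vector, as w_i
    -- requires.
    have hby : ∀ a, a ≠ b₀ → β (f' a) y = 0 := by
      intro a hab
      refine hiso hy1 _ (hmono l (by omega) ?_)
      rw [hB l (by omega)]
      refine Submodule.subset_span ⟨a.val, ⟨?_, fun h => hab (Fin.ext h)⟩, rfl⟩
      have := a.isLt
      omega
    have hby0 : β (f' b₀) y ≠ 0 := by
      intro h
      apply hy2
      rw [← orthogonal_eq_self hn hiso' (by rw [hF' _ le_rfl, hdim, hm])]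
      rw [← hspan]
      intro z hz
      change β z y = 0
      induction hz using Submodule.span_induction with
      | mem z hz =>
        obtain ⟨a, rfl⟩ := hz
        by_cases hab : a = b₀
        · rw [hab, h]
        · exact hby a hab
      | zero => simp
      | add u v _ _ hu hv => rw [map_add, LinearMap.add_apply, hu, hv, add_zero]
      | smul c u _ hu => rw [map_smul, LinearMap.smul_apply, hu, smul_zero]
    let g₁ : Fin m → E := Function.update g₀ b₀ ((β (f' b₀) y)⁻¹ • y)
    have hg₁ : ∀ a c, β (f' a) (g₁ c) = if a = c then 1 else 0 := by
      intro a c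
      by_cases hc : c = b₀
      · subst hc
        simp only [g₁, Function.update_self, map_smul]
        split_ifs with hac
        · rw [hac, smul_eq_mul, inv_mul_cancel₀ hby0]
        · rw [hby a hac, smul_zero]
      · simp only [g₁, Function.update_of_ne hc, hg₀]
    -- The exceptional index gets the smallest value, so that the correction to an isotropic dual
    -- family leaves the multiple of y untouched.
    let r : Fin m → ℕ := fun a => if a = b₀ then 0 else a.val + 1
    have hr : Function.Injective r := by
      intro a c hac
      simp only [r] at hac
      split_ifs at hac with h1 h2
      · rw [h1, h2]
      · exact Fin.ext (by omega)
    obtain ⟨g, hg1, hg2, hg3⟩ := exists_isotropic_dual_family ha hff hg₁ r hr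
    obtain ⟨h, hh, hh1, hh2⟩ := exists_isHyperbolic ha ε hε hff hg1 hg2
    have hhy : h (idx b₀).rev = (ε (idx b₀) * (β (f' b₀) y)⁻¹) • y := by
      rw [hh2, hg3 b₀ (fun a => by simp [r]), mul_smul]
      simp [g₁]
    refine ⟨h, hh, fun j hj => ⟨?_, hstd h hh1 j hj⟩⟩
    have hw : ∀ a : Fin m, a.val < n → h (weylElt m (l + 1) (idx a)) = f a.val := by
      intro a han
      have h1 : weylElt m (l + 1) (idx a) = idx a := by
        apply Fin.ext
        rw [weylElt_apply (by omega), if_pos (by omega)]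
        rfl
      rw [h1, hh1]
    have hw' : ∀ a : Fin m, n ≤ a.val → a.val + 1 < m →
        h (weylElt m (l + 1) (idx a)) = f (a.val + 1) := by
      intro a han ham
      have h1 : weylElt m (l + 1) (idx a) = idx ⟨a.val + 1, ham⟩ := by
        apply Fin.ext
        rw [weylElt_apply (by omega), if_neg (by omega), if_pos ham]
        rfl
      rw [h1, hh1]
    have hw'' : ∀ a : Fin m, a.val + 1 = m → h (weylElt m (l + 1) (idx a)) =
        (ε (idx b₀) * (β (f' b₀) y)⁻¹) • y := by
      intro a ham
      have h1 : weylElt m (l + 1) (idx a) = (idx b₀).rev := by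
        apply Fin.ext
        rw [weylElt_apply (by omega), if_neg (by omega), if_neg (by omega)]
        simp only [Fin.val_rev, idx, b₀]
        omega
      rw [h1, hhy]
    have hsmall : ∀ j ≤ l, F j =
        Submodule.span K ((fun a => h (weylElt m (l + 1) a)) '' {a | a.val < n + j}) := by
      intro j hj
      rw [hB j (by omega)]
      congr 1
      ext z
      constructor
      · rintro ⟨a, ⟨ha1, ha2⟩, rfl⟩
        by_cases han : a < n
        · exact ⟨idx ⟨a, by omega⟩, by simp only [Set.mem_ofPred_eq, hval]; omega, hw ⟨a, _⟩ han⟩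
        · refine ⟨idx ⟨a - 1, by omega⟩, by simp only [Set.mem_ofPred_eq, hval]; omega, ?_⟩
          simp only
          rw [hw' ⟨a - 1, _⟩ (by simp only; omega) (by simp only; omega)]
          simp only
          congr 1
          omega
      · rintro ⟨a, ha, rfl⟩
        simp only [Set.mem_ofPred_eq] at ha
        rw [hidx a (by omega)]
        by_cases han : a.val < n
        · exact ⟨a.val, ⟨by omega, by omega⟩, (hw ⟨a.val, _⟩ han).symm⟩
        · exact ⟨a.val + 1, ⟨by omega, by omega⟩,
            (hw' ⟨a.val, _⟩ (by simp only; omega) (by simp only; omega)).symm⟩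
    rcases Nat.lt_or_ge l j with hjl | hjl
    · have : j = l + 1 := by omega
      subst this
      have : {a : Fin (2 * m) | a.val < n + (l + 1)} =
          insert (idx ⟨n + l, by omega⟩) {a | a.val < n + l} := by
        ext a
        simp only [Set.mem_ofPred_eq, Set.mem_insert_iff, Fin.ext_iff, hval]
        omega
      rw [this, Set.image_insert_eq, Submodule.span_insert, hFi, hsmall l le_rfl, sup_comm,
        hw'' _ (by simp only; omega)]
      congr 1
      exact (Submodule.span_singleton_smul_eq (IsUnit.mk0 _
        (mul_ne_zero (hε0 _) (inv_ne_zero hby0))) y).symm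
    · exact hsmall j hjl

end RelativePosition

/-! ### The stratum in terms of incidences with Frobenius -/

section Stratum

variable {p : ℕ} [Fact p.Prime] {k : Type*} [Field k] [Algebra (ZMod p) k] [IsAlgClosed k]
  {V : Type*} [AddCommGroup V] [Module (ZMod p) V] {B : LinearMap.BilinForm (ZMod p) V}
  {m : ℕ} {e : Module.Basis (Fin (2 * m)) (ZMod p) V} {i : Fin (m + 1)}

/-- The description of the flags in the stratum `S_i` by incidences with their Frobenius
translates. -/
structure IsCoxeterFlag {i : ℕ} (F : Fin (i + 1) → Submodule k (k ⊗[ZMod p] V)) : Prop where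
  zero : frobSpace (F 0) = F 0
  le : ∀ j (hj : j + 1 < i + 1), F ⟨j, by omega⟩ ≤ frobSpace (F ⟨j + 1, hj⟩)
  ne : ∀ j, j ≠ 0 → F j ≠ frobSpace (F j)

/-- One direction reads the incidences off the values of w_i on the basis indices. In the other, the
flag and its Frobenius translate are fitted to a hyperbolic basis with the signs of e, which is
therefore the image of e under an isometry. -/
theorem mem_stratum_iff (hB : B.IsAlt) (he : IsSymplecticBasis B e)
    {F : IsotropicFlag (B.baseChange k) m i} :
    F ∈ stratum k B e i ↔ IsCoxeterFlag F.space := by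
  have : Module.Finite (ZMod p) V := Module.Finite.of_basis e
  have hi := i.isLt
  have hh := isHyperbolic_baseChange (k := k) he
  have hstd : ∀ w d, stdSpace k e w d =
      Submodule.span k ((fun a => (e.baseChange k) (w a)) '' {a | a.val < d}) := by
    intro w d
    simp [stdSpace]
  constructor
  · rintro ⟨g, hg, hF⟩
    simp only [hstd, Submodule.map_span, ← Set.image_comp] at hF
    have hinj : Function.Injective fun a => g ((e.baseChange k) a) :=
      g.injective.comp (e.baseChange k).injective
    have hli : LinearIndependent k fun a => g ((e.baseChange k) a) :=
      (e.baseChange k).linearIndependent.map' g.toLinearMap g.ker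
    have hF1 : ∀ j, F.space j = Submodule.span k ((fun a => g ((e.baseChange k) a)) ''
        (weylElt m i '' {a | a.val < m - i.val + j.val})) := by
      intro j
      rw [(hF j).1, ← Set.image_comp]
      rfl
    have hF2 : ∀ j, frobSpace (F.space j) = Submodule.span k ((fun a => g ((e.baseChange k) a)) ''
        {a | a.val < m - i.val + j.val}) := fun j => (hF j).2
    have hidx : ∀ a : Fin (2 * m), ∀ h : a.val < m, a = idx ⟨a.val, h⟩ := fun a h => rfl
    refine ⟨?_, fun j hj => ?_, fun j hj h => ?_⟩
    · rw [hF2, hF1]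
      congr 2
      ext a
      simp only [Fin.val_zero, add_zero, Set.mem_ofPred_eq, Set.mem_image]
      constructor
      · intro ha
        refine ⟨a, ha, Fin.ext ?_⟩
        rw [hidx a (by omega), weylElt_apply (by omega), if_pos ha]
        rfl
      · rintro ⟨c, hc, rfl⟩
        rw [hidx c (by omega), weylElt_apply (by omega), if_pos hc]
        exact hc
    · rw [hF2, hF1]
      refine Submodule.span_mono (Set.image_mono ?_)
      rintro _ ⟨c, hc, rfl⟩
      simp only [Set.mem_ofPred_eq] at hc ⊢
      rw [hidx c (by omega), weylElt_apply (by omega)]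
      simp only
      split_ifs <;> omega
    · rw [hF2, hF1] at h
      have hj0 : j.val ≠ 0 := fun h => hj (Fin.ext h)
      have hjlt := j.isLt
      let a : Fin m := ⟨m - i.val + j.val - 1, by omega⟩
      have h1 : g ((e.baseChange k) (weylElt m i (idx a))) ∈
          Submodule.span k ((fun a => g ((e.baseChange k) a)) ''
            {a | a.val < m - i.val + j.val}) := by
        rw [← h]
        refine Submodule.subset_span ⟨_, ⟨idx a, ?_, rfl⟩, rfl⟩
        simp only [Set.mem_ofPred_eq, idx, a]
        omega
      refine hli.notMem_span_image (x := weylElt m i (idx a)) ?_ h1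
      rw [Set.mem_ofPred_eq, weylElt_apply (by omega)]
      simp only [a]
      split_ifs <;> omega
  · intro hF
    have hdim : Module.finrank k (k ⊗[ZMod p] V) = 2 * m := by
      rw [Module.finrank_baseChange, Module.finrank_eq_card_basis e, Fintype.card_fin]
    let G : ℕ → Submodule k (k ⊗[ZMod p] V) := fun j =>
      if h : j < i.val + 1 then F.space ⟨j, h⟩ else ⊥
    have hG : ∀ j : Fin (i.val + 1), G j.val = F.space j := fun j => dif_pos j.isLt
    have hG' : ∀ j (h : j < i.val + 1), G j = F.space ⟨j, h⟩ := fun j h => dif_pos h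
    have hiso : ∀ D : Submodule k (k ⊗[ZMod p] V), D ≤ (B.baseChange k).orthogonal D →
        frobSpace D ≤ (B.baseChange k).orthogonal (frobSpace D) := by
      intro D hD x hx y hy
      obtain ⟨x, hxD, rfl⟩ := mem_frobSpace_iff.1 hx
      obtain ⟨y, hyD, rfl⟩ := mem_frobSpace_iff.1 hy
      rw [baseChange_form_frob, show B.baseChange k y x = 0 from hD hxD y hyD,
        zero_pow (Fact.out : p.Prime).ne_zero]
    have hFiso : G i ≤ (B.baseChange k).orthogonal (G i) := by
      rw [hG' i (by omega)]
      exact fun x hx y hy => F.isotropic _ y hy x hx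
    obtain ⟨h, hh', hh1⟩ := exists_hyperbolic_of_flags (isAlt_baseChange hB)
      (nondegenerate_baseChange hB he) (n := m - i.val) (i := i.val) (by omega) hdim (sgn k B e)
      (sgn_ne_zero he) (hh.neg_rev (isAlt_baseChange hB)) G (fun j => frobSpace (G j))
      (fun j hj => by rw [hG' j (by omega), F.finrank_space])
      (fun j hj => by rw [finrank_frobSpace, hG' j (by omega), F.finrank_space])
      (fun j hj => by
        rw [hG' j (by omega), hG' (j + 1) (by omega)]
        exact F.mono (Fin.mk_le_mk.2 (Nat.le_succ j)))
      (fun j hj => frobSpace_mono (by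
        rw [hG' j (by omega), hG' (j + 1) (by omega)]
        exact F.mono (Fin.mk_le_mk.2 (Nat.le_succ j))))
      hFiso (hiso _ hFiso) (by rw [hG' 0 (by omega)]; exact hF.zero.symm)
      (fun j hj => by rw [hG' j (by omega), hG' (j + 1) (by omega)]; exact hF.le j (by omega))
      (fun j hj1 hj2 => by
        rw [hG' j (by omega)]
        exact hF.ne _ fun h => by simp [Fin.ext_iff] at h; omega)
    obtain ⟨g, hg1, hg2⟩ := exists_isometry (sgn_ne_zero he) hh hh'
    refine ⟨g, hg1, fun j => ?_⟩
    obtain ⟨h1, h2⟩ := hh1 j.val (by omega)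
    simp only [hstd, Submodule.map_span, ← Set.image_comp]
    rw [hG] at h1 h2
    refine ⟨h1.trans ?_, h2.trans ?_⟩
    · congr 1
      refine Set.image_congr fun a _ => ?_
      exact (hg2 _).symm
    · congr 1
      refine Set.image_congr fun a _ => ?_
      exact (hg2 _).symm

end Stratum

/-! ### Bases adapted to a flag -/

section Adapted

variable {K : Type*} [Field K] {E : Type*} [AddCommGroup E] [Module K E] [FiniteDimensional K E]

theorem exists_adapted_family {n i : ℕ} (F : ℕ → Submodule K E)
    (hF : ∀ j ≤ i, Module.finrank K (F j) = n + j) (hmono : ∀ j < i, F j ≤ F (j + 1)) :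
    ∃ f : ℕ → E, ∀ j ≤ i, F j = Submodule.span K (f '' {a | a < n + j}) := by
  have hx : ∀ j, ∃ x, j < i → x ∈ F (j + 1) ∧ x ∉ F j := by
    intro j
    by_cases hj : j < i
    · have : ¬ F (j + 1) ≤ F j := by
        intro h
        have := Submodule.finrank_mono h
        rw [hF _ (by omega), hF _ (by omega)] at this
        omega
      obtain ⟨x, hx1, hx2⟩ := Set.not_subset.1 this
      exact ⟨x, fun _ => ⟨hx1, hx2⟩⟩
    · exact ⟨0, fun h => absurd h hj⟩
  choose x hx using hx
  obtain ⟨b, -, hb⟩ := exists_linearIndependent_span_eq (F 0) (hF 0 (Nat.zero_le _))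
  let f : ℕ → E := fun a => if h : a < n + 0 then b ⟨a, h⟩ else x (a - n)
  have hfx : ∀ j, f (n + j) = x j := by
    intro j
    simp only [f, dif_neg (show ¬ n + j < n + 0 by omega)]
    congr 1
    omega
  refine ⟨f, fun j => ?_⟩
  induction j with
  | zero =>
    intro _
    rw [← hb]
    congr 1
    ext y
    constructor
    · rintro ⟨a, rfl⟩
      exact ⟨a.val, a.isLt, dif_pos a.isLt⟩
    · rintro ⟨a, ha, rfl⟩
      exact ⟨⟨a, ha⟩, (dif_pos (show a < n + 0 from ha) : f a = _).symm⟩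
  | succ j ih =>
    intro hj
    obtain ⟨hx1, hx2⟩ := hx j (by omega)
    have h1 : F j ⊔ Submodule.span K {x j} ≤ F (j + 1) :=
      sup_le (hmono j (by omega)) ((Submodule.span_singleton_le_iff_mem _ _).2 hx1)
    have h2 : Module.finrank K (F j) < Module.finrank K ↥(F j ⊔ Submodule.span K {x j}) := by
      refine Submodule.finrank_lt_finrank_of_lt (lt_of_le_of_ne le_sup_left fun h => hx2 ?_)
      rw [h]
      exact Submodule.mem_sup_right (Submodule.mem_span_singleton_self _)
    rw [← Submodule.eq_of_le_of_finrank_le h1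
      (by rw [hF _ hj]; rw [hF _ (by omega)] at h2; omega), ih (by omega), ← hfx]
    have : {a | a < n + (j + 1)} = insert (n + j) {a | a < n + j} := by
      ext a
      simp only [Set.mem_ofPred_eq, Set.mem_insert_iff]
      omega
    rw [this, Set.image_insert_eq, Submodule.span_insert, sup_comm]

end Adapted

/-! ### Topology and morphisms of flag varieties through frames -/

section FlagTopology

variable {k : Type*} [Field k] {E : Type*} [AddCommGroup E] [Module k E]
  {β : LinearMap.BilinForm k E} {m : ℕ} {i : Fin (m + 1)}

theorem IsotropicFrame.flag_last_eq (v : IsotropicFrame β m) :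
    (v.flag i).space (Fin.last i.val) = Submodule.span k (Set.range v.vec) := by
  have hi := i.isLt
  rw [← Set.image_univ]
  change Submodule.span k (v.vec '' {a | a.val < m - i.val + i.val}) = _
  congr 2
  ext a
  have := a.isLt
  simp only [Set.mem_ofPred_eq, Set.mem_univ, iff_true]
  omega

theorem exists_frame [FiniteDimensional k E] (F : IsotropicFlag β m i) :
    ∃ v : IsotropicFrame β m, v.flag i = F := by
  have hi := i.isLt
  let G : ℕ → Submodule k E := fun j => if h : j < i.val + 1 then F.space ⟨j, h⟩ else ⊥
  have hG : ∀ j (h : j < i.val + 1), G j = F.space ⟨j, h⟩ := fun j h => dif_pos h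
  obtain ⟨f, hf⟩ := exists_adapted_family (n := m - i.val) (i := i.val) G
    (fun j hj => by rw [hG j (by omega), F.finrank_space]) (fun j hj => by
      rw [hG j (by omega), hG (j + 1) (by omega)]
      exact F.mono (Fin.mk_le_mk.2 (Nat.le_succ j)))
  have hspan : ∀ j : Fin (i.val + 1), F.space j =
      Submodule.span k ((fun a : Fin m => f a) '' {a | a.val < m - i.val + j.val}) := by
    intro j
    rw [← hG j.val j.isLt, hf j.val (by omega)]
    congr 1
    ext y
    constructor
    · rintro ⟨a, ha, rfl⟩
      simp only [Set.mem_ofPred_eq] at ha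
      exact ⟨⟨a, by omega⟩, ha, rfl⟩
    · rintro ⟨a, ha, rfl⟩
      exact ⟨a, ha, rfl⟩
  have hrange : Submodule.span k (Set.range fun a : Fin m => f a) =
      F.space (Fin.last i.val) := by
    rw [hspan, ← Set.image_univ]
    congr 2
    ext a
    have := a.isLt
    simp only [Set.mem_ofPred_eq, Set.mem_univ, Fin.val_last, true_iff]
    omega
  have hmem : ∀ a : Fin m, f a ∈ F.space (Fin.last i.val) := fun a =>
    hrange ▸ Submodule.subset_span ⟨a, rfl⟩
  refine ⟨⟨fun a => f a, ?_, fun a b => F.isotropic _ _ (hmem a) _ (hmem b)⟩, ?_⟩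
  · rw [linearIndependent_iff_card_eq_finrank_span, Set.finrank, hrange, F.finrank_space,
      Fintype.card_fin, Fin.val_last]
    omega
  · ext1
    funext j
    exact (hspan j).symm

/-- Two frames of one flag differ by a block triangular matrix. This matrix acts linearly on E^m and
preserves the flag of every frame, so conditions and functions can be moved from one frame of a flag
to another. -/
theorem exists_linear_of_flag_eq {v w : IsotropicFrame β m} (h : v.flag i = w.flag i) :
    ∃ L : (Fin m → E) →ₗ[k] (Fin m → E), L w.vec = v.vec ∧
      ∀ u : IsotropicFrame β m, ∃ u' : IsotropicFrame β m,
        u'.vec = L u.vec ∧ u'.flag i = u.flag i := by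
  classical
  have hi := i.isLt
  have hg : ∀ a, ∃ g : Fin m → k, ∑ b, g b • w.vec b = v.vec a ∧
      ∀ j : Fin (i.val + 1), a.val < m - i.val + j.val →
        ∀ b : Fin m, m - i.val + j.val ≤ b.val → g b = 0 := by
    intro a
    have hlast : v.vec a ∈ Submodule.span k (Set.range w.vec) := by
      rw [← w.flag_last_eq (i := i), ← h, v.flag_last_eq]
      exact Submodule.subset_span ⟨a, rfl⟩
    obtain ⟨g, hg⟩ := (Submodule.mem_span_range_iff_exists_fun k).1 hlast
    refine ⟨g, hg, fun j hj b hb => ?_⟩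
    have h1 : v.vec a ∈ (w.flag i).space j := by
      rw [← h]
      exact Submodule.subset_span ⟨a, hj, rfl⟩
    obtain ⟨l, hl1, hl2⟩ := (Finsupp.mem_span_image_iff_linearCombination k).1 h1
    have h2 : Finsupp.linearCombination k w.vec (l - Finsupp.equivFunOnFinite.symm g) = 0 := by
      rw [map_sub, hl2, sub_eq_zero, ← hg,
        Finsupp.linearCombination_apply, Finsupp.sum_fintype _ _ (fun c => by simp)]
      rfl
    have h3 := congrArg (fun l => l b) (linearIndependent_iff.1 w.linearIndependent _ h2)
    simp only [Finsupp.sub_apply, Finsupp.zero_apply, sub_eq_zero] at h3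
    change l b = g b at h3
    rw [← h3]
    by_contra hne
    have := (Finsupp.mem_supported _ _).1 hl1 (Finsupp.mem_support_iff.2 hne)
    simp only [Set.mem_ofPred_eq] at this
    omega
  choose g hg1 hg2 using hg
  let L : (Fin m → E) →ₗ[k] (Fin m → E) :=
    LinearMap.pi fun a => ∑ b, g a b • LinearMap.proj b
  have hL : ∀ u a, L u a = ∑ b, g a b • u b := by
    intro u a
    simp [L]
  refine ⟨L, funext fun a => by rw [hL, hg1], fun u => ?_⟩
  have hli : LinearIndependent k (L u.vec) := by
    rw [Fintype.linearIndependent_iff]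
    intro c hc
    have h1 : ∑ b, (∑ a, c a * g a b) • u.vec b = 0 := by
      rw [← hc]
      simp only [hL, Finset.sum_smul, Finset.smul_sum, mul_smul]
      rw [Finset.sum_comm]
    have h2 := Fintype.linearIndependent_iff.1 u.linearIndependent _ h1
    refine Fintype.linearIndependent_iff.1 v.linearIndependent c ?_
    have h3 : ∑ a, c a • v.vec a = ∑ b, (∑ a, c a * g a b) • w.vec b := by
      simp only [← hg1, Finset.sum_smul, Finset.smul_sum, mul_smul]
      rw [Finset.sum_comm]
    rw [h3]
    exact Finset.sum_eq_zero fun b _ => by rw [h2 b, zero_smul]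
  let u' : IsotropicFrame β m := ⟨L u.vec, hli, fun a b => by
    simp [hL, u.isotropic]⟩
  refine ⟨u', rfl, ?_⟩
  ext1
  funext j
  have : FiniteDimensional k ((u.flag i).space j) :=
    FiniteDimensional.span_of_finite k (Set.toFinite _)
  refine Submodule.eq_of_le_of_finrank_eq ?_ ?_
  · refine Submodule.span_le.2 ?_
    rintro _ ⟨a, ha, rfl⟩
    change L u.vec a ∈ _
    rw [hL]
    refine Submodule.sum_mem _ fun b _ => ?_
    by_cases hb : b.val < m - i.val + j.val
    · exact Submodule.smul_mem _ _ (Submodule.subset_span ⟨b, hb, rfl⟩)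
    · rw [hg2 a j ha b (not_lt.1 hb), zero_smul]
      exact Submodule.zero_mem _
  · rw [IsotropicFlag.finrank_space, IsotropicFlag.finrank_space]

/-- The topology of a subset X of the flag variety can be tested on frames of flags in X. What has
to be shown is that a basic open set of frames, enlarged by all frames with the same flags, is still
open; this holds because it is stable under the linear changes of frame. -/
theorem isOpen_flag_iff [FiniteDimensional k E] {X : Set (IsotropicFlag β m i)} {U : Set X} :
    IsOpen U ↔ ∀ (v : IsotropicFrame β m) (hv : v.flag i ∈ X), (⟨v.flag i, hv⟩ : X) ∈ U →
      ∃ f ∈ polyFun k (Fin m → E), f v.vec ≠ 0 ∧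
        ∀ (u : IsotropicFrame β m) (hu : u.flag i ∈ X), f u.vec ≠ 0 →
          (⟨u.flag i, hu⟩ : X) ∈ U := by
  constructor
  · intro hU v hv hvU
    obtain ⟨O, hO, rfl⟩ := isOpen_induced_iff.1 hU
    have h1 : IsOpen ((fun v : IsotropicFrame β m => v.flag i) ⁻¹' O) := isOpen_coinduced.1 hO
    obtain ⟨f, hf, hfv, hfO⟩ := (isOpen_induced_zariski_iff (k := k)
      (IsotropicFrame.vec : IsotropicFrame β m → _)).1 h1 v hvU
    exact ⟨f, hf, hfv, fun u _ hu => hfO u hu⟩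
  · intro h
    choose! f hf1 hf2 hf3 using h
    -- The open set of the full flag variety consists of the flags that have some frame at which one
    -- of the chosen polynomials is nonzero.
    refine isOpen_induced_iff.2 ⟨{F | ∃ (u v : IsotropicFrame β m) (hv : v.flag i ∈ X),
      (⟨v.flag i, hv⟩ : X) ∈ U ∧ f v u.vec ≠ 0 ∧ u.flag i = F}, ?_, ?_⟩
    · refine isOpen_coinduced.2 ((isOpen_induced_zariski_iff (k := k) _).2 ?_)
      rintro w ⟨u, v, hv, hvU, hfu, huw⟩
      obtain ⟨L, hL1, hL2⟩ := exists_linear_of_flag_eq huw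
      refine ⟨fun x => f v (L x), polyFun_comp_linear L (hf1 v hv hvU), by simpa only [hL1] using hfu, fun y hy => ?_⟩
      obtain ⟨u', hu1, hu2⟩ := hL2 y
      exact ⟨u', v, hv, hvU, by rwa [hu1], hu2⟩
    · ext F
      constructor
      · rintro ⟨u, v, hv, hvU, hfu, huF⟩
        have := hf3 v hv hvU u (huF ▸ F.2) hfu
        convert this
        exact huF.symm
      · intro hF
        obtain ⟨v, hv⟩ := exists_frame F.1
        have hvX : v.flag i ∈ X := hv ▸ F.2
        have hvU : (⟨v.flag i, hvX⟩ : X) ∈ U := by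
          convert hF
        exact ⟨v, v, hvX, hvU, hf2 v hvX hvU, hv⟩

/-- Maps of subvarieties of flag varieties that lift locally to polynomial maps on frames. -/
def LiftsToFrames {E' : Type*} [AddCommGroup E'] [Module k E'] {β' : LinearMap.BilinForm k E'}
    {m' : ℕ} {i' : Fin (m' + 1)} {X : Set (IsotropicFlag β m i)}
    {Y : Set (IsotropicFlag β' m' i')} (φ : X → Y) : Prop :=
  ∀ (v : IsotropicFrame β m), v.flag i ∈ X → ∃ P : (Fin m → E) → (Fin m' → E'),
    (∀ f ∈ polyFun k (Fin m' → E'), (fun x => f (P x)) ∈ polyFun k (Fin m → E)) ∧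
    ∃ b ∈ polyFun k (Fin m → E), b v.vec ≠ 0 ∧
      ∀ (u : IsotropicFrame β m) (hu : u.flag i ∈ X), b u.vec ≠ 0 →
        ∃ u' : IsotropicFrame β' m', u'.vec = P u.vec ∧ u'.flag i' = (φ ⟨u.flag i, hu⟩).1

section Lifts

variable [FiniteDimensional k E] {E' : Type*} [AddCommGroup E'] [Module k E']
  [FiniteDimensional k E'] {β' : LinearMap.BilinForm k E'}
  {m' : ℕ} {i' : Fin (m' + 1)} {X : Set (IsotropicFlag β m i)}
  {Y : Set (IsotropicFlag β' m' i')}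

theorem LiftsToFrames.continuous {φ : X → Y} (hφ : LiftsToFrames φ) : Continuous φ := by
  refine continuous_def.2 fun U hU => isOpen_flag_iff.2 fun v hv hvU => ?_
  obtain ⟨P, hP, b, hb, hbv, hlift⟩ := hφ v hv
  obtain ⟨v', hv'1, hv'2⟩ := hlift v hv hbv
  have hv'Y : v'.flag i' ∈ Y := hv'2 ▸ (φ _).2
  have hv'e : (⟨v'.flag i', hv'Y⟩ : Y) = φ ⟨v.flag i, hv⟩ := Subtype.ext hv'2
  have hv'U : (⟨v'.flag i', hv'Y⟩ : Y) ∈ U := hv'e ▸ hvU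
  obtain ⟨f, hf, hfv, hfU⟩ := isOpen_flag_iff.1 hU v' hv'Y hv'U
  refine ⟨b * fun x => f (P x), mul_mem hb (hP f hf), ?_, fun u hu hbu => ?_⟩
  · rw [Pi.mul_apply, ← hv'1]
    exact mul_ne_zero hbv hfv
  · rw [Pi.mul_apply] at hbu
    obtain ⟨u', hu'1, hu'2⟩ := hlift u hu (left_ne_zero_of_mul hbu)
    have := hfU u' (hu'2 ▸ (φ _).2) (by rw [hu'1]; exact right_ne_zero_of_mul hbu)
    change φ _ ∈ U
    convert this
    exact hu'2.symm

omit [FiniteDimensional k E] [FiniteDimensional k E'] in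
theorem LiftsToFrames.isRegularOn {φ : X → Y} (hφ : LiftsToFrames φ) {U : Set Y} {f : Y → k}
    (hf : IsRegularOn U f) : IsRegularOn (φ ⁻¹' U) (f ∘ φ) := by
  intro v hv hvU
  obtain ⟨P, hP, b, hb, hbv, hlift⟩ := hφ v hv
  obtain ⟨v', hv'1, hv'2⟩ := hlift v hv hbv
  have hv'Y : v'.flag i' ∈ Y := hv'2 ▸ (φ _).2
  have hv'e : (⟨v'.flag i', hv'Y⟩ : Y) = φ ⟨v.flag i, hv⟩ := Subtype.ext hv'2
  have hv'U : (⟨v'.flag i', hv'Y⟩ : Y) ∈ U := hv'e ▸ hvU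
  obtain ⟨c, hc, d, hd, hdv, hcd⟩ := hf v' hv'Y hv'U
  refine ⟨b * fun x => c (P x), mul_mem hb (hP c hc), b * fun x => d (P x), mul_mem hb (hP d hd),
    ?_, fun u hu huU hbu => ?_⟩
  · rw [Pi.mul_apply, ← hv'1]
    exact mul_ne_zero hbv hdv
  · rw [Pi.mul_apply] at hbu
    have hbu' := left_ne_zero_of_mul hbu
    obtain ⟨u', hu'1, hu'2⟩ := hlift u hu hbu'
    have hu'Y : u'.flag i' ∈ Y := hu'2 ▸ (φ _).2
    have hu'e : (⟨u'.flag i', hu'Y⟩ : Y) = φ ⟨u.flag i, hu⟩ := Subtype.ext hu'2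
    have hu'U : (⟨u'.flag i', hu'Y⟩ : Y) ∈ U := hu'e ▸ huU
    have := hcd u' hu'Y hu'U (by rw [hu'1]; exact right_ne_zero_of_mul hbu)
    rw [Pi.mul_apply, Pi.mul_apply, mul_div_mul_left _ _ hbu', ← hu'1, ← this, Function.comp_apply]
    congr 1
    exact Subtype.ext hu'2.symm

/-- A bijection that lifts to frames in both directions, as a homeomorphism. -/
def homeomorphOfLifts (φ : X ≃ Y) (h1 : LiftsToFrames φ) (h2 : LiftsToFrames φ.symm) : X ≃ₜ Y where
  toEquiv := φ
  continuous_toFun := h1.continuous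
  continuous_invFun := h2.continuous

theorem isIsomorphicTo_of_lifts (φ : X ≃ Y) (h1 : LiftsToFrames φ) (h2 : LiftsToFrames φ.symm) :
    IsIsomorphicTo X Y := by
  refine ⟨homeomorphOfLifts φ h1 h2, fun U hU f => ⟨fun h => h1.isRegularOn h, fun h => ?_⟩⟩
  have h3 := h2.isRegularOn h
  have h4 : φ.symm ⁻¹' (homeomorphOfLifts φ h1 h2 ⁻¹' U) = U := by
    ext y
    change φ (φ.symm y) ∈ U ↔ _
    rw [φ.apply_symm_apply]
  have h5 : (f ∘ (homeomorphOfLifts φ h1 h2)) ∘ φ.symm = f := by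
    funext y
    change f (φ (φ.symm y)) = _
    rw [φ.apply_symm_apply]
  rwa [h4, h5] at h3

end Lifts

end FlagTopology

/-! ### Flags of N^⊥/N and flags of spaces that contain N -/

section Reduction

variable {K : Type*} [Field K] {E : Type*} [AddCommGroup E] [Module K E] [FiniteDimensional K E]
  {E' : Type*} [AddCommGroup E'] [Module K E'] [FiniteDimensional K E']
  {β : LinearMap.BilinForm K E} {β' : LinearMap.BilinForm K E'} {N : Submodule K E}
  {pr : E →ₗ[K] E'} {sec : E' →ₗ[K] E}

/-- `E'` is the symplectic reduction `N^⊥/N`, by means of a linear map `pr` that extends the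
quotient map and a linear section of the quotient map. -/
structure IsReduction (β : LinearMap.BilinForm K E) (N : Submodule K E)
    (β' : LinearMap.BilinForm K E') (pr : E →ₗ[K] E') (sec : E' →ₗ[K] E) : Prop where
  le_orthogonal : N ≤ β.orthogonal N
  sec_mem : ∀ y, sec y ∈ β.orthogonal N
  pr_sec : ∀ y, pr (sec y) = y
  sub_mem : ∀ x ∈ β.orthogonal N, x - sec (pr x) ∈ N
  pr_mem : ∀ x ∈ N, pr x = 0
  form : ∀ x ∈ β.orthogonal N, ∀ y ∈ β.orthogonal N, β' (pr x) (pr y) = β x y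

/-- The preimage in `N^⊥` of a subspace of `N^⊥/N`. -/
def liftSpace (N : Submodule K E) (sec : E' →ₗ[K] E) (D : Submodule K E') : Submodule K E :=
  N ⊔ D.map sec

namespace IsReduction

variable (h : IsReduction β N β' pr sec)

include h

omit [FiniteDimensional K E] [FiniteDimensional K E'] in
theorem liftSpace_le (D : Submodule K E') : liftSpace N sec D ≤ β.orthogonal N :=
  sup_le h.le_orthogonal (Submodule.map_le_iff_le_comap.2 fun y _ => h.sec_mem y)

omit [FiniteDimensional K E] [FiniteDimensional K E'] in
theorem mem_liftSpace_iff {D : Submodule K E'} {x : E} (hx : x ∈ β.orthogonal N) :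
    x ∈ liftSpace N sec D ↔ pr x ∈ D := by
  constructor
  · intro hx
    obtain ⟨y, hy, z, hz, rfl⟩ := Submodule.mem_sup.1 hx
    obtain ⟨w, hw, rfl⟩ := hz
    rw [map_add, h.pr_mem y hy, h.pr_sec, zero_add]
    exact hw
  · intro hD
    have : x = (x - sec (pr x)) + sec (pr x) := by abel
    rw [this]
    exact Submodule.add_mem_sup (h.sub_mem x hx) ⟨_, hD, rfl⟩

omit [FiniteDimensional K E] [FiniteDimensional K E'] in
theorem liftSpace_le_iff {D D' : Submodule K E'} :
    liftSpace N sec D ≤ liftSpace N sec D' ↔ D ≤ D' := by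
  constructor
  · intro hle y hy
    have h1 : sec y ∈ liftSpace N sec D := Submodule.mem_sup_right ⟨y, hy, rfl⟩
    have h2 := (h.mem_liftSpace_iff (h.sec_mem y)).1 (hle h1)
    rwa [h.pr_sec] at h2
  · exact fun hle => sup_le_sup le_rfl (Submodule.map_mono hle)

omit [FiniteDimensional K E] [FiniteDimensional K E'] in
theorem liftSpace_injective : Function.Injective (liftSpace N sec) := fun _ _ hD =>
  le_antisymm (h.liftSpace_le_iff.1 hD.le) (h.liftSpace_le_iff.1 hD.ge)

omit [FiniteDimensional K E] [FiniteDimensional K E'] in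
theorem liftSpace_inf (D D' : Submodule K E') :
    liftSpace N sec (D ⊓ D') = liftSpace N sec D ⊓ liftSpace N sec D' := by
  ext x
  by_cases hx : x ∈ β.orthogonal N
  · rw [Submodule.mem_inf, h.mem_liftSpace_iff hx, h.mem_liftSpace_iff hx,
      h.mem_liftSpace_iff hx, Submodule.mem_inf]
  · exact iff_of_false (fun h' => hx (h.liftSpace_le _ h'))
      (fun h' => hx (h.liftSpace_le _ h'.1))

theorem finrank_liftSpace (D : Submodule K E') :
    Module.finrank K (liftSpace N sec D) = Module.finrank K N + Module.finrank K D := by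
  have h1 := Submodule.finrank_sup_add_finrank_inf_eq N (D.map sec)
  have h2 : N ⊓ D.map sec = ⊥ := by
    rw [eq_bot_iff]
    rintro _ ⟨hx, y, hy, rfl⟩
    have := h.pr_mem _ hx
    rw [h.pr_sec] at this
    rw [this, map_zero]
    exact Submodule.zero_mem _
  have hinj : Function.Injective sec := Function.LeftInverse.injective h.pr_sec
  have h3 := (Submodule.equivMapOfInjective sec hinj D).finrank_eq
  rw [h2, finrank_bot, add_zero, ← h3] at h1
  exact h1

omit [FiniteDimensional K E] [FiniteDimensional K E'] in
theorem liftSpace_map {D : Submodule K E} (hN : N ≤ D) (hD : D ≤ β.orthogonal N) :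
    liftSpace N sec (D.map pr) = D := by
  ext x
  constructor
  · intro hx
    obtain ⟨y, hy, hyx⟩ := (h.mem_liftSpace_iff (h.liftSpace_le _ hx)).1 hx
    have h1 : x - y ∈ N := by
      have h2 := h.sub_mem (x - y) (Submodule.sub_mem _ (h.liftSpace_le _ hx) (hD hy))
      rwa [map_sub, hyx, sub_self, map_zero, sub_zero] at h2
    have : x = (x - y) + y := by abel
    rw [this]
    exact D.add_mem (hN h1) hy
  · intro hx
    exact (h.mem_liftSpace_iff (hD hx)).2 ⟨x, hx, rfl⟩

omit [FiniteDimensional K E] [FiniteDimensional K E'] in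
theorem map_liftSpace (D : Submodule K E') : (liftSpace N sec D).map pr = D := by
  ext y
  constructor
  · rintro ⟨x, hx, rfl⟩
    exact (h.mem_liftSpace_iff (h.liftSpace_le _ hx)).1 hx
  · intro hy
    exact ⟨sec y, Submodule.mem_sup_right ⟨y, hy, rfl⟩, h.pr_sec y⟩

variable {m i : ℕ} {c : Fin (m + 1)}

omit [FiniteDimensional K E] [FiniteDimensional K E'] in
theorem space_le_orthogonal (F : IsotropicFlag β m c) (hF : N ≤ F.space 0)
    (j : Fin (c.val + 1)) : F.space j ≤ β.orthogonal N := fun x hx y hy =>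
  F.isotropic j y (F.mono (Fin.zero_le j) (hF hy)) x hx

/-- The flag of `N^⊥/N` induced by a flag of subspaces that contain `N`. -/
def reduceFlag (hi : Module.finrank K N + i = m) (hc : c.val < i + 1) (F : IsotropicFlag β m c)
    (hF : N ≤ F.space 0) : IsotropicFlag β' i ⟨c.val, hc⟩ where
  space j := (F.space j).map pr
  mono _ _ hj := Submodule.map_mono (F.mono hj)
  finrank_space j := by
    have h1 := h.finrank_liftSpace ((F.space j).map pr)
    rw [h.liftSpace_map (hF.trans (F.mono (Fin.zero_le j))) (h.space_le_orthogonal F hF j),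
      F.finrank_space] at h1
    have h2 := c.isLt
    have h3 := j.isLt
    simp only
    omega
  isotropic j := by
    rintro _ ⟨x, hx, rfl⟩ _ ⟨y, hy, rfl⟩
    rw [h.form x (h.space_le_orthogonal F hF j hx) y (h.space_le_orthogonal F hF j hy)]
    exact F.isotropic j x hx y hy

/-- The preimage in `N^⊥` of a flag of `N^⊥/N`. -/
def liftFlag (hi : Module.finrank K N + i = m) (hc : c.val < i + 1)
    (F : IsotropicFlag β' i ⟨c.val, hc⟩) : IsotropicFlag β m c where
  space j := liftSpace N sec (F.space j)
  mono _ _ hj := h.liftSpace_le_iff.2 (F.mono hj)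
  finrank_space j := by
    rw [h.finrank_liftSpace, F.finrank_space]
    have h2 := c.isLt
    have h3 := j.isLt
    simp only
    omega
  isotropic j x hx y hy := by
    rw [← h.form x (h.liftSpace_le _ hx) y (h.liftSpace_le _ hy)]
    exact F.isotropic j _ ((h.mem_liftSpace_iff (h.liftSpace_le _ hx)).1 hx) _
      ((h.mem_liftSpace_iff (h.liftSpace_le _ hy)).1 hy)

theorem le_liftFlag (hi : Module.finrank K N + i = m) (hc : c.val < i + 1)
    (F : IsotropicFlag β' i ⟨c.val, hc⟩) : N ≤ (h.liftFlag hi hc F).space 0 := le_sup_left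

theorem liftFlag_reduceFlag (hi : Module.finrank K N + i = m) (hc : c.val < i + 1)
    (F : IsotropicFlag β m c) (hF : N ≤ F.space 0) :
    h.liftFlag hi hc (h.reduceFlag hi hc F hF) = F := by
  ext1
  funext j
  exact h.liftSpace_map (hF.trans (F.mono (Fin.zero_le j))) (h.space_le_orthogonal F hF j)

theorem reduceFlag_liftFlag (hi : Module.finrank K N + i = m) (hc : c.val < i + 1)
    (F : IsotropicFlag β' i ⟨c.val, hc⟩) :
    h.reduceFlag hi hc (h.liftFlag hi hc F) (h.le_liftFlag hi hc F) = F := by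
  ext1
  funext j
  exact h.map_liftSpace (F.space j)

/-- Varieties of flags of `N^⊥/N` as varieties of flags of subspaces that contain `N`. -/
def equiv (hi : Module.finrank K N + i = m) (hc : c.val < i + 1)
    {X : Set (IsotropicFlag β m c)} {Y : Set (IsotropicFlag β' i ⟨c.val, hc⟩)}
    (hX : ∀ F ∈ X, N ≤ F.space 0) (hY : ∀ F, h.liftFlag hi hc F ∈ X ↔ F ∈ Y) : X ≃ Y where
  toFun F := ⟨h.reduceFlag hi hc F.1 (hX F.1 F.2), (hY _).1 (by
    rw [h.liftFlag_reduceFlag]; exact F.2)⟩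
  invFun F := ⟨h.liftFlag hi hc F.1, (hY _).2 F.2⟩
  left_inv F := Subtype.ext (h.liftFlag_reduceFlag hi hc F.1 (hX F.1 F.2))
  right_inv F := Subtype.ext (h.reduceFlag_liftFlag hi hc F.1)

/-- The frame of a lifted flag. -/
theorem exists_lift_frame (hi : Module.finrank K N + i = m) (hc : c.val < i + 1) :
    ∃ P : (Fin i → E') → (Fin m → E), (∃ (L : (Fin i → E') →ₗ[K] (Fin m → E)) (v₀ : Fin m → E),
      ∀ x, P x = L x + v₀) ∧ (∀ x (a : Fin i), P x ⟨Module.finrank K N + a.val, by omega⟩ = sec (x a)) ∧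
      ∀ u : IsotropicFrame β' i, ∃ u' : IsotropicFrame β m, u'.vec = P u.vec ∧
        u'.flag c = h.liftFlag hi hc (u.flag _) := by
  obtain ⟨b, hb1, hb2⟩ := exists_linearIndependent_span_eq N rfl
  let v₀ : Fin m → E := fun a => if ha : a.val < Module.finrank K N then b ⟨a, ha⟩ else 0
  let L : (Fin i → E') →ₗ[K] (Fin m → E) := LinearMap.pi fun a =>
    if ha : a.val < Module.finrank K N then 0 else
      sec ∘ₗ LinearMap.proj ⟨a.val - Module.finrank K N, by omega⟩
  -- The map is affine: the first entries are a fixed basis of N, the others are lifted by the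
  -- section.
  let P : (Fin i → E') → (Fin m → E) := fun x => L x + v₀
  have hP1 : ∀ x (a : Fin m) (ha : a.val < Module.finrank K N), P x a = b ⟨a, ha⟩ := by
    intro x a ha
    simp [P, L, v₀, ha]
  have hP2 : ∀ x (a : Fin i), P x ⟨Module.finrank K N + a.val, by omega⟩ = sec (x a) := by
    intro x a
    simp [P, L, v₀]
  refine ⟨P, ⟨L, v₀, fun x => rfl⟩, hP2, fun u => ?_⟩
  have hspan : ∀ d ≤ i, Submodule.span K (P u.vec '' {a | a.val < Module.finrank K N + d}) =
      liftSpace N sec (Submodule.span K (u.vec '' {a | a.val < d})) := by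
    intro d hd
    rw [liftSpace, Submodule.map_span]
    conv_rhs => rw [← hb2, ← Submodule.span_union]
    congr 1
    ext y
    constructor
    · rintro ⟨a, ha, rfl⟩
      simp only [Set.mem_ofPred_eq] at ha
      by_cases han : a.val < Module.finrank K N
      · exact Or.inl ⟨⟨a, han⟩, (hP1 _ _ han).symm⟩
      · refine Or.inr ⟨u.vec ⟨a.val - Module.finrank K N, by omega⟩, ⟨_, ?_, rfl⟩, ?_⟩
        · simp only [Set.mem_ofPred_eq]; omega
        · rw [← hP2]
          congr 1
          apply Fin.ext
          simp only
          omega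
    · rintro (⟨a, rfl⟩ | ⟨_, ⟨a, ha, rfl⟩, rfl⟩)
      · exact ⟨⟨a, by omega⟩, by simp only [Set.mem_ofPred_eq]; omega, hP1 _ _ a.isLt⟩
      · exact ⟨_, by simpa using ha, hP2 _ _⟩
  have hspan' : Submodule.span K (Set.range (P u.vec)) =
      liftSpace N sec (Submodule.span K (Set.range u.vec)) := by
    have := hspan i le_rfl
    rw [← Set.image_univ, ← Set.image_univ]
    convert this using 3
    · ext a
      have := a.isLt
      simp only [Set.mem_univ, Set.mem_ofPred_eq, true_iff]
      omega
    · congr 1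
      ext a
      simp
  have hli : LinearIndependent K (P u.vec) := by
    rw [linearIndependent_iff_card_eq_finrank_span, Set.finrank, hspan', h.finrank_liftSpace,
      finrank_span_eq_card u.linearIndependent, Fintype.card_fin, Fintype.card_fin, hi]
  let F := h.liftFlag (c := 0) hi (Nat.succ_pos i) (u.flag 0)
  have hmem : ∀ a, P u.vec a ∈ F.space (Fin.last _) := by
    intro a
    change _ ∈ liftSpace N sec ((u.flag 0).space (Fin.last _))
    rw [u.flag_last_eq, ← hspan']
    exact Submodule.subset_span ⟨a, rfl⟩
  refine ⟨⟨P u.vec, hli, fun a a' => F.isotropic _ _ (hmem a) _ (hmem a')⟩, rfl, ?_⟩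
  ext1
  funext j
  have h1 := c.isLt
  have h2 := j.isLt
  have h3 := hspan (i - c.val + j.val) (by omega)
  rw [show Module.finrank K N + (i - c.val + j.val) = m - c.val + j.val by omega] at h3
  exact h3

theorem liftsToFrames_symm (hi : Module.finrank K N + i = m) (hc : c.val < i + 1)
    {X : Set (IsotropicFlag β m c)} {Y : Set (IsotropicFlag β' i ⟨c.val, hc⟩)}
    (hX : ∀ F ∈ X, N ≤ F.space 0) (hY : ∀ F, h.liftFlag hi hc F ∈ X ↔ F ∈ Y) :
    LiftsToFrames (h.equiv hi hc hX hY).symm := by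
  intro v hv
  obtain ⟨P, ⟨L, v₀, hL⟩, -, hP2⟩ := h.exists_lift_frame (c := c) hi hc
  refine ⟨P, fun f hf => ?_, 1, one_mem _, one_ne_zero, fun u hu _ => ?_⟩
  · simp only [hL]
    exact polyFun_comp_affine L v₀ hf
  · exact hP2 u

/-- A frame of a flag above N need not begin with a basis of N, as for Lagrangian subspaces. So a
fixed change of frame first brings v to the frame lifted from N^⊥/N; the last i vectors are then
projected, which gives a frame wherever these projections stay independent. -/
theorem liftsToFrames (hi : Module.finrank K N + i = m) (hc : c.val < i + 1)
    {X : Set (IsotropicFlag β m c)} {Y : Set (IsotropicFlag β' i ⟨c.val, hc⟩)}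
    (hX : ∀ F ∈ X, N ≤ F.space 0) (hY : ∀ F, h.liftFlag hi hc F ∈ X ↔ F ∈ Y) :
    LiftsToFrames (h.equiv hi hc hX hY) := by
  classical
  intro v hv
  obtain ⟨P, -, hP1, hP2⟩ := h.exists_lift_frame (c := c) hi hc
  obtain ⟨v', hv'⟩ := exists_frame (h.reduceFlag hi hc (v.flag c) (hX _ hv))
  obtain ⟨w, hw1, hw2⟩ := hP2 v'
  rw [hv', h.liftFlag_reduceFlag] at hw2
  obtain ⟨L, hL1, hL2⟩ := exists_linear_of_flag_eq hw2
  obtain ⟨ℓ, hℓ⟩ := exists_dual_functionals v'.linearIndependent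
  let q : (Fin m → E) →ₗ[K] (Fin i → E') := LinearMap.pi fun a =>
    pr ∘ₗ LinearMap.proj (⟨Module.finrank K N + a.val, by omega⟩ : Fin m) ∘ₗ L
  have hq : ∀ x (a : Fin i), q x a = pr (L x ⟨Module.finrank K N + a.val, by omega⟩) :=
    fun _ _ => rfl
  -- The determinant against functionals dual to v' is 1 at v, and where it is nonzero the projected
  -- vectors are independent.
  let D : (Fin m → E) → K := fun x => (Matrix.of fun a b => ℓ a (q x b)).det
  have hD : D ∈ polyFun K (Fin m → E) := by
    have : D = ∑ σ : Equiv.Perm (Fin i), (Equiv.Perm.sign σ : ℤ) •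
        ∏ a, fun x => ℓ (σ a) (q x a) := by
      funext x
      simp [D, Matrix.det_apply, Finset.sum_apply, Finset.prod_apply, Units.smul_def]
    rw [this]
    refine sum_mem fun σ _ => zsmul_mem (prod_mem fun a _ => ?_) _
    exact dual_mem_polyFun (ℓ (σ a) ∘ₗ LinearMap.proj a ∘ₗ q)
  refine ⟨q, fun f hf => polyFun_comp_linear q hf, D, hD, ?_, fun u hu hDu => ?_⟩
  · have : (Matrix.of fun a b => ℓ a (q v.vec b)) = 1 := by
      ext a b
      rw [Matrix.of_apply, hq, hL1, hw1, hP1, h.pr_sec, hℓ, Matrix.one_apply]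
      simp only [eq_comm]
    simp only [D, this, Matrix.det_one]
    exact one_ne_zero
  · obtain ⟨u', hu1, hu2⟩ := hL2 u
    have hN := hX _ hu
    have hli : LinearIndependent K (q u.vec) := by
      rw [Fintype.linearIndependent_iff]
      intro g hg a
      have h1 : (Matrix.of fun a b => ℓ a (q u.vec b)).mulVec g = 0 := by
        funext a
        have := congrArg (ℓ a) hg
        rw [map_sum, map_zero] at this
        rw [Pi.zero_apply, ← this]
        simp [Matrix.mulVec, dotProduct, mul_comm]
      exact congrFun (Matrix.eq_zero_of_mulVec_eq_zero hDu h1) a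
    have hmem : ∀ a, u'.vec a ∈ β.orthogonal N := by
      intro a
      refine h.space_le_orthogonal (u.flag c) hN (Fin.last _) ?_
      rw [← hu2, u'.flag_last_eq]
      exact Submodule.subset_span ⟨a, rfl⟩
    refine ⟨⟨q u.vec, hli, fun a a' => ?_⟩, rfl, ?_⟩
    · rw [hq, hq, ← hu1, h.form _ (hmem _) _ (hmem _), u'.isotropic]
    · ext1
      funext j
      refine Submodule.eq_of_le_of_finrank_eq ?_ ?_
      · refine Submodule.span_le.2 ?_
        rintro _ ⟨a, ha, rfl⟩
        have ha' : a.val < i - c.val + j.val := ha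
        refine ⟨u'.vec ⟨Module.finrank K N + a.val, by omega⟩, ?_, congrArg pr (congrFun hu1 _)⟩
        change _ ∈ (u.flag c).space j
        rw [← hu2]
        refine Submodule.subset_span ⟨_, ?_, rfl⟩
        have h1 := c.isLt
        have h2 := j.isLt
        simp only [Set.mem_ofPred_eq]
        simp only at h2
        omega
      · rw [IsotropicFlag.finrank_space, IsotropicFlag.finrank_space]

end IsReduction

end Reduction

/-! ### The quotient W^⊥/W -/

section PerpQuot

variable {p : ℕ} [Fact p.Prime] {V : Type*} [AddCommGroup V] [Module (ZMod p) V]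
  {B : LinearMap.BilinForm (ZMod p) V} (hB : B.IsAlt) {W : Submodule (ZMod p) V}

theorem isIsotropic_iff_le_orthogonal : IsIsotropic B W ↔ W ≤ B.orthogonal W :=
  ⟨fun h x hx y hy => h y hy x hx, fun h x hx y hy => h hy x hx⟩

theorem perpQuotForm_isAlt : (perpQuotForm B hB W).IsAlt := by
  intro x
  obtain ⟨x, rfl⟩ := Submodule.mkQ_surjective _ x
  exact hB x.1

theorem exists_isReduction [Module.Finite (ZMod p) V] (hW : IsIsotropic B W) :
    ∃ (pr : V →ₗ[ZMod p] PerpQuot B W) (sec : PerpQuot B W →ₗ[ZMod p] V),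
      IsReduction B W (perpQuotForm B hB W) pr sec := by
  obtain ⟨pr, hpr⟩ := LinearMap.exists_extend (Submodule.mkQ (W.submoduleOf (B.orthogonal W)))
  obtain ⟨s, hs⟩ := LinearMap.exists_rightInverse_of_surjective
    (Submodule.mkQ (W.submoduleOf (B.orthogonal W)))
    (LinearMap.range_eq_top.2 (Submodule.mkQ_surjective _))
  have hpr' : ∀ x (hx : x ∈ B.orthogonal W),
      pr x = Submodule.mkQ (W.submoduleOf (B.orthogonal W)) ⟨x, hx⟩ := fun x hx =>
    LinearMap.congr_fun hpr ⟨x, hx⟩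
  have hs' : ∀ y, pr (s y) = y := fun y =>
    (hpr' _ (s y).2).trans (LinearMap.congr_fun hs y)
  have hle := isIsotropic_iff_le_orthogonal.1 hW
  refine ⟨pr, (B.orthogonal W).subtype ∘ₗ s, hle, fun y => (s y).2, hs', fun x hx => ?_,
    fun x hx => ?_, fun x hx y hy => ?_⟩
  · have hmem : x - s (pr x) ∈ B.orthogonal W := Submodule.sub_mem _ hx (s (pr x)).2
    have h1 : pr (x - s (pr x)) = 0 := by rw [map_sub, hs', sub_self]
    rw [hpr' _ hmem, Submodule.mkQ_apply, Submodule.Quotient.mk_eq_zero] at h1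
    exact h1
  · rw [hpr' x (hle hx), Submodule.mkQ_apply, Submodule.Quotient.mk_eq_zero]
    exact hx
  · rw [hpr' x hx, hpr' y hy]
    rfl

variable {V' : Type*} [AddCommGroup V'] [Module (ZMod p) V']
  {B' : LinearMap.BilinForm (ZMod p) V'} {pr : V →ₗ[ZMod p] V'} {sec : V' →ₗ[ZMod p] V}

include hB in
theorem IsReduction.nondegenerate [Module.Finite (ZMod p) V] (h : IsReduction B W B' pr sec)
    (hB' : B.Nondegenerate) (halt : B'.IsAlt) : B'.Nondegenerate := by
  have h1 : B'.SeparatingLeft := by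
    intro y hy
    have h2 : sec y ∈ B.orthogonal (B.orthogonal W) := by
      intro x hx
      change B x (sec y) = 0
      rw [← h.form x hx _ (h.sec_mem y), h.pr_sec, ← halt.neg_eq, hy, neg_zero]
    rw [LinearMap.BilinForm.orthogonal_orthogonal hB' hB.isRefl] at h2
    rw [← h.pr_sec y, h.pr_mem _ h2]
  exact ⟨h1, fun x hx => h1 x fun y => by rw [← halt.neg_eq, hx y, neg_zero]⟩

include hB in
theorem IsReduction.baseChange {k : Type*} [Field k] [Algebra (ZMod p) k]
    (h : IsReduction B W B' pr sec) (hB' : B.Nondegenerate) {m : ℕ}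
    {e : Module.Basis (Fin (2 * m)) (ZMod p) V} (he : IsSymplecticBasis B e) :
    IsReduction (B.baseChange k) (W.baseChange k) (B'.baseChange k) (pr.baseChange k)
      (sec.baseChange k) := by
  have horth := baseChange_orthogonal (k := k) hB hB' he W
  constructor
  · rw [← horth]
    exact Submodule.baseChange_mono k h.le_orthogonal
  · intro y
    rw [← horth]
    induction y with
    | zero => rw [map_zero]; exact Submodule.zero_mem _
    | tmul c y => exact Submodule.tmul_mem_baseChange_of_mem _ (h.sec_mem y)
    | add y z hy hz => rw [map_add]; exact Submodule.add_mem _ hy hz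
  · intro y
    induction y with
    | zero => simp
    | tmul c y => rw [LinearMap.baseChange_tmul, LinearMap.baseChange_tmul, h.pr_sec]
    | add y z hy hz => rw [map_add, map_add, hy, hz]
  · rw [← horth]
    rintro _ ⟨x, rfl⟩
    induction x with
    | zero => simp
    | tmul c x =>
      rw [LinearMap.baseChange_tmul, LinearMap.baseChange_tmul, LinearMap.baseChange_tmul,
        ← TensorProduct.tmul_sub]
      exact Submodule.tmul_mem_baseChange_of_mem _ (h.sub_mem x.1 x.2)
    | add x y hx hy =>
      rw [map_add, map_add, map_add, add_sub_add_comm]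
      exact Submodule.add_mem _ hx hy
  · rintro _ ⟨x, rfl⟩
    induction x with
    | zero => simp
    | tmul c x =>
      rw [LinearMap.baseChange_tmul, LinearMap.baseChange_tmul]
      have := h.pr_mem x.1 x.2
      simp [this]
    | add x y hx hy => rw [map_add, map_add, hx, hy, add_zero]
  · rw [← horth]
    rintro _ ⟨x, rfl⟩ _ ⟨y, rfl⟩
    induction x with
    | zero => simp
    | tmul c x =>
      induction y with
      | zero => simp
      | tmul d y =>
        simp only [LinearMap.baseChange_tmul, LinearMap.BilinForm.baseChange_tmul]
        exact congrArg (· • (c * d)) (h.form x.1 x.2 y.1 y.2)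
      | add y z hy hz => rw [map_add, map_add, map_add, hy, hz, map_add]
    | add x y hx hy =>
      rw [map_add, map_add, map_add, LinearMap.add_apply, hx, hy, map_add, LinearMap.add_apply]

/-- Both W and the section are defined over 𝔽_p, so they commute with Frobenius. -/
theorem frobSpace_liftSpace {k : Type*} [Field k] [Algebra (ZMod p) k]
    (D : Submodule k (k ⊗[ZMod p] V')) :
    frobSpace (liftSpace (W.baseChange k) (sec.baseChange k) D) =
      liftSpace (W.baseChange k) (sec.baseChange k) (frobSpace D) := by
  have h1 : ∀ A C : Submodule k (k ⊗[ZMod p] V), frobSpace (A ⊔ C) = frobSpace A ⊔ frobSpace C := by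
    intro A C
    rw [← Submodule.span_eq A, ← Submodule.span_eq C, ← Submodule.span_union, frobSpace_span,
      frobSpace_span, frobSpace_span, Set.image_union, Submodule.span_union]
  rw [liftSpace, h1, frobSpace_baseChange, liftSpace, frobSpace, frobSpace, Submodule.map_span,
    Submodule.map_coe, ← Set.image_comp, ← Set.image_comp]
  congr 3
  funext x
  exact frob_baseChange sec x

end PerpQuot

/-! ### Symplectic bases adapted to an isotropic subspace -/

section SymplecticBasis

variable {p : ℕ} [Fact p.Prime] {V : Type*} [AddCommGroup V] [Module (ZMod p) V]
  {B : LinearMap.BilinForm (ZMod p) V} (hB : B.IsAlt) (hB' : B.Nondegenerate)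

include hB hB' in
theorem exists_isSymplecticBasis [Module.Finite (ZMod p) V] {m : ℕ}
    (hdim : Module.finrank (ZMod p) V = 2 * m) (D : Submodule (ZMod p) V)
    (hD : D ≤ B.orthogonal D) :
    ∃ e : Module.Basis (Fin (2 * m)) (ZMod p) V, IsSymplecticBasis B e ∧
      (∀ a : Fin m, B (e (idx a)) (e (idx a).rev) = 1) ∧
      D ≤ Submodule.span (ZMod p) (Set.range fun a : Fin m => e (idx a)) := by
  let ε : Fin (2 * m) → ZMod p := fun a => if a.val < m then 1 else -1
  obtain ⟨e, he, hDe⟩ := exists_hyperbolic_basis hB hB' hdim ε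
    (fun a => by simp only [ε]; split_ifs <;> simp) (fun a => by
      have := a.isLt
      simp only [ε, Fin.val_rev]
      split_ifs <;> first | omega | simp) D hD
  refine ⟨e, fun a b => ⟨fun hab => ?_, fun hab => ?_⟩, fun a => ?_, hDe⟩
  · rw [he a b, if_pos hab]
    simp only [ε]
    split_ifs <;> simp
  · rw [he a b, if_neg hab]
  · rw [he, if_pos rfl]
    exact if_pos a.isLt

include hB hB' in
theorem exists_isSymplecticBasis_perpQuot {m : ℕ} (e : Module.Basis (Fin (2 * m)) (ZMod p) V)
    {i : ℕ} (hi : i ≤ m) {W : Submodule (ZMod p) V} (hW : IsIsotropic B W)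
    (hdim : Module.finrank (ZMod p) W = m - i) :
    ∃ e' : Module.Basis (Fin (2 * i)) (ZMod p) (PerpQuot B W),
      IsSymplecticBasis (perpQuotForm B hB W) e' := by
  have : Module.Finite (ZMod p) V := Module.Finite.of_basis e
  obtain ⟨pr, sec, h⟩ := exists_isReduction hB hW
  have h1 : Module.finrank (ZMod p) (PerpQuot B W) = 2 * i := by
    have h2 := h.finrank_liftSpace ⊤
    have h3 : liftSpace W sec ⊤ = B.orthogonal W := by
      refine le_antisymm (h.liftSpace_le _) fun x hx => ?_
      exact (h.mem_liftSpace_iff hx).2 trivial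
    rw [h3, LinearMap.BilinForm.finrank_orthogonal hB', finrank_top,
      Module.finrank_eq_card_basis e, Fintype.card_fin, hdim] at h2
    omega
  obtain ⟨e', he', -⟩ := exists_isSymplecticBasis (perpQuotForm_isAlt hB)
    (h.nondegenerate hB hB' (perpQuotForm_isAlt hB)) h1 ⊥ bot_le
  exact ⟨e', he'⟩

end SymplecticBasis

/-! ### Transport of X_W and of S_V to W^⊥/W -/

section Components

variable {p : ℕ} [Fact p.Prime] {k : Type*} [Field k] [Algebra (ZMod p) k] [IsAlgClosed k]
  {V : Type*} [AddCommGroup V] [Module (ZMod p) V] {B : LinearMap.BilinForm (ZMod p) V}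
  {m : ℕ} {e : Module.Basis (Fin (2 * m)) (ZMod p) V} {i : Fin (m + 1)}
  {W : Submodule (ZMod p) V}
  {V' : Type*} [AddCommGroup V'] [Module (ZMod p) V'] {B' : LinearMap.BilinForm (ZMod p) V'}
  {pr : V →ₗ[ZMod p] V'} {sec : V' →ₗ[ZMod p] V}
  {e' : Module.Basis (Fin (2 * i.val)) (ZMod p) V'}

omit [IsAlgClosed k] in
theorem le_of_mem_component {F : IsotropicFlag (B.baseChange k) m i}
    (hF : F ∈ component k B e i W) : W.baseChange k ≤ F.space 0 := hF.2.ge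

variable [Module.Finite (ZMod p) V'] [Module.Finite (ZMod p) V]

/-- The incidences involve only inclusion and Frobenius, both of which the lift from W^⊥/W preserves
and reflects; the zero member at the bottom lifts to W ⊗ k. -/
theorem liftFlag_mem_component_iff (hB : B.IsAlt)
    (he : IsSymplecticBasis B e)
    (hBV' : B'.IsAlt) (he' : IsSymplecticBasis B' e')
    (h : IsReduction (B.baseChange k) (W.baseChange k) (B'.baseChange k) (pr.baseChange k)
      (sec.baseChange k)) (hi : Module.finrank k (W.baseChange k) + i.val = m)
    (F : IsotropicFlag (B'.baseChange k) i.val (Fin.last i.val)) :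
    h.liftFlag hi (Nat.lt_succ_self i.val) F ∈ component k B e i W ↔
      F ∈ coxeterDLVariety k B' e' := by
  have hbot : F.space 0 = ⊥ := by
    rw [← Submodule.finrank_eq_zero (R := k), F.finrank_space]
    simp
  have h0 : (h.liftFlag hi (Nat.lt_succ_self i.val) F).space 0 = W.baseChange k := by
    change liftSpace _ _ (F.space 0) = _
    rw [hbot, liftSpace, Submodule.map_bot, sup_bot_eq]
  have h1 : F ∈ coxeterDLVariety k B' e' ↔ IsCoxeterFlag F.space :=
    mem_stratum_iff (i := Fin.last i.val) hBV' he'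
  rw [h1, component, Set.mem_ofPred_eq, mem_stratum_iff hB he, and_iff_left h0]
  constructor
  · rintro ⟨-, h2, h3⟩
    refine ⟨by rw [hbot]; simp [frobSpace], fun j hj => ?_, fun j hj hj' => h3 j hj ?_⟩
    · have := h2 j hj
      change liftSpace _ _ (F.space _) ≤ frobSpace (liftSpace _ _ (F.space _)) at this
      rwa [frobSpace_liftSpace, h.liftSpace_le_iff] at this
    · change liftSpace _ _ (F.space _) = frobSpace (liftSpace _ _ (F.space _))
      rw [frobSpace_liftSpace]
      exact congrArg _ hj'
  · rintro ⟨-, h2, h3⟩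
    refine ⟨by rw [h0, frobSpace_baseChange], fun j hj => ?_, fun j hj hj' => h3 j hj ?_⟩
    · change liftSpace _ _ (F.space _) ≤ frobSpace (liftSpace _ _ (F.space _))
      rw [frobSpace_liftSpace, h.liftSpace_le_iff]
      exact h2 j hj
    · change liftSpace _ _ (F.space _) = frobSpace (liftSpace _ _ (F.space _)) at hj'
      rw [frobSpace_liftSpace] at hj'
      exact h.liftSpace_injective hj'

/-- The Lagrangian subspaces in `S_V` that contain `W`. -/
def lagrangianVarietyOver (k : Type*) [Field k] [Algebra (ZMod p) k]
    (B : LinearMap.BilinForm (ZMod p) V) (m : ℕ) (W : Submodule (ZMod p) V) :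
    Set (IsotropicFlag (B.baseChange k) m 0) :=
  {U | U ∈ lagrangianVariety k B m ∧ W.baseChange k ≤ U.space 0}

omit [IsAlgClosed k] in
-- The lift commutes with intersections and Frobenius, and adds dim W to both sides of the
-- inequality.
theorem liftFlag_mem_lagrangianVarietyOver_iff
    (h : IsReduction (B.baseChange k) (W.baseChange k) (B'.baseChange k) (pr.baseChange k)
      (sec.baseChange k)) {l : ℕ} (hi : Module.finrank k (W.baseChange k) + l = m)
    (F : IsotropicFlag (B'.baseChange k) l 0) :
    h.liftFlag (c := 0) hi (Nat.succ_pos l) F ∈ lagrangianVarietyOver k B m W ↔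
      F ∈ lagrangianVariety k B' l := by
  refine (and_iff_left (h.le_liftFlag (c := 0) hi (Nat.succ_pos l) F)).trans ?_
  change m ≤ Module.finrank k ↥(liftSpace _ _ (F.space 0) ⊓ frobSpace (liftSpace _ _ (F.space 0))) + 1
    ↔ l ≤ Module.finrank k ↥(F.space 0 ⊓ frobSpace (F.space 0)) + 1
  rw [frobSpace_liftSpace, ← h.liftSpace_inf, h.finrank_liftSpace]
  omega

end Components

/-! ### Frobenius twists of a point of the cone -/

section Cone

variable {p : ℕ} [Fact p.Prime] {k : Type*} [Field k] [Algebra (ZMod p) k] {n : ℕ}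

/-- The standard alternating form as a bilinear form. -/
def stdBilin (k : Type*) [Field k] (n : ℕ) : LinearMap.BilinForm k (Fin n ⊕ Fin n → k) :=
  LinearMap.mk₂ k stdForm stdForm_add_left
    (fun c x y => by
      simp only [stdForm, Pi.smul_apply, smul_eq_mul, Finset.mul_sum]
      exact Finset.sum_congr rfl fun i _ => by ring)
    stdForm_add_right
    (fun c x y => by
      simp only [stdForm, Pi.smul_apply, smul_eq_mul, Finset.mul_sum]
      exact Finset.sum_congr rfl fun i _ => by ring)

theorem stdBilin_apply (x y : Fin n ⊕ Fin n → k) : stdBilin k n x y = stdForm x y := rfl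

theorem stdBilin_isAlt : (stdBilin k n).IsAlt := stdForm_self

theorem stdBilin_nondegenerate : (stdBilin k n).Nondegenerate := by
  have h : (stdBilin k n).SeparatingLeft := by
    intro x hx
    funext s
    rcases s with a | a
    · have := hx (Pi.single (Sum.inr a) 1)
      simpa [stdBilin_apply, stdForm, Pi.single_apply] using this
    · have := hx (Pi.single (Sum.inl a) 1)
      simpa [stdBilin_apply, stdForm, Pi.single_apply] using this
  exact ⟨h, fun x hx => h x fun y => by rw [← stdBilin_isAlt.neg_eq, hx y, neg_zero]⟩

theorem stdForm_twist (x : Fin n ⊕ Fin n → k) (b j : ℕ) :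
    stdForm (fun s => x s ^ p ^ b) (fun s => x s ^ p ^ (b + j)) = frobPairing p x j ^ p ^ b := by
  have := charP_of_algebra p k
  have h := map_stdForm (iterateFrobenius k p b) x fun s => x s ^ p ^ j
  simp only [iterateFrobenius_def, ← pow_mul, ← pow_add] at h
  rw [frobPairing, h, add_comm b j]

/-- Pairing a relation with Φ^{a+N} x kills every term Φ^b x with a < b < N and leaves c_a times a
nonzero power. The terms with b < a are gone by induction. -/
theorem linearIndependent_twist {N : ℕ} {x : Fin n ⊕ Fin n → k}
    (h0 : ∀ j, 1 ≤ j → j < N → frobPairing p x j = 0) (hN : frobPairing p x N ≠ 0) :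
    LinearIndependent k fun (a : Fin N) s => x s ^ p ^ a.val := by
  rw [Fintype.linearIndependent_iff]
  intro c hc a
  induction a using WellFoundedLT.induction with
  | ind a ih =>
  have h1 : stdBilin k n (∑ b, c b • fun s => x s ^ p ^ b.val) (fun s => x s ^ p ^ (a.val + N)) =
      c a * frobPairing p x N ^ p ^ a.val := by
    rw [map_sum, LinearMap.sum_apply, Finset.sum_eq_single a]
    · rw [map_smul, LinearMap.smul_apply, stdBilin_apply, stdForm_twist, smul_eq_mul]
    · intro b _ hb
      rw [map_smul, LinearMap.smul_apply, stdBilin_apply, smul_eq_mul]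
      rcases lt_or_gt_of_ne hb with h | h
      · rw [ih b h, zero_mul]
      · have hb := b.isLt
        have h' : a.val < b.val := h
        have h2 := stdForm_twist (p := p) x b.val (a.val + N - b.val)
        rw [show b.val + (a.val + N - b.val) = a.val + N by omega,
          h0 _ (by omega) (by omega), zero_pow (pow_ne_zero _ (Fact.out : p.Prime).ne_zero)] at h2
        rw [h2, mul_zero]
    · simp
  rw [hc, map_zero, LinearMap.zero_apply] at h1
  exact (mul_eq_zero.1 h1.symm).resolve_right (pow_ne_zero _ hN)

theorem stdForm_twist_eq_zero {N : ℕ} {x : Fin n ⊕ Fin n → k}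
    (h0 : ∀ j, 1 ≤ j → j < N → frobPairing p x j = 0) {a b : ℕ} (ha : a < N) (hb : b < N) :
    stdForm (fun s => x s ^ p ^ a) (fun s => x s ^ p ^ b) = 0 := by
  have hp := (Fact.out : p.Prime).ne_zero
  rcases lt_trichotomy a b with h | rfl | h
  · rw [← Nat.add_sub_cancel' h.le, stdForm_twist, h0 _ (by omega) (by omega),
      zero_pow (pow_ne_zero _ hp)]
  · exact stdForm_self _
  · rw [stdForm_neg_swap, ← Nat.add_sub_cancel' h.le, stdForm_twist, h0 _ (by omega) (by omega),
      zero_pow (pow_ne_zero _ hp), neg_zero]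

/-- If this coordinate vanished, its hyperbolic pair would contribute nothing to any pairing. Then
the remaining 2n coordinates would carry n + 1 independent twists spanning an isotropic subspace,
which is too large. -/
theorem IsCone.ne_zero (n : ℕ) (u : Fin (n + 1) ⊕ Fin (n + 1) → k) (hu : IsCone p u) :
    u (Sum.inr 0) ≠ 0 := by
  intro h
  have hp := (Fact.out : p.Prime).ne_zero
  let x : Fin n ⊕ Fin n → k := Sum.elim (fun a => u (Sum.inl a.succ)) fun a => u (Sum.inr a.succ)
  have hx : ∀ j, frobPairing p u j = frobPairing p x j := by
    intro j
    simp [frobPairing, stdForm, Fin.sum_univ_succ, h, x, hp]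
  obtain ⟨hu1, hu2⟩ := hu
  simp only [hx] at hu1 hu2
  have hli := linearIndependent_twist hu1 hu2
  have hiso : Submodule.span k (Set.range fun (a : Fin (n + 1)) s => x s ^ p ^ a.val) ≤
      (stdBilin k n).orthogonal (Submodule.span k (Set.range fun (a : Fin (n + 1)) s =>
        x s ^ p ^ a.val)) := by
    intro y hy z hz
    change stdBilin k n z y = 0
    induction hz using Submodule.span_induction with
    | zero => simp
    | add z w _ _ hz hw => rw [map_add, LinearMap.add_apply, hz, hw, add_zero]
    | smul c z _ hz => rw [map_smul, LinearMap.smul_apply, hz, smul_zero]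
    | mem z hz =>
      obtain ⟨a, rfl⟩ := hz
      induction hy using Submodule.span_induction with
      | zero => simp
      | add z w _ _ hz hw => rw [map_add, hz, hw, add_zero]
      | smul c z _ hz => rw [map_smul, hz, smul_zero]
      | mem z hz =>
        obtain ⟨b, rfl⟩ := hz
        exact stdForm_twist_eq_zero hu1 a.isLt b.isLt
  have h1 := two_mul_finrank_le stdBilin_nondegenerate hiso
  rw [finrank_span_eq_card hli] at h1
  simp at h1
  omega

end Cone

/-! ### Bases in which the form is standard -/

section StandardBasis

variable {p : ℕ} [Fact p.Prime] {V : Type*} [AddCommGroup V] [Module (ZMod p) V]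
  {B : LinearMap.BilinForm (ZMod p) V}

/-- Bases of symplectic spaces in which the form is the standard alternating form. -/
def IsStdBasis {n : ℕ} (B : LinearMap.BilinForm (ZMod p) V)
    (c : Module.Basis (Fin n ⊕ Fin n) (ZMod p) V) : Prop :=
  (∀ a b, B (c (Sum.inl a)) (c (Sum.inl b)) = 0) ∧ (∀ a b, B (c (Sum.inr a)) (c (Sum.inr b)) = 0) ∧
    ∀ a b, B (c (Sum.inl a)) (c (Sum.inr b)) = if a = b then 1 else 0

theorem exists_isStdBasis [Module.Finite (ZMod p) V] (hB : B.IsAlt) (hB' : B.Nondegenerate) {n : ℕ}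
    (hdim : Module.finrank (ZMod p) V = 2 * n) (D : Submodule (ZMod p) V)
    (hD : D ≤ B.orthogonal D) : ∃ c : Module.Basis (Fin n ⊕ Fin n) (ZMod p) V, IsStdBasis B c ∧
      D ≤ Submodule.span (ZMod p) (Set.range fun a : Fin n => c (Sum.inl a)) := by
  obtain ⟨e, he, he1, hDe⟩ := exists_isSymplecticBasis hB hB' hdim D hD
  let f : Fin n ⊕ Fin n → Fin (2 * n) := Sum.elim (fun a => idx a) fun a => (idx a).rev
  have hne : ∀ a b : Fin n, idx a ≠ (idx b).rev := by
    intro a b hab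
    have := congrArg Fin.val hab
    simp only [idx, Fin.val_rev] at this
    omega
  have hinj : ∀ a b : Fin n, idx a = idx b ↔ a = b := by
    intro a b
    simp [idx, Fin.ext_iff]
  have hf : Function.Bijective f := by
    rw [Fintype.bijective_iff_injective_and_card]
    refine ⟨?_, by simp; omega⟩
    rintro (a | a) (b | b) hab
    · exact congrArg _ ((hinj a b).1 hab)
    · exact absurd hab (hne a b)
    · exact absurd hab.symm (hne b a)
    · exact congrArg _ ((hinj a b).1 (Fin.rev_injective hab))
  let c := e.reindex (Equiv.ofBijective f hf).symm
  have hc1 : ∀ a, c (Sum.inl a) = e (idx a) := fun a => by simp [c, f]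
  have hc2 : ∀ a, c (Sum.inr a) = e (idx a).rev := fun a => by simp [c, f]
  refine ⟨c, ⟨fun a b => ?_, fun a b => ?_, fun a b => ?_⟩, ?_⟩
  · rw [hc1, hc1, ← Fin.rev_rev (idx b)]
    exact (he _ _).2 (hne a b)
  · rw [hc2, hc2]
    exact (he _ _).2 (hne b a).symm
  · rw [hc1, hc2]
    split_ifs with hab
    · rw [hab, he1]
    · exact (he _ _).2 fun h => hab ((hinj a b).1 h)
  · simpa only [hc1] using hDe

theorem IsStdBasis.baseChange_apply {k : Type*} [Field k] [Algebra (ZMod p) k] (hB : B.IsAlt)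
    {n : ℕ} {c : Module.Basis (Fin n ⊕ Fin n) (ZMod p) V} (hc : IsStdBasis B c)
    (x y : k ⊗[ZMod p] V) : B.baseChange k x y =
      stdForm (fun s => (c.baseChange k).repr x s) fun s => (c.baseChange k).repr y s := by
  have h : B.baseChange k = (stdBilin k n).compl₁₂ (c.baseChange k).equivFun.toLinearMap
      (c.baseChange k).equivFun.toLinearMap := by
    obtain ⟨h1, h2, h3⟩ := hc
    have h4 : ∀ a b, B (c (Sum.inr a)) (c (Sum.inl b)) = if a = b then -1 else 0 := by
      intro a b
      rw [← hB.neg_eq, h3]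
      by_cases h : a = b <;> simp [h, eq_comm]
    refine (c.baseChange k).ext fun s => (c.baseChange k).ext fun t => ?_
    rcases s with a | a <;> rcases t with b | b <;>
    · simp [stdBilin_apply, stdForm, h1, h2, h3, h4, Finsupp.single_apply]
      try split_ifs <;> simp_all
  rw [h]
  rfl

end StandardBasis

/-! ### Spans of Frobenius twists -/

section Twists

variable {p : ℕ} [Fact p.Prime] {k : Type*} [Field k] [Algebra (ZMod p) k]
  {V : Type*} [AddCommGroup V] [Module (ZMod p) V] {B : LinearMap.BilinForm (ZMod p) V}
  {n : ℕ} (c : Module.Basis (Fin n ⊕ Fin n) (ZMod p) V)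

/-- The `a`-th Frobenius twist of the vector with coordinates `x`. -/
def twist (x : Fin n ⊕ Fin n → k) (a : ℕ) : k ⊗[ZMod p] V :=
  (c.baseChange k).equivFun.symm fun s => x s ^ p ^ a

/-- The span of a range of Frobenius twists. -/
def twistSpan (x : Fin n ⊕ Fin n → k) (a b : ℕ) : Submodule k (k ⊗[ZMod p] V) :=
  Submodule.span k (twist c x '' Set.Ico a b)

theorem repr_twist (x : Fin n ⊕ Fin n → k) (a : ℕ) (s : Fin n ⊕ Fin n) :
    (c.baseChange k).repr (twist c x a) s = x s ^ p ^ a := by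
  rw [← Module.Basis.equivFun_apply, twist, LinearEquiv.apply_symm_apply]

theorem ext_repr {y z : k ⊗[ZMod p] V}
    (h : ∀ s, (c.baseChange k).repr y s = (c.baseChange k).repr z s) : y = z :=
  (c.baseChange k).repr.injective (Finsupp.ext h)

theorem frob_twist (x : Fin n ⊕ Fin n → k) (a : ℕ) :
    frob k V (twist c x a) = twist c x (a + 1) :=
  ext_repr c fun s => by rw [repr_frob, repr_twist, repr_twist, ← pow_mul, pow_succ]

theorem twist_smul (t : k) (x : Fin n ⊕ Fin n → k) (a : ℕ) :
    twist c (fun s => t * x s) a = t ^ p ^ a • twist c x a :=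
  ext_repr c fun s => by
    rw [map_smul, Finsupp.smul_apply, repr_twist, repr_twist, mul_pow, smul_eq_mul]

theorem twist_mem_twistSpan (x : Fin n ⊕ Fin n → k) {a b l : ℕ} (h1 : a ≤ l) (h2 : l < b) :
    twist c x l ∈ twistSpan c x a b :=
  Submodule.subset_span ⟨l, ⟨h1, h2⟩, rfl⟩

theorem twistSpan_mono (x : Fin n ⊕ Fin n → k) {a b a' b' : ℕ} (h1 : a' ≤ a) (h2 : b ≤ b') :
    twistSpan c x a b ≤ twistSpan c x a' b' :=
  Submodule.span_mono (Set.image_mono (Set.Ico_subset_Ico h1 h2))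

theorem twistSpan_le {x : Fin n ⊕ Fin n → k} {a b : ℕ} {D : Submodule k (k ⊗[ZMod p] V)}
    (h : ∀ l, a ≤ l → l < b → twist c x l ∈ D) : twistSpan c x a b ≤ D := by
  refine Submodule.span_le.2 ?_
  rintro _ ⟨l, hl, rfl⟩
  exact h l hl.1 hl.2

theorem frobSpace_twistSpan (x : Fin n ⊕ Fin n → k) (a b : ℕ) :
    frobSpace (twistSpan c x a b) = twistSpan c x (a + 1) (b + 1) := by
  rw [twistSpan, frobSpace_span, ← Set.image_comp, twistSpan]
  congr 1
  ext y
  constructor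
  · rintro ⟨l, hl, rfl⟩
    exact ⟨l + 1, ⟨Nat.succ_le_succ hl.1, Nat.succ_lt_succ hl.2⟩, (frob_twist c x l).symm⟩
  · rintro ⟨l, hl, rfl⟩
    obtain ⟨h1, h2⟩ := hl
    refine ⟨l - 1, ⟨by omega, by omega⟩, ?_⟩
    rw [Function.comp_apply, frob_twist, Nat.sub_add_cancel (by omega)]

variable {c} (hB : B.IsAlt) (hc : IsStdBasis B c)

include hB hc in
theorem form_twist (x : Fin n ⊕ Fin n → k) (a b : ℕ) :
    B.baseChange k (twist c x a) (twist c x b) =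
      stdForm (fun s => x s ^ p ^ a) fun s => x s ^ p ^ b := by
  rw [hc.baseChange_apply hB]
  simp only [repr_twist]

include hB hc in
theorem form_twist_zero (x : Fin n ⊕ Fin n → k) (j : ℕ) :
    B.baseChange k (twist c x 0) (twist c x j) = frobPairing p x j := by
  rw [form_twist hB hc, frobPairing]
  simp

end Twists

/-! ### Subspaces comparable with their Frobenius translate -/

section FrobeniusStable

variable {p : ℕ} [Fact p.Prime] {k : Type*} [Field k] [Algebra (ZMod p) k] [IsAlgClosed k]
  {V : Type*} [AddCommGroup V] [Module (ZMod p) V] [Module.Finite (ZMod p) V]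
  {D D' : Submodule k (k ⊗[ZMod p] V)}

omit [IsAlgClosed k] in
theorem eq_of_le_of_finrank_le' (h : D ≤ D') (h' : Module.finrank k D' ≤ Module.finrank k D) :
    D = D' :=
  Submodule.eq_of_le_of_finrank_le h h'

theorem eq_frobSpace_of_le (h : D ≤ frobSpace D) : D = frobSpace D :=
  eq_of_le_of_finrank_le' h (finrank_frobSpace D).le

theorem eq_frobSpace_of_ge (h : frobSpace D ≤ D) : D = frobSpace D :=
  (eq_of_le_of_finrank_le' h (finrank_frobSpace D).ge).symm

end FrobeniusStable

/-! ### From the slice to the Coxeter variety -/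

section CoxeterVariety

universe u

variable {p : ℕ} [Fact p.Prime] {k : Type u} [Field k] [Algebra (ZMod p) k] [IsAlgClosed k]
  {V : Type*} [AddCommGroup V] [Module (ZMod p) V] {B : LinearMap.BilinForm (ZMod p) V}
  {n : ℕ} {e : Module.Basis (Fin (2 * (n + 1))) (ZMod p) V}
  {c : Module.Basis (Fin (n + 1) ⊕ Fin (n + 1)) (ZMod p) V}
  (hB : B.IsAlt) (he : IsSymplecticBasis B e) (hc : IsStdBasis B c)

omit [IsAlgClosed k] in
/-- The frame `Φ^n x, …, Φ x, x` of a point `x` of the slice. -/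
def coxeterFrame (s : Slice p k n) : IsotropicFrame (B.baseChange k) (n + 1) where
  vec a := twist c s.vec (n - a.val)
  linearIndependent := by
    have h1 := linearIndependent_twist (N := n + 1) s.cone.1 s.cone.2
    have h2 := (h1.map' (c.baseChange k).equivFun.symm.toLinearMap
      (LinearEquiv.ker _)).comp Fin.rev Fin.rev_injective
    have h3 : (fun a : Fin (n + 1) => twist c s.vec (n - a.val)) =
        ((c.baseChange k).equivFun.symm.toLinearMap ∘ fun (a : Fin (n + 1)) r =>
          s.vec r ^ p ^ a.val) ∘ Fin.rev := by
      funext a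
      rw [Function.comp_apply, Function.comp_apply, Fin.val_rev, Nat.add_sub_add_right]
      rfl
    rw [h3]
    exact h2
  isotropic a b := by
    rw [form_twist hB hc]
    exact stdForm_twist_eq_zero s.cone.1 (by omega) (by omega)

omit [IsAlgClosed k] in
theorem flag_space_eq_twistSpan (v : IsotropicFrame (B.baseChange k) (n + 1))
    (x : Fin (n + 1) ⊕ Fin (n + 1) → k) (hv : ∀ a, v.vec a = twist c x (n - a.val))
    (j : Fin (n + 1 + 1)) :
    (v.flag (Fin.last (n + 1))).space j = twistSpan c x (n + 1 - j.val) (n + 1) := by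
  have h1 : (v.flag (Fin.last (n + 1))).space j =
    Submodule.span k (v.vec '' {a | a.val < n + 1 - (n + 1) + j.val}) := rfl
  have hj := j.isLt
  rw [h1, twistSpan]
  congr 1
  ext y
  simp only [Set.mem_image, hv, Set.mem_ofPred_eq, Set.mem_Ico]
  constructor
  · rintro ⟨a, ha, rfl⟩
    exact ⟨n - a.val, ⟨by omega, by omega⟩, rfl⟩
  · rintro ⟨l, ⟨hl1, hl2⟩, rfl⟩
    refine ⟨⟨n - l, by omega⟩, by simp only; omega, ?_⟩
    simp only
    rw [Nat.sub_sub_self (by omega)]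

omit [IsAlgClosed k] in
theorem coxeterFrame_flag_space (s : Slice p k n) (j : Fin (n + 1 + 1)) :
    ((coxeterFrame hB hc s).flag (Fin.last (n + 1))).space j =
      twistSpan c s.vec (n + 1 - j.val) (n + 1) :=
  flag_space_eq_twistSpan _ _ (fun _ => rfl) j

include he in
theorem coxeterFrame_flag_mem (s : Slice p k n) :
    (coxeterFrame hB hc s).flag (Fin.last (n + 1)) ∈ coxeterDLVariety k B e := by
  refine (mem_stratum_iff (i := Fin.last (n + 1)) hB he).2 ⟨?_, fun j hj => ?_, fun j hj h => ?_⟩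
  · rw [coxeterFrame_flag_space, frobSpace_twistSpan]
    simp [twistSpan]
  · rw [coxeterFrame_flag_space, coxeterFrame_flag_space, frobSpace_twistSpan]
    exact twistSpan_mono _ _ (by simp only; omega) (by omega)
  · have hj0 : j.val ≠ 0 := fun h => hj (Fin.ext h)
    -- If F_j were Frobenius-stable it would contain Φ^{n+1} x. But F_j is orthogonal to x, against
    -- ⟨x, Φ^{n+1} x⟩ ≠ 0.
    have h1 : twist c s.vec (n + 1) ∈ twistSpan c s.vec (n + 1 - j.val) (n + 1) := by
      rw [← coxeterFrame_flag_space hB hc, h, coxeterFrame_flag_space, frobSpace_twistSpan]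
      exact twist_mem_twistSpan _ _ (by omega) (by omega)
    apply s.cone.2
    rw [← form_twist_zero hB hc]
    have h2 : twistSpan c s.vec (n + 1 - j.val) (n + 1) ≤
        LinearMap.ker (B.baseChange k (twist c s.vec 0)) := by
      refine twistSpan_le _ fun l _ hl => ?_
      rw [LinearMap.mem_ker, form_twist hB hc]
      exact stdForm_twist_eq_zero s.cone.1 (Nat.succ_pos n) hl
    exact h2 h1

omit [IsAlgClosed k] in
/-- The first vector of any frame of the flag of `x` is a multiple of `Φ^n x`. -/
theorem repr_vec_zero {s : Slice p k n} {u : IsotropicFrame (B.baseChange k) (n + 1)}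
    (hu : u.flag (Fin.last (n + 1)) = (coxeterFrame hB hc s).flag (Fin.last (n + 1))) :
    (c.baseChange k).repr (u.vec 0) (Sum.inr 0) ≠ 0 ∧ ∀ r, (c.baseChange k).repr (u.vec 0) r =
      (c.baseChange k).repr (u.vec 0) (Sum.inr 0) * s.vec r ^ p ^ n := by
  have h1 : u.vec 0 ∈ (u.flag (Fin.last (n + 1))).space 1 := by
    refine Submodule.subset_span ⟨0, ?_, rfl⟩
    change 0 < n + 1 - (n + 1) + (1 : Fin (n + 1 + 1)).val
    simp
  rw [hu, coxeterFrame_flag_space] at h1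
  have h2 : twistSpan c s.vec (n + 1 - (1 : Fin (n + 1 + 1)).val) (n + 1) ≤
      Submodule.span k {twist c s.vec n} := by
    refine twistSpan_le _ fun l hl1 hl2 => ?_
    have h3 : (1 : Fin (n + 1 + 1)).val = 1 := by simp
    have h4 : l = n := by omega
    rw [h4]
    exact Submodule.mem_span_singleton_self _
  obtain ⟨t, ht⟩ := Submodule.mem_span_singleton.1 (h2 h1)
  have h3 : ∀ r, (c.baseChange k).repr (u.vec 0) r = t * s.vec r ^ p ^ n := by
    intro r
    rw [← ht, map_smul, Finsupp.smul_apply, repr_twist, smul_eq_mul]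
  have h4 : (c.baseChange k).repr (u.vec 0) (Sum.inr 0) = t := by
    rw [h3, s.one, one_pow, mul_one]
  rw [h4]
  refine ⟨?_, h3⟩
  rintro rfl
  rw [zero_smul] at ht
  exact u.linearIndependent.ne_zero 0 ht.symm

omit [IsAlgClosed k] in
-- The first line of the flag is spanned by Φ^n x. The normalized coordinate fixes the scalar, and
-- the iterated Frobenius of k is injective.
theorem coxeterFrame_flag_injective (s t : Slice p k n)
    (h : (coxeterFrame hB hc s).flag (Fin.last (n + 1)) =
      (coxeterFrame hB hc t).flag (Fin.last (n + 1))) : s = t := by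
  obtain ⟨h1, h2⟩ := repr_vec_zero hB hc h
  obtain ⟨-, h3⟩ := repr_vec_zero hB hc (u := coxeterFrame hB hc s) rfl
  have := charP_of_algebra p k
  have h4 : s.vec = t.vec := by
    funext r
    have h5 := mul_left_cancel₀ h1 ((h3 r).symm.trans (h2 r))
    exact iterateFrobenius_inj k p n (by simpa [iterateFrobenius_def] using h5)
  cases s
  cases t
  simpa using h4

/-- The line G_1 is generated by some Φ^n x, since k has p^n-th roots. Once Φ^{n+1-j} x lies in G_j,
the inclusion G_j ⊆ Φ G_{j+1} puts Φ^{n-j} x into G_{j+1}, and comparing dimensions shows that it is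
the vector that was missing. -/
theorem exists_twistSpan_eq [Module.Finite (ZMod p) V] (G : ℕ → Submodule k (k ⊗[ZMod p] V))
    (hfr : ∀ j ≤ n + 1, Module.finrank k (G j) = j) (hmono : ∀ j ≤ n, G j ≤ G (j + 1))
    (hle : ∀ j ≤ n, G j ≤ frobSpace (G (j + 1)))
    (hne : ∀ j, 1 ≤ j → j ≤ n + 1 → G j ≠ frobSpace (G j)) :
    ∃ x, ∀ j, 1 ≤ j → j ≤ n + 1 → G j = twistSpan c x (n + 1 - j) (n + 1) := by
  obtain ⟨y, hy, hy0⟩ : ∃ y ∈ G 1, y ≠ 0 := by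
    refine (Submodule.ne_bot_iff _).1 fun h => ?_
    have := hfr 1 (by omega)
    rw [h, finrank_bot] at this
    omega
  choose x hx using fun s => IsAlgClosed.exists_pow_nat_eq ((c.baseChange k).repr y s)
    (pow_pos (Fact.out : p.Prime).pos n)
  have hxy : twist c x n = y := ext_repr c fun s => by rw [repr_twist, hx]
  refine ⟨x, fun j hj1 => ?_⟩
  induction j, hj1 using Nat.le_induction with
  | base =>
    intro _
    symm
    refine eq_of_le_of_finrank_le' (twistSpan_le _ fun l hl1 hl2 => ?_) ?_
    · have : l = n := by omega
      rw [this, hxy]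
      exact hy
    · rw [hfr 1 (by omega), Nat.one_le_iff_ne_zero, Ne, Submodule.finrank_eq_zero]
      intro h
      have h1 : y ∈ twistSpan c x (n + 1 - 1) (n + 1) := by
        rw [← hxy]
        exact twist_mem_twistSpan _ _ (by omega) (by omega)
      rw [h] at h1
      exact hy0 h1
  | succ j hj1 ih =>
    intro hj
    have ih := ih (by omega)
    symm
    have hlt : twistSpan c x (n + 1 - (j + 1)) (n + 1) ≤ G (j + 1) := by
      refine twistSpan_le _ fun l hl1 hl2 => ?_
      rcases Nat.lt_or_ge l (n + 1 - j) with hl | hl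
      · have h1 : twist c x (l + 1) ∈ G j := by
          rw [ih]
          exact twist_mem_twistSpan _ _ (by omega) (by omega)
        have h2 := hle j (by omega) h1
        rwa [← frob_twist, frob_mem_frobSpace_iff] at h2
      · refine hmono j (by omega) ?_
        rw [ih]
        exact twist_mem_twistSpan _ _ hl hl2
    refine eq_of_le_of_finrank_le' hlt ?_
    rw [hfr _ hj]
    -- If the new twist added nothing, G_j would contain it, and then G_j ⊆ Φ G_j would force
    -- equality.
    by_contra hcon
    have hsub : G j ≤ twistSpan c x (n + 1 - (j + 1)) (n + 1) := by
      rw [ih]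
      exact twistSpan_mono _ _ (by omega) le_rfl
    have heq := eq_of_le_of_finrank_le' hsub (by rw [hfr j (by omega)]; omega)
    refine hne j hj1 (by omega) (eq_frobSpace_of_le ?_)
    conv_rhs => rw [heq, frobSpace_twistSpan]
    rw [ih]
    exact twistSpan_mono _ _ (by omega) (by omega)

end CoxeterVariety

/-- A flag shows x only through multiples z of Φ^n x. Since F(x)^{p^n} is the polynomial with
coefficients raised to the power p^n, evaluated at Φ^n x = z / z_{r₀}, the condition F(x) ≠ 0
becomes polynomial in z after clearing denominators. -/
theorem exists_homogenize_frobenius (p : ℕ) [Fact p.Prime] {k : Type*} [Field k]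
    [Algebra (ZMod p) k] {σ : Type*} (n : ℕ) (F : MvPolynomial σ k) (r₀ : σ) :
    ∃ g : MvPolynomial σ k, ∀ x z : σ → k, z r₀ ≠ 0 → (∀ r, z r = z r₀ * x r ^ p ^ n) →
      (MvPolynomial.aeval z g ≠ 0 ↔ MvPolynomial.aeval x F ≠ 0) := by
  have hch := charP_of_algebra p k
  let Q : MvPolynomial (Option σ) k := MvPolynomial.aeval
    (fun r => MvPolynomial.X none * MvPolynomial.X (some r))
    (MvPolynomial.map (iterateFrobenius k p n) F)
  obtain ⟨N, g, hg⟩ := exists_clear_denominators (MvPolynomial.X r₀) Q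
  refine ⟨g, fun x z h1 h2 => ?_⟩
  let w : Option σ → k := fun o => o.elim (z r₀)⁻¹ z
  have h3 := hg k w (by
    rw [MvPolynomial.aeval_X]
    exact inv_mul_cancel₀ h1)
  have h6 : (MvPolynomial.aeval w).comp (MvPolynomial.aeval (R := k)
      (fun r => (MvPolynomial.X none * MvPolynomial.X (some r) : MvPolynomial (Option σ) k))) =
      MvPolynomial.aeval (fun r => x r ^ p ^ n) := by
    refine MvPolynomial.algHom_ext fun r => ?_
    rw [AlgHom.comp_apply, MvPolynomial.aeval_X, MvPolynomial.aeval_X, map_mul,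
      MvPolynomial.aeval_X, MvPolynomial.aeval_X]
    change (z r₀)⁻¹ * z r = _
    rw [h2 r, inv_mul_cancel_left₀ h1]
  have h4 : MvPolynomial.aeval w Q = MvPolynomial.aeval x F ^ p ^ n := by
    have h5 : MvPolynomial.aeval w Q = MvPolynomial.aeval (fun r => x r ^ p ^ n)
        (MvPolynomial.map (iterateFrobenius k p n) F) := DFunLike.congr_fun h6 _
    rw [h5, MvPolynomial.aeval_def, MvPolynomial.eval₂_map, MvPolynomial.aeval_def,
      ← iterateFrobenius_def p, MvPolynomial.hom_eval₂]
    rfl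
  rw [h4, MvPolynomial.aeval_X] at h3
  change MvPolynomial.aeval (fun r => w (some r)) g ≠ 0 ↔ _
  rw [← h3]
  exact ⟨fun h h' => h (by
    rw [h', zero_pow (pow_ne_zero _ (Fact.out : p.Prime).ne_zero), zero_mul]),
    fun h => mul_ne_zero (pow_ne_zero _ h) (pow_ne_zero _ h1)⟩

theorem aeval_equivFun_mem_polyFun {k : Type*} [Field k] {E : Type*} [AddCommGroup E] [Module k E]
    {σ ι : Type*} [Fintype σ] (b : Module.Basis σ k E) (a : ι) (g : MvPolynomial σ k) :
    (fun x : ι → E => MvPolynomial.aeval (b.equivFun (x a)) g) ∈ polyFun k (ι → E) := by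
  have h : (fun y : σ → k => MvPolynomial.aeval y g) ∈ polyFun k (σ → k) :=
    mem_polyFun_pi_iff.2 ⟨g, fun _ => rfl⟩
  have h' := polyFun_comp_linear
    (b.equivFun.toLinearMap ∘ₗ (LinearMap.proj a : (ι → E) →ₗ[k] E)) h
  exact h'

/-! ### Surjectivity from the slice, and the homeomorphism -/

section CoxeterVariety

universe u

variable {p : ℕ} [Fact p.Prime] {k : Type u} [Field k] [Algebra (ZMod p) k] [IsAlgClosed k]
  {V : Type*} [AddCommGroup V] [Module (ZMod p) V] {B : LinearMap.BilinForm (ZMod p) V}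
  {n : ℕ} {e : Module.Basis (Fin (2 * (n + 1))) (ZMod p) V}
  {c : Module.Basis (Fin (n + 1) ⊕ Fin (n + 1)) (ZMod p) V}
  (hB : B.IsAlt) (he : IsSymplecticBasis B e) (hc : IsStdBasis B c)

include hB he hc in
-- Isotropy gives the vanishing pairings. If ⟨x, Φ^{n+1} x⟩ vanished as well, Φ^{n+1} x would be
-- orthogonal to the Lagrangian D, hence in D, and D would be Frobenius-stable.
theorem isCone_of_twistSpan {D : Submodule k (k ⊗[ZMod p] V)} {x : Fin (n + 1) ⊕ Fin (n + 1) → k}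
    (hx : D = twistSpan c x 0 (n + 1)) (hfr : Module.finrank k D = n + 1)
    (hD : D ≤ (B.baseChange k).orthogonal D) (hne : D ≠ frobSpace D) : IsCone p x := by
  have : Module.Finite (ZMod p) V := Module.Finite.of_basis e
  have hmem : ∀ a < n + 1, twist c x a ∈ D := by
    intro a ha
    rw [hx]
    exact twist_mem_twistSpan _ _ (Nat.zero_le _) ha
  have hvan : ∀ j < n + 1, frobPairing p x j = 0 := by
    intro j hj
    rw [← form_twist_zero hB hc]
    exact hD (hmem j hj) _ (hmem 0 (by omega))
  refine ⟨fun j _ hj => hvan j hj, fun h => hne ?_⟩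
  have hzero : ∀ j, 1 ≤ j → j < n + 2 → frobPairing p x j = 0 := by
    intro j hj1 hj2
    rcases Nat.lt_or_ge j (n + 1) with hj | hj
    · exact hvan j hj
    · rw [show j = n + 1 by omega, h]
  have horth := orthogonal_eq_self (nondegenerate_baseChange hB he) hD (by
    rw [hfr, Module.finrank_baseChange, Module.finrank_eq_card_basis e, Fintype.card_fin])
  have hker : D ≤ LinearMap.ker (B.baseChange k (twist c x (n + 1))) := by
    rw [hx]
    refine twistSpan_le _ fun l _ hl => ?_
    rw [LinearMap.mem_ker, form_twist hB hc]
    exact stdForm_twist_eq_zero hzero (by omega) (by omega)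
  have hnew : twist c x (n + 1) ∈ D := by
    rw [← horth]
    intro z hz
    change B.baseChange k z (twist c x (n + 1)) = 0
    rw [← (isAlt_baseChange hB).neg_eq, neg_eq_zero]
    exact hker hz
  refine eq_frobSpace_of_ge ?_
  have hfrob : frobSpace D = twistSpan c x (0 + 1) (n + 1 + 1) := by
    rw [← frobSpace_twistSpan, ← hx]
  rw [hfrob]
  refine twistSpan_le _ fun l hl1 hl2 => ?_
  rcases Nat.lt_or_ge l (n + 1) with hl | hl
  · exact hmem l hl
  · rw [show l = n + 1 by omega]
    exact hnew

include he in
theorem exists_coxeterFrame_flag_eq {F : IsotropicFlag (B.baseChange k) (n + 1) (Fin.last (n + 1))}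
    (hF : F ∈ coxeterDLVariety k B e) :
    ∃ s : Slice p k n, (coxeterFrame hB hc s).flag (Fin.last (n + 1)) = F := by
  have : Module.Finite (ZMod p) V := Module.Finite.of_basis e
  obtain ⟨-, hle, hne⟩ := (mem_stratum_iff (i := Fin.last (n + 1)) hB he).1 hF
  let G : ℕ → Submodule k (k ⊗[ZMod p] V) := fun j =>
    if h : j < (Fin.last (n + 1)).val + 1 then F.space ⟨j, h⟩ else ⊥
  have hG : ∀ j (h : j < (Fin.last (n + 1)).val + 1), G j = F.space ⟨j, h⟩ := fun j h => dif_pos h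
  have hn : (Fin.last (n + 1)).val = n + 1 := rfl
  have hfr : ∀ j ≤ n + 1, Module.finrank k (G j) = j := by
    intro j hj
    rw [hG j (by omega), F.finrank_space]
    simp
  have hne' : ∀ j, 1 ≤ j → j ≤ n + 1 → G j ≠ frobSpace (G j) := by
    intro j hj1 hj
    rw [hG j (by omega)]
    refine hne _ fun h => ?_
    have := congrArg Fin.val h
    rw [Fin.val_zero] at this
    simp only at this
    omega
  obtain ⟨x, hx⟩ := exists_twistSpan_eq (c := c) G hfr
    (fun j hj => by
      rw [hG j (by omega), hG (j + 1) (by omega)]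
      exact F.mono (Fin.mk_le_mk.2 (Nat.le_succ j)))
    (fun j hj => by
      rw [hG j (by omega), hG (j + 1) (by omega)]
      exact hle j (by omega)) hne'
  have hlast := hx (n + 1) (by omega) le_rfl
  rw [Nat.sub_self] at hlast
  have hcone : IsCone p x := by
    refine isCone_of_twistSpan hB he hc hlast (hfr _ le_rfl) ?_ (hne' _ (by omega) le_rfl)
    rw [hG (n + 1) (by omega)]
    exact fun z hz w hw => F.isotropic _ _ hw _ hz
  have hne0 := IsCone.ne_zero n x hcone
  -- Scaling x into the slice does not change the spans of its twists.
  have hcone' : IsCone p fun s => (x (Sum.inr 0))⁻¹ * x s := by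
    refine ⟨fun j hj1 hj2 => ?_, ?_⟩
    · rw [frobPairing_smul, hcone.1 j hj1 hj2, mul_zero]
    · rw [frobPairing_smul]
      exact mul_ne_zero (pow_ne_zero _ (inv_ne_zero hne0)) hcone.2
  refine ⟨⟨_, inv_mul_cancel₀ hne0, hcone'⟩, ?_⟩
  refine IsotropicFlag.ext (funext fun j => ?_)
  refine eq_of_le_of_finrank_le' ?_
    (by rw [IsotropicFlag.finrank_space, IsotropicFlag.finrank_space])
  rw [coxeterFrame_flag_space]
  have hj := j.isLt
  refine twistSpan_le _ fun l hl1 hl2 => ?_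
  rw [twist_smul]
  refine Submodule.smul_mem _ _ ?_
  have h1 := hx j.val (by omega) (by omega)
  rw [hG j.val hj] at h1
  rw [show F.space j = _ from h1]
  exact twist_mem_twistSpan _ _ hl1 hl2

/-- The points of the Coxeter variety as points of the slice. -/
def coxeterMap (s : Slice p k n) : coxeterDLVariety k B e :=
  ⟨(coxeterFrame hB hc s).flag (Fin.last (n + 1)), coxeterFrame_flag_mem hB he hc s⟩

theorem continuous_coxeterMap : Continuous (coxeterMap hB he hc (k := k)) := by
  have : Module.Finite (ZMod p) V := Module.Finite.of_basis e
  refine continuous_def.2 fun U hU => (isOpen_induced_zariski_iff (k := k) _).2 fun s hs => ?_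
  obtain ⟨f, hf, hfs, hfU⟩ := isOpen_flag_iff.1 hU (coxeterFrame hB hc s)
    (coxeterFrame_flag_mem hB he hc s) hs
  refine ⟨fun x => f fun a => twist c x (n - a.val), ?_, hfs, fun t ht =>
    hfU (coxeterFrame hB hc t) (coxeterFrame_flag_mem hB he hc t) ht⟩
  refine polyFun_comp (M := Fin (n + 1) ⊕ Fin (n + 1) → k)
    (fun x (a : Fin (n + 1)) => twist c x (n - a.val)) (fun g => ?_) hf
  have h1 : (fun x : Fin (n + 1) ⊕ Fin (n + 1) → k => g fun a => twist c x (n - a.val)) =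
      ∑ a : Fin (n + 1), ∑ s, (fun x => x s) ^ p ^ (n - a.val) *
        fun _ => g (Pi.single a ((c.baseChange k) s)) := by
    funext x
    have h2 : (fun a : Fin (n + 1) => twist c x (n - a.val)) =
        ∑ a : Fin (n + 1), ∑ s, x s ^ p ^ (n - a.val) • Pi.single a ((c.baseChange k) s) := by
      rw [← Finset.univ_sum_single fun a : Fin (n + 1) => twist c x (n - a.val)]
      refine Finset.sum_congr rfl fun a _ => ?_
      simp only [← Pi.single_smul, twist, Module.Basis.equivFun_symm_apply]
      exact map_sum (LinearMap.single k (fun _ => k ⊗[ZMod p] V) a) _ _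
    rw [h2]
    simp only [map_sum, map_smul, Finset.sum_apply, Pi.mul_apply, Pi.pow_apply, smul_eq_mul]
  rw [h1]
  refine sum_mem fun a _ => sum_mem fun s _ => mul_mem (pow_mem ?_ _) (const_mem_polyFun _)
  exact dual_mem_polyFun (LinearMap.proj s : Module.Dual k (Fin (n + 1) ⊕ Fin (n + 1) → k))

/-- An open condition on x is read off from the first vector of any frame, which is a nonzero
multiple of Φ^n x. -/
theorem isOpenMap_coxeterMap : IsOpenMap (coxeterMap hB he hc (k := k)) := by
  have : Module.Finite (ZMod p) V := Module.Finite.of_basis e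
  intro U hU
  refine isOpen_flag_iff.2 fun v hv hvU => ?_
  obtain ⟨s, hs, hsv⟩ := hvU
  obtain ⟨f, hf, hfs, hfU⟩ := (isOpen_induced_zariski_iff (k := k) _).1 hU s hs
  obtain ⟨F, hF⟩ := mem_polyFun_pi_iff.1 hf
  obtain ⟨g, hg⟩ := exists_homogenize_frobenius p n F (Sum.inr (0 : Fin (n + 1)))
  have key : ∀ (t : Slice p k n) (u : IsotropicFrame (B.baseChange k) (n + 1)),
      u.flag (Fin.last (n + 1)) = (coxeterFrame hB hc t).flag (Fin.last (n + 1)) →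
      (MvPolynomial.aeval ((c.baseChange k).equivFun (u.vec 0)) g ≠ 0 ↔ f t.vec ≠ 0) := by
    intro t u hut
    obtain ⟨h1, h2⟩ := repr_vec_zero hB hc hut
    rw [hF]
    exact hg _ _ h1 h2
  refine ⟨fun x => MvPolynomial.aeval ((c.baseChange k).equivFun (x 0)) g, ?_, ?_,
    fun u hu hgu => ?_⟩
  · exact aeval_equivFun_mem_polyFun (c.baseChange k) 0 g
  · exact (key s v (congrArg Subtype.val hsv).symm).2 hfs
  · obtain ⟨t, ht⟩ := exists_coxeterFrame_flag_eq hB he hc hu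
    exact ⟨t, hfU t ((key t u ht.symm).1 hgu), Subtype.ext ht⟩

theorem isHomeomorph_coxeterMap : IsHomeomorph (coxeterMap hB he hc (k := k)) where
  continuous := continuous_coxeterMap hB he hc
  isOpenMap := isOpenMap_coxeterMap hB he hc
  bijective := ⟨fun s t h => coxeterFrame_flag_injective hB hc s t (congrArg Subtype.val h),
    fun F => by
      obtain ⟨s, hs⟩ := exists_coxeterFrame_flag_eq hB he hc F.2
      exact ⟨s, Subtype.ext hs⟩⟩

end CoxeterVariety

/-! ### Irreducibility and dimension of the Coxeter variety -/

section CoxeterVarietyDimension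

universe u

variable {p : ℕ} [Fact p.Prime] {k : Type u} [Field k] [Algebra (ZMod p) k] [IsAlgClosed k]
  {V : Type*} [AddCommGroup V] [Module (ZMod p) V] {B : LinearMap.BilinForm (ZMod p) V}

theorem irreducibleSpace_of_surjective {X Y : Type*} [TopologicalSpace X] [TopologicalSpace Y]
    [IrreducibleSpace X] {f : X → Y} (hf : Continuous f) (hs : Function.Surjective f) :
    IrreducibleSpace Y := by
  have h := (IrreducibleSpace.isIrreducible_univ X).image f hf.continuousOn
  rw [Set.image_univ, hs.range_eq] at h
  exact (irreducibleSpace_def Y).2 h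

/-- The Deligne–Lusztig variety of the standard Coxeter element is irreducible, of dimension equal
to the rank. -/
theorem irreducibleSpace_coxeterDLVariety_and_krullDim (hp : p ≠ 2) (hB : B.IsAlt) {n : ℕ}
    {e : Module.Basis (Fin (2 * n)) (ZMod p) V} (he : IsSymplecticBasis B e)
    (hB' : B.Nondegenerate) :
    IrreducibleSpace (coxeterDLVariety k B e) ∧
      topologicalKrullDim (coxeterDLVariety k B e) = (n : WithBot ℕ∞) := by
  have : Module.Finite (ZMod p) V := Module.Finite.of_basis e
  rcases n with _ | n
  -- In rank zero the variety is a single point, which no slice describes.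
  · have hmem : ∀ F : IsotropicFlag (B.baseChange k) 0 (Fin.last 0), F ∈ coxeterDLVariety k B e := by
      intro F
      have hbot : ∀ j, F.space j = ⊥ := by
        intro j
        rw [← Submodule.finrank_eq_zero (R := k), F.finrank_space]
        have := j.isLt
        simp at this ⊢
      refine (mem_stratum_iff (i := Fin.last 0) hB he).2 ⟨?_, fun j hj => ?_, fun j hj => ?_⟩
      · rw [hbot]
        simp [frobSpace]
      · rw [hbot]
        exact bot_le
      · exact absurd (Subsingleton.elim (α := Fin 1) j 0) hj
    let F : IsotropicFlag (B.baseChange k) 0 (Fin.last 0) :=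
      IsotropicFrame.flag ⟨Fin.elim0, linearIndependent_empty_type, fun a => a.elim0⟩ _
    have hsub : Subsingleton (coxeterDLVariety k B e) := by
      refine ⟨fun F G => Subtype.ext (IsotropicFlag.ext ?_)⟩
      funext j
      have h1 : Module.finrank k (F.1.space j) = 0 := by
        rw [F.1.finrank_space]; have := j.isLt; simp at this ⊢
      have h2 : Module.finrank k (G.1.space j) = 0 := by
        rw [G.1.finrank_space]; have := j.isLt; simp at this ⊢
      rw [Submodule.finrank_eq_zero.1 h1, Submodule.finrank_eq_zero.1 h2]
    have hne : Nonempty (coxeterDLVariety k B e) := ⟨⟨F, hmem F⟩⟩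
    refine ⟨(irreducibleSpace_def _).2 ⟨Set.univ_nonempty, Set.subsingleton_univ.isPreirreducible⟩,
      ?_⟩
    have hs : Subsingleton (TopologicalSpace.IrreducibleCloseds (coxeterDLVariety k B e)) := by
      refine ⟨fun A C => ?_⟩
      apply TopologicalSpace.IrreducibleCloseds.ext
      rw [Subsingleton.eq_univ_of_nonempty A.isIrreducible.nonempty,
        Subsingleton.eq_univ_of_nonempty C.isIrreducible.nonempty]
    have hne' : Nonempty (TopologicalSpace.IrreducibleCloseds (coxeterDLVariety k B e)) :=
      ⟨⟨Set.univ, ⟨Set.univ_nonempty, Set.subsingleton_univ.isPreirreducible⟩, isClosed_univ⟩⟩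
    rw [topologicalKrullDim, Order.krullDim_eq_zero]
    rfl
  · obtain ⟨c, hc, -⟩ := exists_isStdBasis hB hB'
      (by rw [Module.finrank_eq_card_basis e, Fintype.card_fin]) ⊥ bot_le
    obtain ⟨h1, h2⟩ := irreducibleSpace_slice_and_krullDim hp (k := k) IsCone.ne_zero n
    have h3 := isHomeomorph_coxeterMap hB he hc (k := k)
    exact ⟨irreducibleSpace_of_surjective h3.continuous h3.bijective.2,
      (IsHomeomorph.topologicalKrullDim_eq _ h3).symm.trans h2⟩

end CoxeterVarietyDimension

/-! ### Lagrangian subspaces without rational vectors -/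

section CoxeterFiltration

variable {p : ℕ} [Fact p.Prime] {k : Type*} [Field k] [Algebra (ZMod p) k] [IsAlgClosed k]
  {V : Type*} [AddCommGroup V] [Module (ZMod p) V] [Module.Finite (ZMod p) V]

omit [IsAlgClosed k] in
theorem finrank_sup_add_inf (D D' : Submodule k (k ⊗[ZMod p] V)) :
    Module.finrank k ↥(D ⊔ D') + Module.finrank k ↥(D ⊓ D') =
      Module.finrank k D + Module.finrank k D' :=
  Submodule.finrank_sup_add_finrank_inf_eq D D'

omit [IsAlgClosed k] in
theorem finrank_mono' {D D' : Submodule k (k ⊗[ZMod p] V)} (h : D ≤ D') :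
    Module.finrank k D ≤ Module.finrank k D' :=
  Submodule.finrank_mono h

theorem eq_bot_of_frobSpace_eq {D D' : Submodule k (k ⊗[ZMod p] V)} (h : D ≤ D')
    (hD : D = frobSpace D) (hD' : rationalVectors D' = ⊥) : D = ⊥ := by
  have h1 : rationalVectors D ≤ rationalVectors D' := fun v hv => h hv
  rw [hD', le_bot_iff] at h1
  rw [← baseChange_rationalVectors hD.ge, h1, Submodule.baseChange_bot]

/-- The descending sequence `D`, `D ∩ Φ D`, `D ∩ Φ D ∩ Φ² D`, … -/
def frobFiltration (D : Submodule k (k ⊗[ZMod p] V)) : ℕ → Submodule k (k ⊗[ZMod p] V)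
  | 0 => D
  | t + 1 => frobFiltration D t ⊓ frobSpace (frobFiltration D t)

omit [IsAlgClosed k] [Module.Finite (ZMod p) V] in
theorem frobFiltration_antitone (D : Submodule k (k ⊗[ZMod p] V)) :
    Antitone (frobFiltration D) :=
  antitone_nat_of_succ_le fun _ => inf_le_left

/-- The dimension drops by at least one, since a Frobenius-stable term would be spanned by rational
vectors and so be zero. It drops by at most one, since each term D_{s+1} and its translate both lie
in Φ D_s, which is only one dimension larger. -/
theorem finrank_frobFiltration {D : Submodule k (k ⊗[ZMod p] V)} {n : ℕ}
    (hn : Module.finrank k D = n) (hD : n ≤ Module.finrank k ↥(D ⊓ frobSpace D) + 1)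
    (hrat : rationalVectors D = ⊥) : ∀ t ≤ n, Module.finrank k (frobFiltration D t) = n - t := by
  intro t
  induction t using Nat.strong_induction_on with
  | _ t ih =>
  intro ht
  rcases t with _ | t
  · exact hn
  have h1 := ih t (Nat.lt_succ_self t) (by omega)
  have h2 : Module.finrank k (frobFiltration D (t + 1)) ≤ n - (t + 1) := by
    by_contra hlt
    have h3 : frobFiltration D (t + 1) = frobFiltration D t :=
      eq_of_le_of_finrank_le' inf_le_left (by omega)
    have h4 : frobFiltration D t ≤ frobSpace (frobFiltration D t) := inf_eq_left.1 h3
    have h5 := eq_bot_of_frobSpace_eq (frobFiltration_antitone D (Nat.zero_le t))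
      (eq_frobSpace_of_le h4) hrat
    rw [h5, finrank_bot] at h1
    omega
  refine le_antisymm h2 ?_
  rcases t with _ | s
  · change n - 1 ≤ Module.finrank k ↥(D ⊓ frobSpace D)
    omega
  · have h4 := finrank_sup_add_inf (frobFiltration D (s + 1))
      (frobSpace (frobFiltration D (s + 1)))
    have h5 : frobFiltration D (s + 1) ⊔ frobSpace (frobFiltration D (s + 1)) ≤
        frobSpace (frobFiltration D s) :=
      sup_le inf_le_right (frobSpace_mono inf_le_left)
    have h6 := finrank_mono' h5
    rw [finrank_frobSpace] at h4 h6
    rw [ih s (by omega) (by omega)] at h6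
    change n - _ ≤ Module.finrank k
      ↥(frobFiltration D (s + 1) ⊓ frobSpace (frobFiltration D (s + 1)))
    omega

variable {B : LinearMap.BilinForm (ZMod p) V} {n : ℕ}
  {e : Module.Basis (Fin (2 * n)) (ZMod p) V}

/-- Lagrangian subspaces in `S_V` without rational vectors come from the Coxeter variety. -/
theorem exists_last_eq_of_rationalVectors_eq_bot (hB : B.IsAlt) (he : IsSymplecticBasis B e)
    {U : IsotropicFlag (B.baseChange k) n 0} (hU : U ∈ lagrangianVariety k B n)
    (hrat : rationalVectors (U.space 0) = ⊥) : ∃ F ∈ coxeterDLVariety k B e, F.last = U := by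
  have hn : Module.finrank k (U.space 0) = n := by
    rw [U.finrank_space]
    simp
  have hfr := finrank_frobFiltration hn hU hrat
  have hle : ∀ t, frobFiltration (U.space 0) t ≤ U.space 0 := fun t =>
    frobFiltration_antitone _ (Nat.zero_le t)
  let F : IsotropicFlag (B.baseChange k) n (Fin.last n) :=
    { space := fun j => frobFiltration (U.space 0) (n - j.val)
      mono := fun j j' h => frobFiltration_antitone _ (Nat.sub_le_sub_left h n)
      finrank_space := fun j => by
        have hj := j.isLt
        have hl : (Fin.last n).val = n := rfl
        rw [hfr _ (Nat.sub_le _ _)]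
        omega
      isotropic := fun j x hx y hy => U.isotropic 0 x (hle _ hx) y (hle _ hy) }
  have hF : ∀ j, F.space j = frobFiltration (U.space 0) (n - j.val) := fun _ => rfl
  refine ⟨F, (mem_stratum_iff (i := Fin.last n) hB he).2 ⟨?_, fun j hj => ?_, fun j hj h => ?_⟩, ?_⟩
  · have h0 : F.space 0 = ⊥ := by
      rw [← Submodule.finrank_eq_zero (R := k), F.finrank_space]
      simp
    rw [h0]
    simp [frobSpace]
  · rw [hF, hF]
    rw [Fin.val_last] at hj
    have h1 : n - j = n - (j + 1) + 1 := by omega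
    simp only [h1]
    exact inf_le_right
  · have h1 := eq_bot_of_frobSpace_eq (hle _) h hrat
    have h2 := F.finrank_space j
    rw [show F.space j = ⊥ from h1, finrank_bot] at h2
    exact hj (Fin.ext (by rw [Fin.val_zero]; omega))
  · refine IsotropicFlag.ext (funext fun j => ?_)
    rw [Subsingleton.elim (α := Fin 1) j 0]
    change frobFiltration (U.space 0) (n - n) = _
    rw [Nat.sub_self]
    rfl

/-- A Frobenius-stable isotropic subspace of half the dimension that contains no rational vector of
a point `D` of `S_V` is a complement of `D`. -/
theorem inf_eq_bot_of_rationalVectors {n : ℕ} (hn : (B.baseChange k).Nondegenerate)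
    (hdim : Module.finrank (ZMod p) V = 2 * n) {D M : Submodule k (k ⊗[ZMod p] V)}
    (hD : D ≤ (B.baseChange k).orthogonal D) (hDn : Module.finrank k D = n)
    (hDΦ : n ≤ Module.finrank k ↥(D ⊓ frobSpace D) + 1)
    (hM : M ≤ (B.baseChange k).orthogonal M) (hMn : Module.finrank k M = n)
    (hMΦ : frobSpace M = M) (hrat : rationalVectors (D ⊓ M) = ⊥) : D ⊓ M = ⊥ := by
  have hinf : frobSpace (D ⊓ M) = frobSpace D ⊓ M := by rw [frobSpace_inf, hMΦ]
  have hΦD : frobSpace D ≤ (B.baseChange k).orthogonal (frobSpace D) := by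
    intro x hx y hy
    obtain ⟨x', hx', rfl⟩ := mem_frobSpace_iff.1 hx
    obtain ⟨y', hy', rfl⟩ := mem_frobSpace_iff.1 hy
    have h1 : B.baseChange k y' x' = 0 := hD hx' y' hy'
    change B.baseChange k _ _ = 0
    rw [baseChange_form_frob, h1, zero_pow (Fact.out : p.Prime).ne_zero]
  -- Let d = dim (D ∩ M) and let q be the dimension of its intersection with its translate. The left
  -- side has dimension 2d - q and the right side at most 1 + q, so 2d ≤ 2q + 1 and d ≤ q. Hence D ∩
  -- M is Frobenius-stable.
  have horth : (D ⊓ M) ⊔ frobSpace (D ⊓ M) ≤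
      (B.baseChange k).orthogonal ((D ⊓ frobSpace D) ⊔ M) := by
    rw [hinf]
    refine sup_le ?_ ?_
    · rintro x ⟨hx1, hx2⟩ y hy
      obtain ⟨y₁, hy₁, y₂, hy₂, rfl⟩ := Submodule.mem_sup.1 hy
      change B.baseChange k _ _ = 0
      rw [map_add, LinearMap.add_apply, show B.baseChange k y₁ x = 0 from hD hx1 _ hy₁.1,
        show B.baseChange k y₂ x = 0 from hM hx2 _ hy₂, add_zero]
    · rintro x ⟨hx1, hx2⟩ y hy
      obtain ⟨y₁, hy₁, y₂, hy₂, rfl⟩ := Submodule.mem_sup.1 hy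
      change B.baseChange k _ _ = 0
      rw [map_add, LinearMap.add_apply, show B.baseChange k y₁ x = 0 from hΦD hx1 _ hy₁.2,
        show B.baseChange k y₂ x = 0 from hM hx2 _ hy₂, add_zero]
  have h1 := finrank_mono' horth
  rw [LinearMap.BilinForm.finrank_orthogonal hn, Module.finrank_baseChange, hdim] at h1
  have h2 := finrank_sup_add_inf (D ⊓ M) (frobSpace (D ⊓ M))
  have h3 := finrank_sup_add_inf (D ⊓ frobSpace D) M
  have h4 : D ⊓ frobSpace D ⊓ M ≤ (D ⊓ M) ⊓ frobSpace (D ⊓ M) := by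
    rw [hinf]
    exact le_inf (inf_le_inf_right _ inf_le_left) (inf_le_inf_right _ inf_le_right)
  have h5 := finrank_mono' h4
  rw [finrank_frobSpace] at h2
  have h6 := finrank_mono' (inf_le_left : (D ⊓ M) ⊓ frobSpace (D ⊓ M) ≤ D ⊓ M)
  have h7 : (D ⊓ M) ⊓ frobSpace (D ⊓ M) = D ⊓ M :=
    eq_of_le_of_finrank_le' inf_le_left (by omega)
  exact eq_bot_of_frobSpace_eq le_rfl (eq_frobSpace_of_le (inf_eq_left.1 h7)) hrat

end CoxeterFiltration

/-! ### Symmetric matrices of rank at most one -/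

section RankOne

variable {K : Type*} [Field K]

/-- Over an algebraically closed field, a symmetric matrix of rank at most one is of the form
`x xᵀ`. -/
theorem exists_mul_self_eq_of_symmetric [IsAlgClosed K] {ι : Type*} (C : ι → ι → K)
    (hC : ∀ a b, C a b = C b a) (w : ι → K) (l : ι → K) (h : ∀ a b, C a b = l a * w b) :
    ∃ x : ι → K, ∀ a b, C a b = x a * x b := by
  by_cases hl : ∃ a, l a ≠ 0
  · obtain ⟨a₀, ha₀⟩ := hl
    obtain ⟨r, hr⟩ := IsAlgClosed.exists_pow_nat_eq (w a₀ / l a₀) two_pos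
    refine ⟨fun a => r * l a, fun a b => ?_⟩
    have h1 : l a₀ * w b = l b * w a₀ := by rw [← h, ← h, hC]
    have h2 : w b = l b * w a₀ / l a₀ := by
      rw [eq_div_iff ha₀, ← h1, mul_comm]
    have h3 : r * l a * (r * l b) = r ^ 2 * (l a * l b) := by ring
    rw [h, h3, hr, h2]
    ring
  · refine ⟨0, fun a b => ?_⟩
    push Not at hl
    simp [h, hl]

theorem exists_mul_of_finrank_ker {E : Type*} [AddCommGroup E] [Module K E]
    [FiniteDimensional K E] {ι : Type*} [Finite ι] (T : E →ₗ[K] (ι → K))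
    (hT : Module.finrank K E ≤ Module.finrank K (LinearMap.ker T) + 1) :
    ∃ w : ι → K, ∀ x, ∃ l : K, T x = l • w := by
  have h1 := T.finrank_range_add_finrank_ker
  obtain ⟨⟨w, hw⟩, hw'⟩ := finrank_le_one_iff.1 (show Module.finrank K (LinearMap.range T) ≤ 1 by omega)
  refine ⟨w, fun x => ?_⟩
  obtain ⟨l, hl⟩ := hw' ⟨T x, LinearMap.mem_range_self T x⟩
  exact ⟨l, (congrArg Subtype.val hl).symm⟩

/-- There is a point with `𝔽_p`-independent coordinates at which a given polynomial in the products
`x_a x_b` does not vanish. -/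
theorem exists_independent_ne_zero [Infinite K] {p : ℕ} [Fact p.Prime] [Algebra (ZMod p) K] {n : ℕ}
    (F : MvPolynomial (Sym2 (Fin n)) K) (x₀ : Fin n → K)
    (hF : MvPolynomial.eval (fun s : Sym2 (Fin n) => (s.map x₀).mul) F ≠ 0) :
    ∃ x : Fin n → K, MvPolynomial.eval (fun s : Sym2 (Fin n) => (s.map x).mul) F ≠ 0 ∧
      ∀ c : Fin n → ZMod p, ∑ a, algebraMap (ZMod p) K (c a) * x a = 0 → c = 0 := by
  classical
  let G : MvPolynomial (Fin n) K := MvPolynomial.aeval (fun s : Sym2 (Fin n) => (s.map MvPolynomial.X).mul) F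
  have hG : ∀ x, MvPolynomial.eval x G = MvPolynomial.eval (fun s : Sym2 (Fin n) => (s.map x).mul) F := by
    intro x
    have h1 : ((MvPolynomial.aeval x : MvPolynomial (Fin n) K →ₐ[K] K).comp
        (MvPolynomial.aeval fun s : Sym2 (Fin n) => (s.map MvPolynomial.X).mul)) =
        MvPolynomial.aeval (fun s : Sym2 (Fin n) => (s.map x).mul) := by
      refine MvPolynomial.algHom_ext fun s => ?_
      induction s with
      | _ a b => simp
    have h2 := DFunLike.congr_fun h1 F
    rw [AlgHom.comp_apply] at h2
    rw [← MvPolynomial.coe_aeval_eq_eval, ← MvPolynomial.coe_aeval_eq_eval]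
    exact h2
  have hG0 : G ≠ 0 := fun h => hF (by rw [← hG, h, map_zero])
  let L : (Fin n → ZMod p) → MvPolynomial (Fin n) K := fun c =>
    ∑ a, MvPolynomial.C (algebraMap (ZMod p) K (c a)) * MvPolynomial.X a
  have hL : ∀ c x, MvPolynomial.eval x (L c) = ∑ a, algebraMap (ZMod p) K (c a) * x a := by
    intro c x
    simp [L]
  have hL0 : ∀ c, c ≠ 0 → L c ≠ 0 := by
    intro c hc h
    refine hc (funext fun a => ?_)
    have h1 := hL c (Pi.single a 1)
    rw [h] at h1
    simpa [Pi.single_apply] using h1.symm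
  -- The points with dependent coordinates are the zeros of finitely many nonzero linear forms, and
  -- a nonzero polynomial over an infinite field has a nonzero value.
  have hP : G * ∏ c ∈ Finset.univ.filter (fun c : Fin n → ZMod p => c ≠ 0), L c ≠ 0 :=
    mul_ne_zero hG0 (Finset.prod_ne_zero_iff.2 fun c hc => hL0 c (Finset.mem_filter.1 hc).2)
  obtain ⟨x, hx⟩ : ∃ x, MvPolynomial.eval x
      (G * ∏ c ∈ Finset.univ.filter (fun c : Fin n → ZMod p => c ≠ 0), L c) ≠ 0 := by
    by_contra! h
    exact hP (MvPolynomial.funext fun x => by rw [h, map_zero])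
  rw [map_mul, map_prod] at hx
  refine ⟨x, ?_, fun c hc => ?_⟩
  · rw [← hG]
    exact left_ne_zero_of_mul hx
  · by_contra hc0
    refine Finset.prod_ne_zero_iff.1 (right_ne_zero_of_mul hx) c
      (Finset.mem_filter.2 ⟨Finset.mem_univ _, hc0⟩) ?_
    rw [hL, hc]

end RankOne

/-! ### Graphs of symmetric matrices -/

section Graph

variable {p : ℕ} [Fact p.Prime] {k : Type*} [Field k] [Algebra (ZMod p) k]
  {V : Type*} [AddCommGroup V] [Module (ZMod p) V] {B : LinearMap.BilinForm (ZMod p) V}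
  {n : ℕ} (c : Module.Basis (Fin n ⊕ Fin n) (ZMod p) V)

/-- The coordinates of the basis of the graph of a symmetric matrix. -/
def graphCoord (A : Sym2 (Fin n) → k) (a : Fin n) : Fin n ⊕ Fin n → k :=
  Sum.elim (Pi.single a 1) fun b => A s(a, b)

/-- The basis of the graph of a symmetric matrix. -/
def graphVec (A : Sym2 (Fin n) → k) (a : Fin n) : k ⊗[ZMod p] V :=
  (c.baseChange k).equivFun.symm (graphCoord A a)

theorem repr_graphVec (A : Sym2 (Fin n) → k) (a : Fin n) (s : Fin n ⊕ Fin n) :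
    (c.baseChange k).repr (graphVec c A a) s = graphCoord A a s := by
  rw [← Module.Basis.equivFun_apply, graphVec, LinearEquiv.apply_symm_apply]

theorem frob_graphVec (A : Sym2 (Fin n) → k) (a : Fin n) :
    frob k V (graphVec c A a) = graphVec c (fun s => A s ^ p) a := by
  have hp := (Fact.out : p.Prime).ne_zero
  refine ext_repr c fun s => ?_
  rw [repr_frob, repr_graphVec, repr_graphVec]
  rcases s with b | b
  · by_cases h : b = a <;> simp [graphCoord, h, hp]
  · rfl

theorem repr_inl_sum_graphVec (A : Sym2 (Fin n) → k) (y : Fin n → k) (b : Fin n) :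
    (c.baseChange k).repr (∑ a, y a • graphVec c A a) (Sum.inl b) = y b := by
  simp [repr_graphVec, graphCoord, Pi.single_apply]

theorem linearIndependent_graphVec (A : Sym2 (Fin n) → k) :
    LinearIndependent k (graphVec c A) := by
  rw [Fintype.linearIndependent_iff]
  intro y hy b
  rw [← repr_inl_sum_graphVec c A y b, hy]
  simp

variable {c} (hB : B.IsAlt) (hc : IsStdBasis B c)

include hB hc in
theorem form_graphVec (A A' : Sym2 (Fin n) → k) (a b : Fin n) :
    B.baseChange k (graphVec c A a) (graphVec c A' b) = A' s(a, b) - A s(a, b) := by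
  rw [hc.baseChange_apply hB]
  simp only [repr_graphVec]
  simp [stdForm, graphCoord, Pi.single_apply, Sym2.eq_swap]

/-- The graph of a symmetric matrix. -/
def graphFrame (A : Sym2 (Fin n) → k) : IsotropicFrame (B.baseChange k) n where
  vec := graphVec c A
  linearIndependent := linearIndependent_graphVec c A
  isotropic a b := by rw [form_graphVec hB hc, sub_self]

end Graph

/-! ### Dimension counts for hyperplane conditions -/

section LinearAlgebra

variable {K : Type*} [Field K] {E : Type*} [AddCommGroup E] [Module K E] [FiniteDimensional K E]

theorem exists_mem_eq_single {n : ℕ} {D : Submodule K E} (hD : Module.finrank K D = n)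
    (π : E →ₗ[K] (Fin n → K)) (hπ : ∀ x ∈ D, π x = 0 → x = 0) :
    ∃ v : Fin n → E, ∀ a, v a ∈ D ∧ π (v a) = Pi.single a 1 := by
  have hinj : Function.Injective (π.comp D.subtype) :=
    (injective_iff_map_eq_zero _).2 fun x hx => Subtype.ext (hπ x.1 x.2 hx)
  have hsurj : Function.Surjective (π.comp D.subtype) :=
    (LinearMap.injective_iff_surjective_of_finrank_eq_finrank (by rw [hD]; simp)).1 hinj
  choose v hv using fun a : Fin n => hsurj (Pi.single a 1)
  exact ⟨fun a => v a, fun a => ⟨(v a).2, hv a⟩⟩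

theorem exists_smul_of_vanishing {ι : Type*} [Finite ι] {D D' : Submodule K E}
    (h : Module.finrank K D ≤ Module.finrank K ↥(D ⊓ D') + 1) (T : E →ₗ[K] (ι → K))
    (hT : ∀ x ∈ D', T x = 0) : ∃ w : ι → K, ∀ x ∈ D, ∃ l : K, T x = l • w := by
  have hle : (D ⊓ D').comap D.subtype ≤ LinearMap.ker (T.comp D.subtype) := fun x hx => hT _ hx.2
  have h1 := Submodule.finrank_mono hle
  rw [(Submodule.comapSubtypeEquivOfLe (inf_le_left : D ⊓ D' ≤ D)).finrank_eq] at h1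
  obtain ⟨w, hw⟩ := exists_mul_of_finrank_ker (T.comp D.subtype) (by omega)
  exact ⟨w, fun x hx => hw ⟨x, hx⟩⟩

theorem le_finrank_add_one {n : ℕ} {v : Fin n → E} (hv : LinearIndependent K v) (x : Fin n → K)
    {S : Submodule K E} (hS : ∀ y : Fin n → K, ∑ a, x a * y a = 0 → ∑ a, y a • v a ∈ S) :
    n ≤ Module.finrank K S + 1 := by
  let T : (Fin n → K) →ₗ[K] K := ∑ a, x a • LinearMap.proj a
  have hT : ∀ y, T y = ∑ a, x a * y a := fun y => by simp [T]
  have h1 := T.finrank_range_add_finrank_ker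
  have h2 : Module.finrank K (LinearMap.range T) ≤ 1 := by
    have := (LinearMap.range T).finrank_le
    rwa [Module.finrank_self] at this
  rw [Module.finrank_fin_fun] at h1
  have hinj : Function.Injective (Fintype.linearCombination K v) :=
    LinearIndependent.fintypeLinearCombination_injective hv
  have hmap : (LinearMap.ker T).map (Fintype.linearCombination K v) ≤ S := by
    rintro _ ⟨y, hy, rfl⟩
    rw [Fintype.linearCombination_apply]
    exact hS y (by rw [← hT]; exact hy)
  have h3 := Submodule.finrank_mono hmap
  rw [((LinearMap.ker T).equivMapOfInjective _ hinj).finrank_eq.symm] at h3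
  omega

omit [FiniteDimensional K E] in
theorem apply_eq_zero_of_mem_span {β : LinearMap.BilinForm K E} {ι : Type*} {v : ι → E} {g z : E}
    (h : ∀ a, β (v a) g = 0) (hz : z ∈ Submodule.span K (Set.range v)) : β z g = 0 := by
  induction hz using Submodule.span_induction with
  | mem y hy => obtain ⟨a, rfl⟩ := hy; exact h a
  | zero => simp
  | add y z _ _ h1 h2 => simp [h1, h2]
  | smul c y _ h => simp [h]

end LinearAlgebra

/-! ### Points of S_V as graphs with A^(p) - A = x xᵀ -/

section Graph

variable {p : ℕ} [Fact p.Prime] {k : Type*} [Field k] [Algebra (ZMod p) k] [IsAlgClosed k]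
  {V : Type*} [AddCommGroup V] [Module (ZMod p) V] {B : LinearMap.BilinForm (ZMod p) V}
  {n : ℕ} {c : Module.Basis (Fin n ⊕ Fin n) (ZMod p) V} (hB : B.IsAlt) (hc : IsStdBasis B c)

theorem finrank_span_inr (c : Module.Basis (Fin n ⊕ Fin n) (ZMod p) V) : Module.finrank (ZMod p)
    (Submodule.span (ZMod p) (Set.range fun a => c (Sum.inr a))) = n := by
  have h := finrank_span_eq_card (c.linearIndependent.comp _ Sum.inr_injective)
  rw [Fintype.card_fin] at h
  exact h

include hB hc in
omit [IsAlgClosed k] in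
-- A subspace transversal to the second half of the basis projects isomorphically to the first half,
-- so it is a graph; isotropy is the symmetry of its matrix.
theorem exists_eq_graph [Module.Finite (ZMod p) V] {D : Submodule k (k ⊗[ZMod p] V)}
    (hD : D ≤ (B.baseChange k).orthogonal D)
    (hDn : Module.finrank k D = n)
    (hinf : D ⊓ (Submodule.span (ZMod p) (Set.range fun a => c (Sum.inr a))).baseChange k = ⊥) :
    ∃ A : Sym2 (Fin n) → k, D = Submodule.span k (Set.range (graphVec c A)) := by
  let π : k ⊗[ZMod p] V →ₗ[k] (Fin n → k) :=
    LinearMap.pi fun a => (c.baseChange k).coord (Sum.inl a)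
  have hπ : ∀ x a, π x a = (c.baseChange k).repr x (Sum.inl a) := fun _ _ => rfl
  obtain ⟨v, hv⟩ := exists_mem_eq_single hDn π fun x hxD hx => by
    have h1 : x ∈ D ⊓
        (Submodule.span (ZMod p) (Set.range fun a => c (Sum.inr a))).baseChange k := by
      refine ⟨hxD, ?_⟩
      rw [← (c.baseChange k).sum_repr x, Fintype.sum_sum_type]
      refine add_mem ?_ (sum_mem fun a _ => Submodule.smul_mem _ _ ?_)
      · rw [Finset.sum_eq_zero fun a _ => ?_]
        · exact zero_mem _
        · rw [← hπ, hx, Pi.zero_apply, zero_smul]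
      · rw [Module.Basis.baseChange_apply]
        exact Submodule.tmul_mem_baseChange_of_mem _ (Submodule.subset_span ⟨a, rfl⟩)
    rw [hinf] at h1
    exact (Submodule.mem_bot k).1 h1
  have hinl : ∀ a b, (c.baseChange k).repr (v a) (Sum.inl b) = Pi.single (M := fun _ => k) a 1 b :=
    fun a b => by rw [← hπ, (hv a).2]
  have hsymm : ∀ a b, (c.baseChange k).repr (v a) (Sum.inr b) =
      (c.baseChange k).repr (v b) (Sum.inr a) := by
    intro a b
    have h1 : B.baseChange k (v a) (v b) = 0 := hD (hv b).1 _ (hv a).1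
    rw [hc.baseChange_apply hB, stdForm] at h1
    simp only [hinl, Finset.sum_sub_distrib] at h1
    simp [Pi.single_apply, sub_eq_zero] at h1
    exact h1.symm
  let A : Sym2 (Fin n) → k :=
    Sym2.lift ⟨fun a b => (c.baseChange k).repr (v a) (Sum.inr b), hsymm⟩
  have hA : ∀ a, graphVec c A a = (v a) := by
    intro a
    refine ext_repr c fun s => ?_
    rw [repr_graphVec]
    rcases s with b | b
    · exact (hinl a b).symm
    · rfl
  refine ⟨A, (eq_of_le_of_finrank_le' (Submodule.span_le.2 ?_) ?_).symm⟩
  · rintro _ ⟨a, rfl⟩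
    rw [hA]
    exact (hv a).1
  · rw [hDn, finrank_span_eq_card (linearIndependent_graphVec c A), Fintype.card_fin]

omit [IsAlgClosed k] in
theorem frobSpace_span_graphVec (A : Sym2 (Fin n) → k) :
    frobSpace (Submodule.span k (Set.range (graphVec c A))) =
      Submodule.span k (Set.range (graphVec c fun s => A s ^ p)) := by
  rw [frobSpace_span, ← Set.range_comp]
  congr 2
  funext a
  exact frob_graphVec c A a

include hB hc in
omit [IsAlgClosed k] in
theorem form_eq_zero_of_mem_frobSpace {A : Sym2 (Fin n) → k} {x : k ⊗[ZMod p] V}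
    (hx : x ∈ frobSpace (Submodule.span k (Set.range (graphVec c A)))) (b : Fin n) :
    B.baseChange k x (graphVec c (fun s => A s ^ p) b) = 0 := by
  rw [frobSpace_span_graphVec] at hx
  exact apply_eq_zero_of_mem_span (fun a => by rw [form_graphVec hB hc, sub_self]) hx

include hB hc in
-- A^(p) - A is the matrix of the pairing between D and Φ D. This pairing vanishes on D ∩ Φ D, as Φ
-- D is isotropic, and D ∩ Φ D has codimension at most one in D. So the matrix has rank at most one,
-- and being symmetric it is x xᵀ.
theorem exists_artinSchreier_eq_mul [Module.Finite (ZMod p) V] (A : Sym2 (Fin n) → k)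
    (hA : n ≤ Module.finrank k ↥(Submodule.span k (Set.range (graphVec c A)) ⊓
      frobSpace (Submodule.span k (Set.range (graphVec c A)))) + 1) :
    ∃ x : Fin n → k, ∀ s, A s ^ p - A s = (s.map x).mul := by
  let D := Submodule.span k (Set.range (graphVec c A))
  have hDn : Module.finrank k D = n := by
    rw [finrank_span_eq_card (linearIndependent_graphVec c A), Fintype.card_fin]
  let T : k ⊗[ZMod p] V →ₗ[k] (Fin n → k) := LinearMap.pi fun b =>
    (B.baseChange k).flip (graphVec c (fun s => A s ^ p) b)
  have hT : ∀ x b, T x b = B.baseChange k x (graphVec c (fun s => A s ^ p) b) := fun _ _ => rfl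
  obtain ⟨w, hw⟩ := exists_smul_of_vanishing (D := D) (D' := frobSpace D)
    (hDn.le.trans hA) T fun x hx =>
      funext fun b => form_eq_zero_of_mem_frobSpace hB hc hx b
  choose l hl using fun a : Fin n => hw (graphVec c A a) (Submodule.subset_span ⟨a, rfl⟩)
  have hl' : ∀ a b, A s(a, b) ^ p - A s(a, b) = l a * w b := by
    intro a b
    have h3 := congrFun (hl a) b
    rw [hT, form_graphVec hB hc] at h3
    exact h3
  obtain ⟨x, hx⟩ := exists_mul_self_eq_of_symmetric (fun a b => A s(a, b) ^ p - A s(a, b))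
    (fun a b => by rw [Sym2.eq_swap]) w l hl'
  refine ⟨x, fun s => ?_⟩
  induction s with
  | _ a b => exact hx a b

omit [IsAlgClosed k] in
theorem sum_graphVec_eq (A : Sym2 (Fin n) → k) (x : Fin n → k)
    (hA : ∀ s, A s ^ p - A s = (s.map x).mul) (y : Fin n → k) (hy : ∑ a, x a * y a = 0) :
    ∑ a, y a • graphVec c A a = ∑ a, y a • graphVec c (fun s => A s ^ p) a := by
  refine ext_repr c fun s => ?_
  rcases s with b | b
  · rw [repr_inl_sum_graphVec, repr_inl_sum_graphVec]
  · simp only [map_sum, map_smul, Finsupp.coe_finsetSum, Finset.sum_apply,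
      Finsupp.smul_apply, repr_graphVec, graphCoord, Sum.elim_inr, smul_eq_mul]
    rw [← sub_eq_zero, ← Finset.sum_sub_distrib]
    have h4 : ∀ a, y a * A s(a, b) - y a * A s(a, b) ^ p = -(x a * y a * x b) := by
      intro a
      have h5 : A s(a, b) ^ p - A s(a, b) = x a * x b := hA s(a, b)
      linear_combination (-y a) * h5
    rw [Finset.sum_congr rfl fun a _ => h4 a, Finset.sum_neg_distrib, ← Finset.sum_mul, hy,
      zero_mul, neg_zero]

include hB hc in
/-- Solutions of `A^(p) - A = x xᵀ` for `x` with `𝔽_p`-independent coordinates. -/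
theorem graph_mem_image_last [Module.Finite (ZMod p) V] {e : Module.Basis (Fin (2 * n)) (ZMod p) V}
    (he : IsSymplecticBasis B e) (A : Sym2 (Fin n) → k) (x : Fin n → k)
    (hA : ∀ s, A s ^ p - A s = (s.map x).mul)
    (hx : ∀ y : Fin n → ZMod p, ∑ a, algebraMap (ZMod p) k (y a) * x a = 0 → y = 0) :
    (graphFrame hB hc A).flag 0 ∈ IsotropicFlag.last '' coxeterDLVariety k B e := by
  let D := Submodule.span k (Set.range (graphVec c A))
  have hD : ((graphFrame hB hc A).flag 0).space 0 = D := (graphFrame hB hc A).flag_last_eq (i := 0)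
  have hC : ∀ a b, B.baseChange k (graphVec c A a) (graphVec c (fun s => A s ^ p) b) =
      x a * x b := by
    intro a b
    rw [form_graphVec hB hc, hA]
    rfl
  have hDn : Module.finrank k D = n := by
    rw [finrank_span_eq_card (linearIndependent_graphVec c A), Fintype.card_fin]
  refine exists_last_eq_of_rationalVectors_eq_bot hB he ?_ ?_
  · change n ≤ Module.finrank k ↥(((graphFrame hB hc A).flag 0).space 0 ⊓
      frobSpace (((graphFrame hB hc A).flag 0).space 0)) + 1
    rw [hD]
    refine le_finrank_add_one (linearIndependent_graphVec c A) x fun y hy => ?_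
    refine ⟨sum_mem fun a _ => Submodule.smul_mem _ _ (Submodule.subset_span ⟨a, rfl⟩), ?_⟩
    rw [sum_graphVec_eq A x hA y hy, SetLike.mem_coe, frobSpace_span_graphVec]
    exact sum_mem fun a _ => Submodule.smul_mem _ _ (Submodule.subset_span ⟨a, rfl⟩)
  · rw [hD, eq_bot_iff]
    intro w hw
    have hw1 : (1 : k) ⊗ₜ[ZMod p] w ∈ D := hw
    obtain ⟨y, hy⟩ := (Submodule.mem_span_range_iff_exists_fun k).1 hw1
    -- A rational vector of D lies in Φ D too, hence pairs to zero with Φ D. With the matrix x xᵀ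
    -- this is an 𝔽_p-linear relation among the coordinates of x, so the vector is zero.
    have hw2 : (1 : k) ⊗ₜ[ZMod p] w ∈ frobSpace D := by
      have := frob_mem_frobSpace hw1
      rwa [frob_tmul, one_pow] at this
    have hyr : ∀ a, y a = algebraMap (ZMod p) k (c.repr w (Sum.inl a)) := by
      intro a
      rw [← repr_inl_sum_graphVec c A y a, hy]
      simp [Algebra.smul_def]
    have hpair : ∀ b, (∑ a, y a * x a) * x b = 0 := by
      intro b
      have h3 := form_eq_zero_of_mem_frobSpace hB hc hw2 b
      rw [← hy, map_sum, LinearMap.sum_apply] at h3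
      rw [Finset.sum_mul, ← h3]
      refine Finset.sum_congr rfl fun a _ => ?_
      rw [map_smul, LinearMap.smul_apply, hC, smul_eq_mul, mul_assoc]
    have hzero : (fun a => c.repr w (Sum.inl a)) = 0 := by
      by_cases h0 : ∃ b, x b ≠ 0
      · obtain ⟨b, hb⟩ := h0
        refine hx _ ?_
        simp only [← hyr]
        exact (mul_eq_zero.1 (hpair b)).resolve_right hb
      · push Not at h0
        exact hx _ (Finset.sum_eq_zero fun a _ => by rw [h0, mul_zero])
    have h1 : (1 : k) ⊗ₜ[ZMod p] w = 0 := by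
      rw [← hy]
      refine Finset.sum_eq_zero fun a _ => ?_
      rw [hyr, congrFun hzero a, Pi.zero_apply, map_zero, zero_smul]
    refine (Submodule.mem_bot (ZMod p)).2 (c.repr.map_eq_zero_iff.1 (Finsupp.ext fun s => ?_))
    have h2 := congrArg (fun z => (c.baseChange k).repr z s) h1
    simpa [Algebra.smul_def] using h2

end Graph

/-! ### Density of the Coxeter variety in S_V -/

section Density

variable {p : ℕ} [Fact p.Prime] {k : Type*} [Field k] [Algebra (ZMod p) k]
  {V : Type*} [AddCommGroup V] [Module (ZMod p) V] {B : LinearMap.BilinForm (ZMod p) V} {n : ℕ}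

theorem graphVec_comp_mem_polyFun (c : Module.Basis (Fin n ⊕ Fin n) (ZMod p) V)
    {f : (Fin n → k ⊗[ZMod p] V) → k} (hf : f ∈ polyFun k (Fin n → k ⊗[ZMod p] V)) :
    (fun A : Sym2 (Fin n) → k => f (graphVec c A)) ∈ polyFun k (Sym2 (Fin n) → k) := by
  let L : (Sym2 (Fin n) → k) →ₗ[k] (Fin n → k ⊗[ZMod p] V) := LinearMap.pi fun a =>
    ∑ b, (LinearMap.proj s(a, b)).smulRight ((c.baseChange k) (Sum.inr b))
  have hL : ∀ A a, L A a = ∑ b, A s(a, b) • (c.baseChange k) (Sum.inr b) := by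
    intro A a
    simp [L]
  have h := polyFun_comp_affine L (graphVec c 0) hf
  have h1 : ∀ A, L A + graphVec c 0 = graphVec c A := by
    intro A
    funext a
    refine ext_repr c fun s => ?_
    rw [Pi.add_apply, map_add, Finsupp.add_apply, repr_graphVec, repr_graphVec, hL]
    rcases s with b | b <;> simp [graphCoord, Finsupp.single_apply]
  simpa only [h1] using h

variable [IsAlgClosed k] (hB : B.IsAlt) (hB' : B.Nondegenerate)
  {e : Module.Basis (Fin (2 * n)) (ZMod p) V} (he : IsSymplecticBasis B e)

include hB hB' he in
-- The basis is chosen so that its first half contains all rational vectors of U. The second half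
-- then contains no nonzero rational vector of U, and therefore meets U only in zero.
theorem exists_flag_eq_graph {U : IsotropicFlag (B.baseChange k) n 0}
    (hU : U ∈ lagrangianVariety k B n) :
    ∃ (c : Module.Basis (Fin n ⊕ Fin n) (ZMod p) V) (hc : IsStdBasis B c)
      (A : Sym2 (Fin n) → k), (graphFrame hB hc A).flag 0 = U := by
  have : Module.Finite (ZMod p) V := Module.Finite.of_basis e
  have hdim : Module.finrank (ZMod p) V = 2 * n := by
    rw [Module.finrank_eq_card_basis e, Fintype.card_fin]
  have hUn : Module.finrank k (U.space 0) = n := by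
    rw [U.finrank_space]
    simp
  have hUo : U.space 0 ≤ (B.baseChange k).orthogonal (U.space 0) :=
    fun x hx y hy => U.isotropic 0 y hy x hx
  obtain ⟨c, hc, hDc⟩ := exists_isStdBasis hB hB' hdim (rationalVectors (U.space 0))
    (fun x hx y hy => by
      have h1 := U.isotropic 0 _ (mem_rationalVectors.1 hy) _ (mem_rationalVectors.1 hx)
      rw [LinearMap.BilinForm.baseChange_tmul] at h1
      change B y x = 0
      simpa [Algebra.smul_def] using h1)
  let M₀ := Submodule.span (ZMod p) (Set.range fun a => c (Sum.inr a))
  have hMiso : M₀.baseChange k ≤ (B.baseChange k).orthogonal (M₀.baseChange k) := by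
    rw [← baseChange_orthogonal hB hB' he]
    refine Submodule.baseChange_mono k fun x hx y hy => ?_
    refine apply_eq_zero_of_mem_span (fun a => ?_) hy
    rw [← hB.neg_eq, neg_eq_zero]
    refine apply_eq_zero_of_mem_span (fun b => ?_) hx
    exact hc.2.1 b a
  have hrat : rationalVectors (U.space 0 ⊓ M₀.baseChange k) = ⊥ := by
    rw [eq_bot_iff]
    intro w hw
    have h1 : w ∈ rationalVectors (U.space 0) := hw.1
    have h2 : w ∈ M₀ := by
      rw [← rationalVectors_baseChange (k := k) M₀]
      exact hw.2
    have hli := (linearIndependent_sum.1 c.linearIndependent).2.2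
    exact Submodule.disjoint_def.1 hli w (hDc h1) h2
  have hinf := inf_eq_bot_of_rationalVectors (nondegenerate_baseChange hB he) hdim hUo hUn hU hMiso
    (by rw [finrank_submodule_baseChange, finrank_span_inr]) (frobSpace_baseChange _) hrat
  obtain ⟨A, hA⟩ := exists_eq_graph hB hc hUo hUn hinf
  refine ⟨c, hc, A, IsotropicFlag.ext (funext fun j => ?_)⟩
  rw [Subsingleton.elim (α := Fin 1) j 0]
  exact ((graphFrame hB hc A).flag_last_eq (i := 0)).trans hA.symm

include hB hB' he in
/-- The image of the Coxeter variety is dense in `S_V`. -/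
theorem lagrangianVariety_subset_closure :
    lagrangianVariety k B n ⊆ closure (IsotropicFlag.last '' coxeterDLVariety k B e) := by
  classical
  have : Module.Finite (ZMod p) V := Module.Finite.of_basis e
  intro U hU
  obtain ⟨c, hc, A₀, rfl⟩ := exists_flag_eq_graph hB hB' he hU
  obtain ⟨x₀, hx₀⟩ := exists_artinSchreier_eq_mul (p := p) hB hc A₀ (by
    have h : Submodule.span k (Set.range (graphVec c A₀)) =
        ((graphFrame hB hc A₀).flag 0).space 0 :=
      ((graphFrame hB hc A₀).flag_last_eq (i := 0)).symm
    rw [h]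
    exact hU)
  refine mem_closure_iff.2 fun O hO hUO => ?_
  obtain ⟨f, hf, hfA, hfO⟩ := (isOpen_induced_zariski_iff (k := k)
    (IsotropicFrame.vec : IsotropicFrame (B.baseChange k) n → _)).1 (isOpen_coinduced.1 hO)
    (graphFrame hB hc A₀) hUO
  obtain ⟨G, hG⟩ := mem_polyFun_pi_iff.1 (graphVec_comp_mem_polyFun c hf)
  have hG' : ∀ A, f (graphVec c A) = MvPolynomial.eval A G := fun A => hG A
  -- The Artin–Schreier map carries the given neighbourhood of A₀ over a neighbourhood of x₀ x₀ᵀ.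
  -- There x₀ is replaced by an x with independent coordinates, the equation A^(p) - A = x xᵀ is
  -- solved, and a translate of A by a matrix over 𝔽_p falls into the given neighbourhood.
  obtain ⟨F, hF, hFG⟩ := exists_artinSchreier_ne_zero (p := p) G A₀ (by rw [← hG']; exact hfA)
  simp only [hx₀] at hF
  obtain ⟨x, hx, hxi⟩ := exists_independent_ne_zero (p := p) F x₀ hF
  choose A hA using fun s : Sym2 (Fin n) => exists_pow_eq_add (p := p) (Sym2.mul (s.map x))
  have hA' : ∀ s, A s ^ p - A s = (s.map x).mul := fun s => by rw [hA]; ring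
  obtain ⟨g, hg⟩ := hFG A (by simpa only [hA'] using hx)
  have hch := charP_of_algebra p k
  refine ⟨_, hfO (graphFrame hB hc fun s => A s + algebraMap (ZMod p) k (g s)) ?_,
    graph_mem_image_last hB hc he _ x (fun s => ?_) hxi⟩
  · rw [← hG'] at hg
    exact hg
  · rw [add_pow_char _ _ p, algebraMap_zmod_pow (g s), ← hA']
    ring

end Density

/-! ### Closed conditions on flags -/

section Closure

variable {k : Type*} [Field k] {E : Type*} [AddCommGroup E] [Module k E] [FiniteDimensional k E]
  {β : LinearMap.BilinForm k E} {m : ℕ} {i : Fin (m + 1)}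

omit [FiniteDimensional k E] in
/-- The condition that a given member of the flag is contained in a given subspace is closed. -/
theorem isClosed_space_le (j : Fin (i.val + 1)) (D : Submodule k E) :
    IsClosed {F : IsotropicFlag β m i | F.space j ≤ D} := by
  refine isOpen_compl_iff.1 (isOpen_coinduced.2
    ((isOpen_induced_zariski_iff (k := k) _).2 fun v hv => ?_))
  have h1 : ∃ a : Fin m, a.val < m - i.val + j.val ∧ v.vec a ∉ D := by
    by_contra! h
    refine hv (Submodule.span_le.2 ?_)
    rintro _ ⟨a, ha, rfl⟩
    exact h a ha
  obtain ⟨a, ha, haD⟩ := h1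
  obtain ⟨g, hg, hgD⟩ := Submodule.exists_le_ker_of_notMem haD
  refine ⟨fun x => g (x a), dual_mem_polyFun (M := Fin m → E) (g.comp (LinearMap.proj a)), hg, fun u hgu hle => ?_⟩
  exact hgu (hgD (hle (Submodule.subset_span ⟨a, ha, rfl⟩)))

/-- The condition that a given subspace is contained in a Lagrangian subspace is closed. -/
theorem isClosed_le_space (ha : β.IsAlt) (hn : β.Nondegenerate)
    (hdim : Module.finrank k E = 2 * m) (D : Submodule k E) :
    IsClosed {U : IsotropicFlag β m 0 | D ≤ U.space 0} := by
  -- A Lagrangian subspace is its own orthogonal, so containing D is the same as being contained in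
  -- D^⊥, which is visibly closed.
  have h1 : {U : IsotropicFlag β m 0 | D ≤ U.space 0} =
      {U : IsotropicFlag β m 0 | U.space 0 ≤ β.orthogonal D} := by
    ext U
    refine ⟨fun h x hx y hy => U.isotropic 0 y (h hy) x hx, fun h x hx => ?_⟩
    have h2 : β.orthogonal (U.space 0) = U.space 0 :=
      orthogonal_eq_self hn (fun x hx y hy => U.isotropic 0 y hy x hx)
        (by rw [U.finrank_space, hdim]; simp)
    rw [← h2]
    intro y hy
    have h3 : β x y = 0 := h hy x hx
    change β y x = 0
    rw [← ha.neg_eq, h3, neg_zero]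
  rw [h1]
  exact isClosed_space_le 0 _

end Closure

/-! ### The closure of the image of X_W -/

section ClosureComponent

variable {p : ℕ} [Fact p.Prime] {k : Type*} [Field k] [Algebra (ZMod p) k] [IsAlgClosed k]
  {V : Type*} [AddCommGroup V] [Module (ZMod p) V] {B : LinearMap.BilinForm (ZMod p) V}
  {m : ℕ} {e : Module.Basis (Fin (2 * m)) (ZMod p) V} {i : Fin (m + 1)}

/-- The last member of a flag in the stratum is a point of `S_V`. -/
theorem last_mem_lagrangianVariety (hB : B.IsAlt) (he : IsSymplecticBasis B e)
    {F : IsotropicFlag (B.baseChange k) m i} (hF : F ∈ stratum k B e i) :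
    F.last ∈ lagrangianVariety k B m := by
  have : Module.Finite (ZMod p) V := Module.Finite.of_basis e
  obtain ⟨h0, hle, -⟩ := (mem_stratum_iff hB he).1 hF
  change m ≤ Module.finrank k ↥(F.space (Fin.last i.val) ⊓ frobSpace (F.space (Fin.last i.val))) + 1
  have hi := i.isLt
  rcases Nat.eq_zero_or_pos i.val with h | h
  · have h1 : Fin.last i.val = 0 := Fin.ext h
    rw [h1, h0, inf_idem, F.finrank_space]
    simp only [Fin.val_zero]
    omega
  · have h1 := hle (i.val - 1) (by omega)
    have h2 : (⟨i.val - 1 + 1, by omega⟩ : Fin (i.val + 1)) = Fin.last i.val :=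
      Fin.ext (by simp only [Fin.val_last]; omega)
    rw [h2] at h1
    have h3 := finrank_mono' (le_inf (F.mono (Fin.le_last (⟨i.val - 1, by omega⟩ : Fin (i.val + 1)))) h1)
    rw [F.finrank_space] at h3
    simp only at h3
    omega

variable {V' : Type*} [AddCommGroup V'] [Module (ZMod p) V'] {W : Submodule (ZMod p) V}
  {B' : LinearMap.BilinForm (ZMod p) V'} {pr : V →ₗ[ZMod p] V'} {sec : V' →ₗ[ZMod p] V}

/-- Containing W ⊗ k is a closed condition, which gives one inclusion. The other transports the
density of the Coxeter variety in S_{W^⊥/W} through the lift from W^⊥/W, a continuous map. -/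
theorem closure_image_component [Module.Finite (ZMod p) V'] [Module.Finite (ZMod p) V]
    (hB : B.IsAlt) (he : IsSymplecticBasis B e)
    (hBV' : B'.IsAlt) (hBn' : B'.Nondegenerate)
    {e' : Module.Basis (Fin (2 * i.val)) (ZMod p) V'} (he' : IsSymplecticBasis B' e')
    (h : IsReduction (B.baseChange k) (W.baseChange k) (B'.baseChange k) (pr.baseChange k)
      (sec.baseChange k)) (hi : Module.finrank k (W.baseChange k) + i.val = m) :
    closure (IsotropicFlag.last '' component k B e i W) ∩ lagrangianVariety k B m =
      lagrangianVarietyOver k B m W := by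
  refine Set.Subset.antisymm ?_ ?_
  · rintro U ⟨hU, hUV⟩
    refine ⟨hUV, ?_⟩
    have hcl := isClosed_le_space (isAlt_baseChange hB) (nondegenerate_baseChange hB he) (m := m)
      (by rw [Module.finrank_baseChange, Module.finrank_eq_card_basis e, Fintype.card_fin])
      (W.baseChange k)
    refine closure_minimal ?_ hcl hU
    rintro _ ⟨F, hF, rfl⟩
    exact (le_of_mem_component hF).trans (F.mono (Fin.zero_le _))
  · intro U hU
    refine ⟨mem_closure_iff.2 fun O hO hUO => ?_, hU.1⟩
    let ψ := h.equiv (c := 0) hi (Nat.succ_pos i.val) (X := lagrangianVarietyOver k B m W)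
      (Y := lagrangianVariety k B' i.val) (fun F hF => hF.2)
      (liftFlag_mem_lagrangianVarietyOver_iff h hi)
    have hcont : Continuous ψ.symm := LiftsToFrames.continuous (h.liftsToFrames_symm _ _ _ _)
    have hO' : IsOpen (ψ.symm ⁻¹' (Subtype.val ⁻¹' O)) :=
      (hO.preimage continuous_subtype_val).preimage hcont
    obtain ⟨O', hO', hOO'⟩ := isOpen_induced_iff.1 hO'
    have hmem : (ψ ⟨U, hU⟩).1 ∈ O' := by
      have h1 : ψ ⟨U, hU⟩ ∈ Subtype.val ⁻¹' O' := by
        rw [hOO']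
        change (ψ.symm (ψ ⟨U, hU⟩)).1 ∈ O
        rw [Equiv.symm_apply_apply]
        exact hUO
      exact h1
    obtain ⟨_, hG1, ⟨G, hG, rfl⟩⟩ := mem_closure_iff.1
      (lagrangianVariety_subset_closure hBV' hBn' he' (ψ ⟨U, hU⟩).2) O' hO' hmem
    have hGl : G.last ∈ lagrangianVariety k B' i.val :=
      last_mem_lagrangianVariety (i := Fin.last i.val) hBV' he' hG
    have h2 : (⟨G.last, hGl⟩ : lagrangianVariety k B' i.val) ∈ ψ.symm ⁻¹' (Subtype.val ⁻¹' O) := by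
      rw [← hOO']
      exact hG1
    refine ⟨_, h2, h.liftFlag hi (Nat.lt_succ_self i.val) G,
      (liftFlag_mem_component_iff hB he hBV' he' h hi G).2 hG, ?_⟩
    rfl

end ClosureComponent

/-! ### Partitions into closed irreducible subsets -/

section Topology

/-- A finite partition into closed irreducible subsets is the partition into irreducible
components. -/
theorem bijOn_irreducibleComponents {Y ι : Type*} [TopologicalSpace Y] (C : ι → Set Y) {s : Set ι}
    (hs : s.Finite) (hC : ∀ w ∈ s, IsClosed (C w)) (hirr : ∀ w ∈ s, IsIrreducible (C w))
    (hdisj : ∀ w ∈ s, ∀ w' ∈ s, ∀ y, y ∈ C w → y ∈ C w' → w = w')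
    (hcov : ∀ y, ∃ w ∈ s, y ∈ C w) : Set.BijOn C s (irreducibleComponents Y) := by
  -- As the partition is finite, each part is open as well. An irreducible subset is connected, so
  -- it lies in a single part.
  have hopen : ∀ w ∈ s, IsClopen (C w) := by
    intro w hw
    refine ⟨hC w hw, ?_⟩
    have h1 : (C w)ᶜ = ⋃ w' ∈ s \ {w}, C w' := by
      ext y
      simp only [Set.mem_compl_iff, Set.mem_iUnion, exists_prop]
      constructor
      · intro hy
        obtain ⟨w', hw', hyw'⟩ := hcov y
        exact ⟨w', ⟨hw', fun h => hy (h ▸ hyw')⟩, hyw'⟩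
      · rintro ⟨w', ⟨hw', hne⟩, hyw'⟩ hy
        exact hne (hdisj w' hw' w hw y hyw' hy)
    rw [← isClosed_compl_iff, h1]
    exact (hs.subset Set.sdiff_subset).isClosed_biUnion fun w' hw' => hC w' hw'.1
  have hsub : ∀ w ∈ s, ∀ Z : Set Y, IsIrreducible Z → (Z ∩ C w).Nonempty → Z ⊆ C w :=
    fun w hw Z hZ h => hZ.isConnected.isPreconnected.subset_isClopen (hopen w hw) h
  refine ⟨fun w hw => ⟨hirr w hw, fun Z hZ hle => ?_⟩, fun w hw w' hw' h => ?_, fun Z hZ => ?_⟩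
  · obtain ⟨y, hy⟩ := (hirr w hw).nonempty
    exact hsub w hw Z hZ ⟨y, hle hy, hy⟩
  · obtain ⟨y, hy⟩ := (hirr w hw).nonempty
    exact hdisj w hw w' hw' y hy (h ▸ hy)
  · obtain ⟨y, hy⟩ := hZ.1.nonempty
    obtain ⟨w, hw, hyw⟩ := hcov y
    have h1 := hsub w hw Z hZ.1 ⟨y, hy, hyw⟩
    exact ⟨w, hw, Set.Subset.antisymm (hZ.2 (hirr w hw) h1) h1⟩

/-- A subset of a subset, as a subspace of either. -/
def preimageValHomeomorph {X : Type*} [TopologicalSpace X] {S T : Set X} (h : T ⊆ S) :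
    (Subtype.val ⁻¹' T : Set S) ≃ₜ T where
  toFun x := ⟨x.1.1, x.2⟩
  invFun x := ⟨⟨x.1, h x.2⟩, x.2⟩
  left_inv _ := rfl
  right_inv _ := rfl
  continuous_toFun := by fun_prop
  continuous_invFun := by fun_prop

theorem isIrreducible_of_homeomorph {X Y : Type*} [TopologicalSpace X] [TopologicalSpace Y]
    [IrreducibleSpace Y] {Z : Set X} (φ : Z ≃ₜ Y) : IsIrreducible Z := by
  have h := (IrreducibleSpace.isIrreducible_univ Y).image (fun y => (φ.symm y).1)
    (continuous_subtype_val.comp φ.symm.continuous).continuousOn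
  have h1 : (fun y => (φ.symm y).1) '' Set.univ = Z := by
    rw [Set.image_univ]
    ext x
    constructor
    · rintro ⟨y, rfl⟩
      exact (φ.symm y).2
    · exact fun hx => ⟨φ ⟨x, hx⟩, by simp⟩
  rwa [h1] at h

end Topology

/-! ### Assembly: the components of the stratum -/

section Main

universe u

variable {p : ℕ} [Fact p.Prime] {k : Type u} [Field k] [Algebra (ZMod p) k] [IsAlgClosed k]
  {V : Type*} [AddCommGroup V] [Module (ZMod p) V] {B : LinearMap.BilinForm (ZMod p) V}
  (hB : B.IsAlt) (hB' : B.Nondegenerate) {m : ℕ} {e : Module.Basis (Fin (2 * m)) (ZMod p) V}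
  (he : IsSymplecticBasis B e) {i : Fin (m + 1)} {W : Submodule (ZMod p) V}

include hB' he in
theorem component_isIsomorphicTo (hW : IsIsotropic B W)
    (hWm : Module.finrank (ZMod p) W = m - i.val)
    {e' : Module.Basis (Fin (2 * i.val)) (ZMod p) (PerpQuot B W)}
    (he' : IsSymplecticBasis (perpQuotForm B hB W) e') :
    IsIsomorphicTo (component k B e i W) (coxeterDLVariety k (perpQuotForm B hB W) e') := by
  have : Module.Finite (ZMod p) V := Module.Finite.of_basis e
  obtain ⟨pr, sec, h⟩ := exists_isReduction hB hW
  have hk := h.baseChange (k := k) hB hB' he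
  have hi : Module.finrank k (W.baseChange k) + i.val = m := by
    rw [finrank_submodule_baseChange, hWm]
    exact Nat.sub_add_cancel (Nat.le_of_lt_succ i.isLt)
  exact isIsomorphicTo_of_lifts
    (hk.equiv hi (Nat.lt_succ_self i.val) (fun F hF => le_of_mem_component hF)
      (liftFlag_mem_component_iff hB he (perpQuotForm_isAlt hB) he' hk hi))
    (hk.liftsToFrames _ _ _ _) (hk.liftsToFrames_symm _ _ _ _)

include hB' he in
theorem closure_component_isIsomorphicTo (hW : IsIsotropic B W)
    (hWm : Module.finrank (ZMod p) W = m - i.val) :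
    IsIsomorphicTo
      (closure (IsotropicFlag.last '' component k B e i W) ∩ lagrangianVariety k B m)
      (lagrangianVariety k (perpQuotForm B hB W) i.val) := by
  have : Module.Finite (ZMod p) V := Module.Finite.of_basis e
  obtain ⟨e', he'⟩ := exists_isSymplecticBasis_perpQuot hB hB' e (Nat.le_of_lt_succ i.isLt) hW hWm
  obtain ⟨pr, sec, h⟩ := exists_isReduction hB hW
  have hk := h.baseChange (k := k) hB hB' he
  have hi : Module.finrank k (W.baseChange k) + i.val = m := by
    rw [finrank_submodule_baseChange, hWm]
    exact Nat.sub_add_cancel (Nat.le_of_lt_succ i.isLt)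
  rw [closure_image_component hB he (perpQuotForm_isAlt hB)
    (h.nondegenerate hB hB' (perpQuotForm_isAlt hB)) he' hk hi]
  exact isIsomorphicTo_of_lifts
    (hk.equiv (c := 0) hi (Nat.succ_pos i.val) (fun F hF => hF.2)
      (liftFlag_mem_lagrangianVarietyOver_iff hk hi))
    (hk.liftsToFrames _ _ _ _) (hk.liftsToFrames_symm _ _ _ _)

include hB hB' he in
theorem component_irreducible_and_krullDim (hp : p ≠ 2) (hW : IsIsotropic B W)
    (hWm : Module.finrank (ZMod p) W = m - i.val) :
    IsIrreducible (Subtype.val ⁻¹' component k B e i W : Set (stratum k B e i)) ∧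
      topologicalKrullDim (Subtype.val ⁻¹' component k B e i W : Set (stratum k B e i)) =
        (i.val : WithBot ℕ∞) := by
  have : Module.Finite (ZMod p) V := Module.Finite.of_basis e
  obtain ⟨e', he'⟩ := exists_isSymplecticBasis_perpQuot hB hB' e (Nat.le_of_lt_succ i.isLt) hW hWm
  obtain ⟨pr, sec, h⟩ := exists_isReduction hB hW
  obtain ⟨φ, -⟩ := component_isIsomorphicTo (k := k) hB hB' he hW hWm he'
  obtain ⟨h1, h2⟩ := irreducibleSpace_coxeterDLVariety_and_krullDim (k := k) hp
    (perpQuotForm_isAlt hB) he' (h.nondegenerate hB hB' (perpQuotForm_isAlt hB))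
  let ψ := (preimageValHomeomorph (S := stratum k B e i) (T := component k B e i W)
    fun F hF => hF.1).trans φ
  exact ⟨isIrreducible_of_homeomorph ψ,
    (IsHomeomorph.topologicalKrullDim_eq _ ψ.isHomeomorph).trans h2⟩

include hB he in
theorem exists_mem_component {F : IsotropicFlag (B.baseChange k) m i} (hF : F ∈ stratum k B e i) :
    ∃ W : Submodule (ZMod p) V, (IsIsotropic B W ∧ Module.finrank (ZMod p) W = m - i.val) ∧
      F ∈ component k B e i W := by
  have : Module.Finite (ZMod p) V := Module.Finite.of_basis e
  have h0 := ((mem_stratum_iff hB he).1 hF).zero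
  have h1 := baseChange_rationalVectors h0.le
  refine ⟨rationalVectors (F.space 0), ⟨fun x hx y hy => ?_, ?_⟩, hF, h1.symm⟩
  · have h2 := F.isotropic 0 _ (mem_rationalVectors.1 hx) _ (mem_rationalVectors.1 hy)
    rw [LinearMap.BilinForm.baseChange_tmul] at h2
    simpa [Algebra.smul_def] using h2
  · rw [← finrank_submodule_baseChange (k := k), h1, F.finrank_space, Fin.val_zero, add_zero]

include hB hB' he in
theorem bijOn_component (hp : p ≠ 2) : Set.BijOn
    (fun W : Submodule (ZMod p) V =>
      (Subtype.val ⁻¹' component k B e i W : Set (stratum k B e i)))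
    {W | IsIsotropic B W ∧ Module.finrank (ZMod p) W = m - i.val}
    (irreducibleComponents (stratum k B e i)) := by
  have : Module.Finite (ZMod p) V := Module.Finite.of_basis e
  have : Finite V := Module.finite_of_finite (ZMod p)
  refine bijOn_irreducibleComponents _ (Set.toFinite _) (fun W hW => ?_)
    (fun W hW => (component_irreducible_and_krullDim hB hB' he hp hW.1 hW.2).1)
    (fun W _ W' _ F hF hF' => ?_) fun F => ?_
  · have h1 : (Subtype.val ⁻¹' component k B e i W : Set (stratum k B e i)) =
        Subtype.val ⁻¹' {F : IsotropicFlag (B.baseChange k) m i | F.space 0 ≤ W.baseChange k} := by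
      ext F
      refine ⟨fun h => h.2.le, fun h => ⟨F.2, eq_of_le_of_finrank_le' h ?_⟩⟩
      rw [finrank_submodule_baseChange, hW.2, F.1.finrank_space]
      exact Nat.le_add_right _ _
    rw [h1]
    exact (isClosed_space_le 0 _).preimage continuous_subtype_val
  · have h1 : W.baseChange k = W'.baseChange k := hF.2.symm.trans hF'.2
    rw [← rationalVectors_baseChange (k := k) W, h1, rationalVectors_baseChange]
  · obtain ⟨W, hW, h⟩ := exists_mem_component hB he F.2
    exact ⟨W, hW, h⟩

end Main

end DLSymplectic
end

theorem mainTheorem6 (p : ℕ) [Fact p.Prime] (hp : p ≠ 2)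
    (k : Type*) [Field k] [Algebra (ZMod p) k] [IsAlgClosure (ZMod p) k]
    (V : Type*) [AddCommGroup V] [Module (ZMod p) V]
    (B : LinearMap.BilinForm (ZMod p) V) (hB : B.IsAlt) (hB' : B.Nondegenerate)
    (m : ℕ) (e : Module.Basis (Fin (2 * m)) (ZMod p) V)
    (he : DLSymplectic.IsSymplecticBasis B e) (i : Fin (m + 1)) :
    -- `S_i` has pure dimension `i`
    (∀ Z ∈ irreducibleComponents (DLSymplectic.stratum k B e i),
      topologicalKrullDim Z = (i.val : WithBot ℕ∞)) ∧
    -- the irreducible components of `S_i` are the `X_W`, without repetition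
    Set.BijOn
      (fun W : Submodule (ZMod p) V =>
        (Subtype.val ⁻¹' DLSymplectic.component k B e i W : Set (DLSymplectic.stratum k B e i)))
      {W | DLSymplectic.IsIsotropic B W ∧ Module.finrank (ZMod p) W = m - i.val}
      (irreducibleComponents (DLSymplectic.stratum k B e i)) ∧
    -- the last member of a flag in `S_i` is a point of `S_V`
    Set.MapsTo DLSymplectic.IsotropicFlag.last (DLSymplectic.stratum k B e i)
      (DLSymplectic.lagrangianVariety k B m) ∧
    ∀ W : Submodule (ZMod p) V, DLSymplectic.IsIsotropic B W →
      Module.finrank (ZMod p) W = m - i.val →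
      -- `W^⊥/W` is a symplectic space of dimension `2i`
      (∃ e' : Module.Basis (Fin (2 * i.val)) (ZMod p) (DLSymplectic.PerpQuot B W),
        DLSymplectic.IsSymplecticBasis (DLSymplectic.perpQuotForm B hB W) e') ∧
      -- `X_W` is isomorphic to the Coxeter Deligne–Lusztig variety of `Sp(W^⊥/W)`
      (∀ e' : Module.Basis (Fin (2 * i.val)) (ZMod p) (DLSymplectic.PerpQuot B W),
        DLSymplectic.IsSymplecticBasis (DLSymplectic.perpQuotForm B hB W) e' →
        DLSymplectic.IsIsomorphicTo (DLSymplectic.component k B e i W)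
          (DLSymplectic.coxeterDLVariety k (DLSymplectic.perpQuotForm B hB W) e')) ∧
      -- the closure of `X_W` in `S_V` is isomorphic to `S_{W^⊥/W}`
      DLSymplectic.IsIsomorphicTo
        (closure (DLSymplectic.IsotropicFlag.last '' DLSymplectic.component k B e i W) ∩
          DLSymplectic.lagrangianVariety k B m)
        (DLSymplectic.lagrangianVariety k (DLSymplectic.perpQuotForm B hB W) i.val) := by
  have := IsAlgClosure.isAlgClosed (R := ZMod p) (K := k)
  have hbij := DLSymplectic.bijOn_component (k := k) hB hB' he (i := i) hp
  refine ⟨fun Z hZ => ?_, hbij, fun F hF => DLSymplectic.last_mem_lagrangianVariety hB he hF,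
    fun W hW hWm => ⟨?_, fun e' he' => ?_, ?_⟩⟩
  · obtain ⟨W, hW, rfl⟩ := hbij.surjOn hZ
    exact (DLSymplectic.component_irreducible_and_krullDim hB hB' he hp hW.1 hW.2).2
  · exact DLSymplectic.exists_isSymplecticBasis_perpQuot hB hB' e (Nat.le_of_lt_succ i.isLt) hW hWm
  · exact DLSymplectic.component_isIsomorphicTo hB hB' he hW hWm he'
  · exact DLSymplectic.closure_component_isIsomorphicTo hB hB' he hW hWm
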